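/- Let $R$ be a field of characteristic $0$ (for example $\mathbb{R}$). Let $\Lambda_{nov}$ be the Novikov ring of formal sums $\sum_i a_iT^{\lambda_i}e^{q_i}$ with $a_i\in R$, $\lambda_i\in\mathbb{R}$, $q_i\in\mathbb{Z}$, $\lambda_i\to\infty$, graded by $\deg T=0$, $\deg e=2$, and let $\Lambda_{0,nov}$ be the subring where all $\lambda_i\ge 0$. All modules are energy-completed free graded modules with a homogeneous basis; $|x|'=|x|-1$ is the shifted degree, and $F^\lambda$ is the energy filtration. *Gapped filtered objects.* A filtered $A_\infty$-algebra $A=(C,\{m_k\}_{k\ge0})$ over $\Lambda_{0,nov}$ (with $m_0(1)\in F^{\lambda'}C$, $\lambda'>0$, possibly non-zero), a filtered $A_\infty$-bimodule $(M,\{n_{k,l}\})$, a filtered $A_\infty$-homomorphism (with $f_0(1)$ of positive energy) are gapped if their operations have the form $\sum_{(\lambda,\mu)\in G}T^\lambda e^{\mu/2}(\cdot)_{(\lambda,\mu)}$ with operations $(\cdot)_{(\lambda,\mu)}$ over $R$ on the spans of the bases, for a submonoid $G\subset\mathbb{R}_{\ge0}\times2\mathbb{Z}$ whose projection to $\mathbb{R}_{\ge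 0}$ is discrete, with $G\cap(\{0\}\times2\mathbb{Z})=\{(0,0)\}$ and with finite fibres over $\mathbb{R}_{\ge 0}$. A filtered $A_\infty$-bimodule homomorphism is a family of degree $0$ maps $\phi_{k,l}$ over $\Lambda_{0,nov}$ preserving the energy filtration and satisfying $\hat\phi\circ\hat d=\hat d\circ\hat\phi$ on the bimodule bar complexes. A weakly filtered one is such a family over $\Lambda_{nov}$, between the modules $M\otimes\Lambda_{nov}$ (completed), that may lower energy by at most a constant $c\ge0$ independent of $k,l$; it is gapped if it is a sum as above over a $G$-set $G'\subset\mathbb{R}\times2\mathbb{Z}$ ($G+G'\subset G'$, projection to $\mathbb{R}$ discrete and bounded below, finite fibres). *Homotopy equivalence.* A model of $[0,1]\times C$ is a gapped filtered $A_\infty$-algebra $\mathfrak{C}$ with gapped homomorphisms $Incl:C\to\mathfrak{C}$, $Eval_0,Eval_1:\mathfrak{C}\to C$ that have only a $k=1$ component, with $Eval_s\circ Incl=id$, with $(Incl)_1$ and $(Eval_s)_1$ inducing cochain homotopy equivalences of the reduced complexes $(\overline{C},\overline{m}_1)$, $(\overline{\mathfrak{C}},\overline{m}_1)$ over $R$,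 and with $(Eval_0)_1\oplus(Eval_1)_1$ surjective. A model of $[0,1]\times M$ over models $\mathfrak C_1,\mathfrak C_0$ is a gapped filtered $(\mathfrak{C}_1,\mathfrak{C}_0)$-bimodule $\mathfrak{M}$ with gapped filtered bimodule homomorphisms $Incl$, $Eval_0$, $Eval_1$ over those of the algebras, having only a $(0,0)$ component, with $Eval_s\circ Incl=id$, $(Eval_0)_{0,0}\oplus(Eval_1)_{0,0}$ split surjective, and $(Incl)_{0,0}$ inducing a cochain homotopy equivalence of the reduced $\overline{n}_{0,0}$-complexes. Two filtered $A_\infty$-homomorphisms $C\to C'$ are homotopic if they are $Eval_0\circ\mathfrak{F}$ and $Eval_1\circ\mathfrak{F}$ for a gapped $\mathfrak{F}:C\to\mathfrak{C}'$ into a model of $[0,1]\times C'$. Two (weakly) filtered bimodule homomorphisms $M\to M'$ are homotopic if they are $Eval_0\circ\Phi$ and $Eval_1\circ\Phi$ for a (weakly) filtered bimodule homomorphism $\Phi:M\to\mathfrak{M}'$ into a model of $[0,1]\times M'$, over such homotopies $\mathfrak{F}_1,\mathfrak{F}_0$ of the underlying algebra homomorphisms. A (weakly) filtered $\phi:M\to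 M'$ over $(f_1,f_0)$ is a homotopy equivalence if there are gapped homotopy inverses $g_i$ of $f_i$ and a (weakly) filtered $\psi:M'\to M$ over $(g_1,g_0)$ with $\phi\circ\psi$ and $\psi\circ\phi$ homotopic to the identity. *Homologies.* For an $A$-bimodule $M$, the Hochschild complex $C_\bullet(A,M)$ is the energy completion of $\bigoplus_kM[1]\otimes C[1]^{\otimes k}$, graded by $|v|'+\sum_i|x_i|'$ (and $\deg e=2$), with $$d(v\otimes x_1\cdots x_k)=(-1)^{|v|'}v\otimes\hat d(x_1\cdots x_k)+\sum_{i+j\le k}(-1)^{\epsilon}\,n_{i,j}(x_{k-i+1},\dots,x_k,v,x_1,\dots,x_j)\otimes x_{j+1}\cdots x_{k-i},$$ $$\epsilon=\Big(\sum_{s>k-i}|x_s|'\Big)\Big(|v|'+\sum_{t\le k-i}|x_t|'\Big),$$ where $\hat d$ is the bar differential; its homology is $H_\bullet(A,M)$. A bimodule homomorphism $\phi$ over $(id,id)$ induces $\phi_*$ on $C_\bullet$ by the second sum with $\phi_{i,j}$ in place of $n_{i,j}$. Let $E_kC\subset C[1]^{\otimes k}$ be the elements fixed by the (Koszul-signed)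 action of $S_k$, and let $\tilde A=(C,\{l_k\})$, $l_k=m_k|_{E_kC}$, be the induced $L_\infty$-algebra. The induced $L_\infty$-bimodule $M$ has structure maps $\eta_k$ on $M[1]\otimes E_kC$, the symmetrization of $n$: $\eta_k(v\otimes x_1\cdots x_k)=\sum_{p+q=k}(-1)^{|v|'(|x_1|'+\cdots+|x_p|')}n_{p,q}(x_1,\dots,x_p,v,x_{p+1},\dots,x_k)$, extended linearly to $E_kC$. The Chevalley–Eilenberg complex $CE_\bullet(\tilde A,M)$ is the energy completion of $\bigoplus_kM[1]\otimes E_kC$ with $$d^{CE}(v\otimes[x_1,\dots,x_k])=\sum_{j}\sum_{\sigma}\pm\,\eta_j(v\otimes[x_{\sigma(1)},\dots,x_{\sigma(j)}])\otimes[x_{\sigma(j+1)},\dots,x_{\sigma(k)}]+\sum_j\sum_\sigma\pm\,v\otimes[l_j([x_{\sigma(1)},\dots,x_{\sigma(j)}]),x_{\sigma(j+1)},\dots,x_{\sigma(k)}],$$ $\sigma$ running over the $(j,k-j)$-shuffles, with Koszul signs; its homology is $H^{CE}_\bullet(\tilde A,M)$. The map induced by $\phi$ is the first sum with the symmetrization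 of $\phi$ in place of $\eta$. **Proposition.** Let $M$ and $N$ be gapped filtered $A_\infty$-bimodules over a gapped filtered $A_\infty$-algebra $A$, and let $\phi:M\to N$ be a filtered or weakly filtered gapped $A_\infty$-bimodule homomorphism over $(id_A,id_A)$ which is a homotopy equivalence. Then, with coefficients in $\Lambda_{nov}$, $\phi$ induces isomorphisms in every degree $$\phi_*:H_\bullet(A,M)\cong H_\bullet(A,N),\qquad \phi_*:H^{CE}_\bullet(\tilde A,M)\cong H^{CE}_\bullet(\tilde A,N).$$ If $\phi$ is filtered (with filtered inverse and filtered homotopies), the same holds with coefficients in $\Lambda_{0,nov}$. -/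

import Mathlib

open scoped LaurentPolynomial Pointwise

universe u v

noncomputable section

namespace GappedAInf

/-- A set of energies that is finite below every energy level. -/
def LocFin (s : Set ℝ) : Prop := ∀ E : ℝ, (s ∩ Set.Iic E).Finite

theorem LocFin.mono {s t : Set ℝ} (ht : LocFin t) (h : s ⊆ t) : LocFin s :=
  fun E => (ht E).subset (Set.inter_subset_inter_left _ h)

theorem LocFin.union {s t : Set ℝ} (hs : LocFin s) (ht : LocFin t) : LocFin (s ∪ t) := by
  intro E
  rw [Set.union_inter_distrib_right]
  exact (hs E).union (ht E)

theorem LocFin.of_finite {s : Set ℝ} (h : s.Finite) : LocFin s :=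
  fun _ => h.subset Set.inter_subset_left

theorem LocFin.bddBelow {s : Set ℝ} (hs : LocFin s) : BddBelow s := by
  rcases s.eq_empty_or_nonempty with rfl | ⟨a, ha⟩
  · exact bddBelow_empty
  · obtain ⟨b, hb⟩ := (hs a).bddBelow
    refine ⟨min a b, fun x hx => ?_⟩
    rcases le_total x a with h | h
    · exact (min_le_right _ _).trans (hb ⟨hx, h⟩)
    · exact (min_le_left _ _).trans h

theorem LocFin.isPWO {s : Set ℝ} (hs : LocFin s) : s.IsPWO := by
  rw [Set.isPWO_iff_isWF, Set.isWF_iff_no_descending_seq]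
  intro f hf hmem
  have h1 : Set.range f ⊆ s ∩ Set.Iic (f 0) := by
    rintro _ ⟨n, rfl⟩
    exact ⟨hmem n, hf.antitone (Nat.zero_le n)⟩
  exact Set.infinite_range_of_injective hf.injective ((hs (f 0)).subset h1)

theorem LocFin.add {s t : Set ℝ} (hs : LocFin s) (ht : LocFin t) : LocFin (s + t) := by
  intro E
  obtain ⟨a, ha⟩ := hs.bddBelow
  obtain ⟨b, hb⟩ := ht.bddBelow
  refine ((hs (E - b)).add (ht (E - a))).subset ?_
  rintro _ ⟨⟨x, hx, y, hy, rfl⟩, hE⟩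
  have h1 := ha hx
  have h2 := hb hy
  simp only [Set.mem_Iic] at hE
  exact Set.add_mem_add ⟨hx, by simp only [Set.mem_Iic]; linarith⟩
    ⟨hy, by simp only [Set.mem_Iic]; linarith⟩

/-- The Novikov ring `Λ_nov` over `R`: formal sums `∑ aᵢ T^{λᵢ} e^{qᵢ}` with `λᵢ → ∞`. They are the
Hahn series in `T` with real exponents and coefficients in `R[e, e⁻¹]` (`e` is the variable of the
Laurent polynomials) whose set of exponents is finite below every energy level. -/
def Novikov (R : Type v) [Field R] : Subring (HahnSeries ℝ R[T;T⁻¹]) where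
  carrier := {a | LocFin a.support}
  mul_mem' ha hb := (LocFin.add ha hb).mono HahnSeries.support_mul_subset
  one_mem' := LocFin.of_finite (by rw [HahnSeries.support_one]; exact Set.finite_singleton 0)
  add_mem' ha hb := (LocFin.union ha hb).mono (HahnSeries.support_add_subset _ _)
  zero_mem' := LocFin.of_finite (by simp)
  neg_mem' {a} ha := by
    simpa only [Set.mem_ofPred_eq, HahnSeries.support_neg] using ha

instance (R : Type v) [Field R] : CommRing (Novikov R) := inferInstance
instance (R : Type v) [Field R] : Semiring (Novikov R) := inferInstance

/-- The completion, with respect to the energy filtration, of the free `Λ_nov`-module with basis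
`X`: formal sums `∑ T^{λᵢ} vᵢ` with `λᵢ → ∞` and `vᵢ` in the free `R[e, e⁻¹]`-module on `X`.
The function sends `t` to the coefficient of `T^t`. -/
def Nov (R : Type v) [Field R] (X : Type u) : Type (max u v) :=
  {c : ℝ → X →₀ R[T;T⁻¹] // LocFin {t | c t ≠ 0}}

namespace Nov

variable {R : Type v} [Field R] {X Y Z : Type u}

/-- The coefficient of `T^t`. -/
def co (z : Nov R X) (t : ℝ) : X →₀ R[T;T⁻¹] := z.1 t

theorem locFin_co (z : Nov R X) : LocFin {t | z.co t ≠ 0} := z.2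

/-- The element with given coefficients. -/
def mk (c : ℝ → X →₀ R[T;T⁻¹]) (hc : LocFin {t | c t ≠ 0}) : Nov R X := ⟨c, hc⟩

@[simp] theorem co_mk (c : ℝ → X →₀ R[T;T⁻¹]) (hc) (t : ℝ) : (mk c hc).co t = c t := rfl

/-- The coefficient in `R` of `T^t e^q x`. -/
def coef (z : Nov R X) (t : ℝ) (x : X) (q : ℤ) : R := (z.co t x).coeff q

@[ext] theorem ext' {z z' : Nov R X} (h : ∀ t, z.co t = z'.co t) : z = z' :=
  Subtype.ext (funext h)

instance : AddCommGroup (Nov R X) :=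
  inferInstanceAs (AddCommGroup (show AddSubgroup (ℝ → X →₀ R[T;T⁻¹]) from
    { carrier := {c | LocFin {t | c t ≠ 0}}
      add_mem' := fun {a b} ha hb => (LocFin.union ha hb).mono (by
        intro t ht
        simp only [Pi.add_apply, ne_eq, Set.mem_ofPred_eq, Set.mem_union] at ht ⊢
        by_contra! h
        exact ht (by rw [h.1, h.2, add_zero]))
      zero_mem' := LocFin.of_finite (by simp)
      neg_mem' := fun {a} ha => by
        refine LocFin.mono (t := {t | a t ≠ 0}) ha fun t ht => ?_
        simpa only [Set.mem_ofPred_eq, Pi.neg_apply, ne_eq, neg_eq_zero] using ht }))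

instance : AddCommMonoid (Nov R X) := inferInstance

@[simp] theorem co_zero (t : ℝ) : (0 : Nov R X).co t = 0 := rfl
@[simp] theorem co_add (z z' : Nov R X) (t : ℝ) : (z + z').co t = z.co t + z'.co t := rfl
@[simp] theorem co_neg (z : Nov R X) (t : ℝ) : (-z).co t = -z.co t := rfl

/-- An element regarded as a Hahn series with coefficients in the free `R[e, e⁻¹]`-module. -/
def toHahn : Nov R X →+ HahnModule ℝ R[T;T⁻¹] (X →₀ R[T;T⁻¹]) where
  toFun z := HahnModule.of R[T;T⁻¹] ⟨z.1, z.2.isPWO⟩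
  map_zero' := rfl
  map_add' _ _ := rfl

theorem toHahn_injective : Function.Injective (toHahn : Nov R X →+ _) := by
  intro z z' h
  ext1 t
  exact congrArg (fun w => ((HahnModule.of R[T;T⁻¹]).symm w).coeff t) h

/-- Multiplication of series. -/
instance : SMul (Novikov R) (Nov R X) where
  smul a z := ⟨((HahnModule.of R[T;T⁻¹]).symm (a.1 • toHahn z)).coeff, (a.2.add z.2).mono (by
    have h := HahnModule.support_smul_subset_vadd_support (x := a.1) (y := toHahn z)
    exact h)⟩

instance : Module (Novikov R) (Nov R X) :=
  Function.Injective.module (Novikov R) toHahn toHahn_injective (fun _ _ => rfl)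

theorem co_smul (a : Novikov R) (z : Nov R X) (t : ℝ) :
    (a • z).co t = ∑ᶠ s : ℝ, a.1.coeff s • z.co (t - s) := by
  have h1 : (a • z).co t = _ := HahnModule.coeff_smul a.1 (toHahn z) t
  rw [h1, finsum_eq_sum_of_support_subset (s := (Finset.VAddAntidiagonal t
    (Set.VAddAntidiagonal.finite_of_isPWO a.1.isPWO_support
      ((HahnModule.of R[T;T⁻¹]).symm (toHahn z)).isPWO_support t)).image Prod.fst)]
  · rw [Finset.sum_image]
    · refine Finset.sum_congr rfl ?_
      rintro ⟨i, j⟩ hij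
      rw [Finset.mem_vaddAntidiagonal] at hij
      have : t - i = j := by
        have := hij.2.2
        simp only [vadd_eq_add] at this
        linarith
      simp only [this]
      rfl
    · rintro ⟨i, j⟩ hij ⟨i', j'⟩ hij' h
      simp only [Finset.mem_coe, Finset.mem_vaddAntidiagonal, vadd_eq_add] at hij hij'
      simp only at h
      ext
      · exact h
      · simp only; linarith [hij.2.2, hij'.2.2]
  · intro s hs
    rw [Function.mem_support] at hs
    simp only [Finset.coe_image, Set.mem_image, Finset.mem_coe, Finset.mem_vaddAntidiagonal]
    refine ⟨(s, t - s), ⟨?_, ?_, ?_⟩, rfl⟩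
    · intro h; exact hs (by rw [h, zero_smul])
    · intro h; exact hs (by
        have : z.co (t - s) = 0 := h
        rw [this, smul_zero])
    · simp

/-- Membership in the `E`-th step `F^E` of the energy filtration. -/
def MemF (E : ℝ) (z : Nov R X) : Prop := ∀ t, z.co t ≠ 0 → E ≤ t

/-- The `R[e, e⁻¹]`-linear map that is the coefficient of `T^t` in the `Λ_nov`-linear map with
values `φ` on the basis. -/
def coeffMap (φ : X → Nov R Y) (t : ℝ) : (X →₀ R[T;T⁻¹]) →ₗ[R[T;T⁻¹]] (Y →₀ R[T;T⁻¹]) :=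
  Finsupp.linearCombination R[T;T⁻¹] fun x => (φ x).co t

theorem coeffMap_eq_zero {φ : X → Nov R Y} {c : ℝ} (hφ : ∀ x, MemF c (φ x)) {t : ℝ} (h : t < c) :
    coeffMap φ t = 0 := by
  have : (fun x => (φ x).co t) = 0 := by
    funext x
    by_contra hx
    exact absurd (hφ x t hx) (not_le.2 h)
  rw [coeffMap, this, Finsupp.linearCombination_zero]

theorem finite_support_lift {φ : X → Nov R Y} {c : ℝ} (hφ : ∀ x, MemF c (φ x)) (z : Nov R X)
    (t : ℝ) : (Function.support fun s => coeffMap φ (t - s) (z.co s)).Finite := by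
  refine (z.2 (t - c)).subset fun s hs => ?_
  rw [Function.mem_support] at hs
  refine ⟨fun h => hs ?_, ?_⟩
  · have : z.co s = 0 := h
    rw [this, map_zero]
  · by_contra h
    rw [Set.mem_Iic, not_le] at h
    exact hs (by rw [coeffMap_eq_zero hφ (by linarith), LinearMap.zero_apply])

theorem exists_ne_zero_of_finsum_ne_zero' {ι M : Type*} [AddCommMonoid M] {f : ι → M}
    (h : ∑ᶠ i, f i ≠ 0) : ∃ i, f i ≠ 0 := by
  by_contra! h'
  exact h (finsum_eq_zero_of_forall_eq_zero h')

theorem locFin_lift {φ : X → Nov R Y} {c : ℝ} (hφ : ∀ x, MemF c (φ x)) (z : Nov R X) :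
    LocFin {t | ∑ᶠ s : ℝ, coeffMap φ (t - s) (z.co s) ≠ 0} := by
  intro E
  have hfin : (⋃ s ∈ {s | z.1 s ≠ 0} ∩ Set.Iic (E - c), ⋃ x ∈ ((z.co s).support : Set X),
      (fun r => s + r) '' ({r | (φ x).1 r ≠ 0} ∩ Set.Iic (E - s))).Finite :=
    (z.2 (E - c)).biUnion fun s _ => (Finset.finite_toSet _).biUnion fun x _ =>
      ((φ x).2 (E - s)).image _
  refine hfin.subset ?_
  rintro t ⟨ht, htE⟩
  rw [Set.mem_Iic] at htE
  obtain ⟨s, hs⟩ := exists_ne_zero_of_finsum_ne_zero' ht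
  have hz : z.co s ≠ 0 := fun h => hs (by rw [h, map_zero])
  have hx : ∃ x ∈ (z.co s).support, (φ x).co (t - s) ≠ 0 := by
    by_contra! h
    refine hs ?_
    rw [coeffMap, Finsupp.linearCombination_apply, Finsupp.sum]
    exact Finset.sum_eq_zero fun x hx => by rw [h x hx, smul_zero]
  obtain ⟨x, hx, hxt⟩ := hx
  have h1 := hφ x _ hxt
  simp only [Set.mem_iUnion]
  refine ⟨s, ⟨hz, ?_⟩, x, hx, t - s, ⟨hxt, ?_⟩, by ring⟩
  · simp only [Set.mem_Iic]; linarith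
  · simp only [Set.mem_Iic]; linarith

theorem lift_smul {φ : X → Nov R Y} {c : ℝ} (hφ : ∀ x, MemF c (φ x)) (a : Novikov R)
    (z : Nov R X) (t : ℝ) :
    ∑ᶠ s : ℝ, coeffMap φ (t - s) ((a • z).co s) =
      ∑ᶠ r : ℝ, a.1.coeff r • ∑ᶠ s : ℝ, coeffMap φ (t - r - s) (z.co s) := by
  obtain ⟨a₀, ha₀⟩ := LocFin.bddBelow a.2
  obtain ⟨u₀, hu₀⟩ := LocFin.bddBelow z.2
  set A : Finset ℝ := (a.2 (t - c - u₀)).toFinset with hA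
  set U : Finset ℝ := (z.2 (t - c - a₀)).toFinset with hU
  have memA : ∀ r, r ∈ A ↔ a.1.coeff r ≠ 0 ∧ r ≤ t - c - u₀ := fun r => by
    rw [hA, Set.Finite.mem_toFinset]; rfl
  have memU : ∀ s, s ∈ U ↔ z.co s ≠ 0 ∧ s ≤ t - c - a₀ := fun s => by
    rw [hU, Set.Finite.mem_toFinset]; rfl
  have boundA : ∀ r, a.1.coeff r ≠ 0 → a₀ ≤ r := fun r hr => ha₀ hr
  have boundU : ∀ s, z.co s ≠ 0 → u₀ ≤ s := fun s hs => hu₀ hs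
  trans ∑ r ∈ A, ∑ u ∈ U, a.1.coeff r • coeffMap φ (t - r - u) (z.co u)
  · have hterm : ∀ s, coeffMap φ (t - s) ((a • z).co s) =
        ∑ r ∈ A, if s - r ∈ U then a.1.coeff r • coeffMap φ (t - s) (z.co (s - r)) else 0 := by
      intro s
      rcases lt_or_ge (t - s) c with h | h
      · rw [coeffMap_eq_zero hφ h]
        simp
      · rw [co_smul, finsum_eq_sum_of_support_subset (s := A), map_sum]
        · refine Finset.sum_congr rfl fun r hr => ?_
          split_ifs with hs
          · rw [map_smul]
          · have : z.co (s - r) = 0 := by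
              by_contra hne
              have := boundA r ((memA r).1 hr).1
              exact hs ((memU _).2 ⟨hne, by linarith⟩)
            rw [this, smul_zero, map_zero]
        · intro r hr
          rw [Function.mem_support] at hr
          have h1 : a.1.coeff r ≠ 0 := fun h => hr (by rw [h, zero_smul])
          have h2 : z.co (s - r) ≠ 0 := fun h => hr (by rw [h, smul_zero])
          have := boundU _ h2
          exact Finset.mem_coe.2 ((memA r).2 ⟨h1, by linarith⟩)
    rw [finsum_congr hterm, finsum_sum_comm]
    · refine Finset.sum_congr rfl fun r hr => ?_
      rw [finsum_eq_sum_of_support_subset (s := U.image fun u => u + r)]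
      · rw [Finset.sum_image fun u _ u' _ h => by simpa using h]
        refine Finset.sum_congr rfl fun u hu => ?_
        rw [add_sub_cancel_right, if_pos hu]
        congr 3
        ring
      · intro s hs
        rw [Function.mem_support] at hs
        have : s - r ∈ U := by
          by_contra h
          exact hs (if_neg h)
        exact Finset.mem_coe.2 (Finset.mem_image.2 ⟨s - r, this, by ring⟩)
    · intro r hr
      refine (U.image fun u => u + r).finite_toSet.subset fun s hs => ?_
      rw [Function.mem_support] at hs
      have : s - r ∈ U := by
        by_contra h
        exact hs (if_neg h)
      exact Finset.mem_coe.2 (Finset.mem_image.2 ⟨s - r, this, by ring⟩)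
  · have hterm : ∀ r, a.1.coeff r ≠ 0 → ∑ᶠ s : ℝ, coeffMap φ (t - r - s) (z.co s) =
        ∑ u ∈ U, coeffMap φ (t - r - u) (z.co u) := by
      intro r hr
      refine finsum_eq_sum_of_support_subset _ fun s hs => ?_
      rw [Function.mem_support] at hs
      have h1 : z.co s ≠ 0 := fun h => hs (by rw [h, map_zero])
      refine Finset.mem_coe.2 ((memU s).2 ⟨h1, ?_⟩)
      by_contra h
      have := boundA r hr
      exact hs (by rw [coeffMap_eq_zero hφ (by linarith), LinearMap.zero_apply])
    symm
    rw [finsum_eq_sum_of_support_subset (s := A)]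
    · refine Finset.sum_congr rfl fun r hr => ?_
      rw [hterm r ((memA r).1 hr).1, Finset.smul_sum]
    · intro r hr
      rw [Function.mem_support] at hr
      have h1 : a.1.coeff r ≠ 0 := fun h => hr (by rw [h, zero_smul])
      refine Finset.mem_coe.2 ((memA r).2 ⟨h1, ?_⟩)
      by_contra h
      refine hr ?_
      rw [finsum_eq_zero_of_forall_eq_zero, smul_zero]
      intro s
      by_cases hs : z.co s = 0
      · rw [hs, map_zero]
      · have := boundU s hs
        rw [coeffMap_eq_zero hφ (by linarith), LinearMap.zero_apply]

open Classical in
/-- The continuous `Λ_nov`-linear map of completed free modules with prescribed values on the basis;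
the values have to lie in a common step of the energy filtration (otherwise the result is `0`). -/
def lift (φ : X → Nov R Y) : Nov R X →ₗ[Novikov R] Nov R Y :=
  if h : ∃ c : ℝ, ∀ x, MemF c (φ x) then
    { toFun := fun z =>
        mk (fun t => ∑ᶠ s : ℝ, coeffMap φ (t - s) (z.co s)) (locFin_lift h.choose_spec z)
      map_add' := fun z z' => by
        ext1 t
        rw [co_add, co_mk, co_mk, co_mk, ← finsum_add_distrib (finite_support_lift h.choose_spec z t)
          (finite_support_lift h.choose_spec z' t)]
        exact finsum_congr fun s => by rw [co_add, map_add]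
      map_smul' := fun a z => by
        ext1 t
        rw [RingHom.id_apply, co_smul]
        simp only [co_mk]
        exact lift_smul h.choose_spec a z t }
  else 0

theorem co_lift {φ : X → Nov R Y} {c : ℝ} (hφ : ∀ x, MemF c (φ x)) (z : Nov R X) (t : ℝ) :
    (lift φ z).co t = ∑ᶠ s : ℝ, coeffMap φ (t - s) (z.co s) := by
  have h : ∃ c : ℝ, ∀ x, MemF c (φ x) := ⟨c, hφ⟩
  rw [lift, dif_pos h]
  rfl

/-- The basis element `x`. -/
def basis (x : X) : Nov R X :=
  mk (Pi.single 0 (Finsupp.single x 1)) <| LocFin.of_finite ((Set.finite_singleton 0).subset fun t ht => by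
    by_contra h
    exact ht (Pi.single_eq_of_ne h _))

/-- The map of completed free modules induced by a map of bases. -/
def map (g : X → Y) : Nov R X →ₗ[Novikov R] Nov R Y := lift fun x => basis (g x)

theorem co_basis (x : X) (t : ℝ) :
    (basis x : Nov R X).co t = if t = 0 then Finsupp.single x 1 else 0 := by
  change (Pi.single 0 (Finsupp.single x 1) : ℝ → X →₀ R[T;T⁻¹]) t = _
  rw [Pi.single_apply]

theorem memF_basis (x : X) : MemF 0 (basis x : Nov R X) := by
  intro t ht
  rw [co_basis] at ht
  by_contra h
  exact ht (if_neg (by rintro rfl; exact h le_rfl))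

theorem lift_basis {φ : X → Nov R Y} {c : ℝ} (hφ : ∀ x, MemF c (φ x)) (x : X) :
    lift φ (basis x) = φ x := by
  ext1 t
  rw [co_lift hφ, finsum_eq_single _ 0]
  · rw [co_basis, if_pos rfl, sub_zero, coeffMap, Finsupp.linearCombination_single, one_smul]
  · intro s hs
    rw [co_basis, if_neg hs, map_zero]

theorem map_basis (g : X → Y) (x : X) : map g (basis x : Nov R X) = basis (g x) :=
  lift_basis (c := 0) (fun _ => memF_basis _) x

theorem lift_basis_eq_id : lift (basis : X → Nov R X) = LinearMap.id := by
  refine LinearMap.ext fun z => ?_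
  ext1 t
  rw [co_lift (c := 0) (fun _ => memF_basis _), finsum_eq_single _ t]
  · simp only [sub_self, coeffMap, co_basis, if_true, LinearMap.id_apply]
    rw [Finsupp.linearCombination_apply]
    simp [Finsupp.smul_single]
  · intro s hs
    have : coeffMap (basis : X → Nov R X) (t - s) = 0 := by
      have h0 : (fun x : X => (basis x : Nov R X).co (t - s)) = 0 := by
        funext x
        rw [co_basis, if_neg (sub_ne_zero.2 hs.symm)]
        rfl
      rw [coeffMap, h0, Finsupp.linearCombination_zero]
    rw [this, LinearMap.zero_apply]

theorem locFin_seriesSum {u : ℕ → Nov R X} (h : ∀ E : ℝ, {n | ¬ MemF E (u n)}.Finite) :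
    LocFin {t | ∑ᶠ n, (u n).co t ≠ 0} := by
  intro E
  refine ((h (E + 1)).biUnion fun n _ => (u n).2 E).subset ?_
  rintro t ⟨ht, htE⟩
  obtain ⟨n, hn⟩ := exists_ne_zero_of_finsum_ne_zero' ht
  rw [Set.mem_Iic] at htE
  simp only [Set.mem_iUnion]
  refine ⟨n, fun hF => ?_, hn, htE⟩
  have := hF t hn
  linarith

open Classical in
/-- The sum of a sequence that tends to `0` in the energy filtration (and `0` for other
sequences). -/
def seriesSum (u : ℕ → Nov R X) : Nov R X :=
  if h : ∀ E : ℝ, {n | ¬ MemF E (u n)}.Finite then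
    mk (fun t => ∑ᶠ n, (u n).co t) (locFin_seriesSum h)
  else 0

theorem seriesSum_eq_single {u : ℕ → Nov R X} (k : ℕ) (hu : ∀ n, n ≠ k → u n = 0) :
    seriesSum u = u k := by
  have h : ∀ E : ℝ, {n | ¬ MemF E (u n)}.Finite := fun E =>
    (Set.finite_singleton k).subset fun n hn => by
      by_contra hne
      exact hn (by rw [hu n hne]; intro t ht; exact absurd (co_zero t) ht)
  rw [seriesSum, dif_pos h]
  ext1 t
  rw [co_mk]
  exact finsum_eq_single _ k fun n hn => by rw [hu n hn, co_zero]

/-- Homogeneous elements of degree `n`, when the basis element `x` has degree `d x`, `e` has degree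
`2` and `T` has degree `0`. -/
def IsHomog (d : X → ℤ) (n : ℤ) (z : Nov R X) : Prop :=
  ∀ t x q, z.coef t x q ≠ 0 → d x + 2 * q = n

/-- The reduction modulo `Λ₀⁺` of a map given on the basis: the coefficients of
`T^0 e^0`. -/
def red (φ : X → Nov R Y) : (X →₀ R) →ₗ[R] (Y →₀ R) :=
  Finsupp.linearCombination R fun x => ((φ x).co 0).mapRange (fun p => p.coeff 0) rfl

end Nov

open Nov

section Words

variable {R : Type v} [Field R] {X Y Z : Type u}

/-- The degree of a word. -/
def wdeg (d : X → ℤ) (w : List X) : ℤ := (w.map d).sum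

/-- The sign `(-1)^n`. -/
def sgn (n : ℤ) : ℤ := (n.negOnePow : ℤ)

/-- The coderivation of the tensor coalgebra defined by `m = (m_k)_{k ≥ 0}`, on words:
`x₁ ⋯ xₙ ↦ ∑ ± x₁ ⋯ xᵢ m_j(xᵢ₊₁, …, xᵢ₊ⱼ) xᵢ₊ⱼ₊₁ ⋯ xₙ` with sign `(-1)^{|x₁|' + ⋯ + |xᵢ|'}`. -/
def barOp (d : X → ℤ) (m : List X → Nov R X) (w : List X) : Nov R (List X) :=
  ∑ i ∈ Finset.range (w.length + 1), ∑ j ∈ Finset.range (w.length + 1 - i),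
    sgn (wdeg d (w.take i)) •
      map (fun y => w.take i ++ y :: w.drop (i + j)) (m ((w.drop i).take j))

/-- Concatenation, the (completed) tensor product of two elements of the tensor coalgebra. -/
def conc (z z' : Nov R (List X)) : Nov R (List X) := lift (fun a => map (fun b => a ++ b) z') z

/-- `∑ f(w₁) ⊗ ⋯ ⊗ f(wₙ)` over all ways of cutting `w` into `n` consecutive, possibly empty,
blocks. -/
def blocks (f : List X → Nov R Y) : ℕ → List X → Nov R (List Y)
  | 0, [] => basis []
  | 0, _ :: _ => 0
  | n + 1, w => ∑ i ∈ Finset.range (w.length + 1),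
      conc (map (fun y => [y]) (f (w.take i))) (blocks f n (w.drop i))

/-- The coalgebra map defined by `f = (f_k)_{k ≥ 0}`, on words: `w ↦ ∑ f(w₁) ⊗ ⋯ ⊗ f(wₙ)` over all
`n` and all ways of cutting `w` into `n` consecutive, possibly empty, blocks. -/
def hatOp (f : List X → Nov R Y) (w : List X) : Nov R (List Y) := seriesSum fun n => blocks f n w

end Words

/-- The conditions on the monoid of pairs `(λ, q)` that index the terms `T^λ e^q` of a gapped
operation. As `e` has degree `2`, the pair `(λ, q)` stands for `(λ, μ) = (λ, 2q)` in
`ℝ_{≥ 0} × 2ℤ`. -/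
structure IsGapMonoid (G : AddSubmonoid (ℝ × ℤ)) : Prop where
  nonneg : ∀ g ∈ G, 0 ≤ g.1
  discrete : IsDiscrete (Prod.fst '' (G : Set (ℝ × ℤ)))
  energy_zero : ∀ g ∈ G, g.1 = 0 → g = 0
  fibre_finite : ∀ t : ℝ, {q : ℤ | (t, q) ∈ G}.Finite

/-- A `G`-set: the index set of the terms `T^λ e^q` of a gapped map that may lose energy. -/
structure IsGapSet (G : AddSubmonoid (ℝ × ℤ)) (S : Set (ℝ × ℤ)) : Prop where
  add_mem : ∀ g ∈ G, ∀ s ∈ S, g + s ∈ S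
  bddBelow : BddBelow (Prod.fst '' S)
  discrete : IsDiscrete (Prod.fst '' S)
  fibre_finite : ∀ t : ℝ, {q : ℤ | (t, q) ∈ S}.Finite

/-- A filtered `A_∞`-algebra over `Λ_{0,nov}` whose underlying module is the completed free graded
module with homogeneous basis `ι`. The operation `m_k` is given by its values on words of length `k`
in the basis. -/
structure AInfAlgebra (R : Type v) [Field R] where
  ι : Type u
  deg : ι → ℤ
  m : List ι → Nov R ι
  filtered : ∀ w, MemF 0 (m w)
  curvature_pos : ∃ c > 0, MemF c (m [])
  degree_one : ∀ w, IsHomog (fun i => deg i - 1) (wdeg (fun i => deg i - 1) w + 1) (m w)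
  sq_zero : lift (barOp (fun i => deg i - 1) m) ∘ₗ lift (barOp (fun i => deg i - 1) m) = 0

namespace AInfAlgebra

variable {R : Type v} [Field R]

/-- The shifted degree `|x|' = |x| - 1`. -/
def sdeg (C : AInfAlgebra.{u} R) (i : C.ι) : ℤ := C.deg i - 1

/-- The shifted degree of a word. -/
def wd (C : AInfAlgebra.{u} R) (w : List C.ι) : ℤ := wdeg C.sdeg w

/-- The completed bar coalgebra. -/
abbrev Bar (C : AInfAlgebra.{u} R) : Type (max u v) := Nov R (List C.ι)

/-- The bar differential on words. -/
def dWord (C : AInfAlgebra.{u} R) (w : List C.ι) : C.Bar := barOp C.sdeg C.m w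

/-- The bar differential. -/
def d (C : AInfAlgebra.{u} R) : C.Bar →ₗ[Novikov R] C.Bar := lift C.dWord

/-- `m_k = ∑_{(λ, q) ∈ G} T^λ e^q m_{k,(λ,q)}` for some gapping monoid `G`. -/
def IsGapped (C : AInfAlgebra.{u} R) : Prop :=
  ∃ G : AddSubmonoid (ℝ × ℤ), IsGapMonoid G ∧ ∀ w t i q, (C.m w).coef t i q ≠ 0 → (t, q) ∈ G

end AInfAlgebra

/-- A filtered `A_∞`-homomorphism. -/
structure AInfHom {R : Type v} [Field R] (C C' : AInfAlgebra.{u} R) where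
  f : List C.ι → Nov R C'.ι
  filtered : ∀ w, MemF 0 (f w)
  zero_pos : ∃ c > 0, MemF c (f [])
  degree_zero : ∀ w, IsHomog C'.sdeg (C.wd w) (f w)
  comm : C'.d ∘ₗ lift (hatOp f) = lift (hatOp f) ∘ₗ C.d

namespace AInfHom

variable {R : Type v} [Field R] {C C' : AInfAlgebra.{u} R}

/-- The induced map of bar coalgebras. -/
def hat (f : AInfHom C C') : C.Bar →ₗ[Novikov R] C'.Bar := lift (hatOp f.f)

/-- `f_k = ∑_{(λ, q) ∈ G} T^λ e^q f_{k,(λ,q)}` for some gapping monoid `G`. -/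
def IsGapped (f : AInfHom C C') : Prop :=
  ∃ G : AddSubmonoid (ℝ × ℤ), IsGapMonoid G ∧ ∀ w t i q, (f.f w).coef t i q ≠ 0 → (t, q) ∈ G

/-- `f_k = 0` for `k ≠ 1`. -/
def IsLinear (f : AInfHom C C') : Prop := ∀ w, w.length ≠ 1 → f.f w = 0

end AInfHom

section Identity

variable {R : Type v} [Field R] {X : Type u}

/-- The components of the identity homomorphism. -/
def idWord : List X → Nov R X
  | [x] => basis x
  | _ => 0

theorem memF_zero {E : ℝ} : MemF E (0 : Nov R X) := fun t ht => absurd (co_zero t) ht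

theorem conc_zero_left (z : Nov R (List X)) : conc 0 z = 0 := by rw [conc, map_zero]

theorem blocks_idWord (n : ℕ) (w : List X) :
    blocks (idWord : List X → Nov R X) n w = if n = w.length then basis w else 0 := by
  induction n generalizing w with
  | zero => cases w <;> simp [blocks]
  | succ n ih =>
    rw [blocks]
    cases w with
    | nil => simp [idWord, conc_zero_left]
    | cons x w =>
      rw [Finset.sum_eq_single 1]
      · simp only [List.take_succ_cons, List.take_zero, idWord, List.drop_succ_cons, List.drop_zero,
          ih, map_basis, List.length_cons, add_left_inj]
        rw [conc]
        have hb : ∀ a : List X, MemF 0 (map (fun b => a ++ b)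
            (if n = w.length then basis w else 0 : Nov R (List X))) := by
          intro a
          split_ifs
          · rw [map_basis]; exact memF_basis _
          · rw [map_zero]; exact memF_zero
        rw [lift_basis hb]
        split_ifs
        · rw [map_basis]; rfl
        · rw [map_zero]
      · intro i hmem hi
        have : idWord ((x :: w).take i) = (0 : Nov R X) := by
          match i, hi, hmem with
          | 0, _, _ => rfl
          | i + 2, _, hmem =>
            cases w with
            | nil => simp at hmem
            | cons y w => rfl
        rw [this, map_zero, conc_zero_left]
      · intro h
        exact absurd (Finset.mem_range.2 (by simp)) h

theorem hatOp_idWord : hatOp (idWord : List X → Nov R X) = basis := by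
  funext w
  rw [hatOp, seriesSum_eq_single w.length]
  · rw [blocks_idWord, if_pos rfl]
  · intro n hn
    rw [blocks_idWord, if_neg hn]

end Identity

/-- The identity homomorphism. -/
def AInfHom.id {R : Type v} [Field R] (C : AInfAlgebra.{u} R) : AInfHom C C where
  f := idWord
  filtered w := by
    unfold idWord
    split
    · exact memF_basis _
    · exact memF_zero
  zero_pos := ⟨1, one_pos, memF_zero⟩
  degree_zero w := by
    unfold idWord
    split
    · rename_i x
      intro t y q h
      classical
      rw [coef, co_basis] at h
      split_ifs at h with ht
      · rw [Finsupp.single_apply] at h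
        split_ifs at h with hxy
        · subst hxy
          have hq : q = 0 := by
            by_contra hq
            refine h ?_
            rw [AddMonoidAlgebra.one_def, AddMonoidAlgebra.coeff_single, Finsupp.single_apply,
              if_neg (Ne.symm hq)]
          simp [hq, AInfAlgebra.wd, wdeg]
        · exact absurd rfl h
      · exact absurd rfl h
    · intro t y q h
      exact absurd rfl h
  comm := by rw [hatOp_idWord, lift_basis_eq_id, LinearMap.comp_id, LinearMap.id_comp]

theorem AInfHom.hat_id {R : Type v} [Field R] (C : AInfAlgebra.{u} R) :
    (AInfHom.id C).hat = LinearMap.id := by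
  rw [AInfHom.hat, AInfHom.id, hatOp_idWord, lift_basis_eq_id]


/-! ### Bimodules -/

section BimodWords

variable {R : Type v} [Field R] {X₁ J X₀ Y₁ K Y₀ : Type u}

/-- The tensor product of an element of a tensor coalgebra, a module element and an element of a
tensor coalgebra. -/
def tri (a : Nov R (List Y₁)) (b : Nov R K) (c : Nov R (List Y₀)) :
    Nov R (List Y₁ × K × List Y₀) :=
  lift.{u, v} (fun x => lift.{u, v} (fun y => map.{u, v} (fun z => (x, y, z)) c) b) a

/-- The differential of the bimodule bar complex, on words `x₁ ⋯ xₖ ⊗ y ⊗ z₁ ⋯ zₗ`. -/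
def bimodOp (d₁ : X₁ → ℤ) (dJ : J → ℤ) (d₀ : X₀ → ℤ) (m₁ : List X₁ → Nov R X₁)
    (m₀ : List X₀ → Nov R X₀) (n : List X₁ → J → List X₀ → Nov R J) :
    List X₁ × J × List X₀ → Nov R (List X₁ × J × List X₀) := fun (x, y, z) =>
  map (fun x' => (x', y, z)) (barOp d₁ m₁ x) +
  (∑ i ∈ Finset.range (x.length + 1), ∑ j ∈ Finset.range (z.length + 1),
    sgn (wdeg d₁ (x.take i)) •
      map (fun y' => (x.take i, y', z.drop j)) (n (x.drop i) y (z.take j))) +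
  sgn (wdeg d₁ x + dJ y) • map (fun z' => (x, y, z')) (barOp d₀ m₀ z)

/-- The map of bimodule bar complexes defined by `φ` over `f₁`, `f₀`, on words. -/
def bimodHatOp (f₁ : List X₁ → Nov R Y₁) (f₀ : List X₀ → Nov R Y₀)
    (φ : List X₁ → J → List X₀ → Nov R K) :
    List X₁ × J × List X₀ → Nov R (List Y₁ × K × List Y₀) := fun (x, y, z) =>
  ∑ i ∈ Finset.range (x.length + 1), ∑ j ∈ Finset.range (z.length + 1),
    tri (hatOp f₁ (x.take i)) (φ (x.drop i) y (z.take j)) (hatOp f₀ (z.drop j))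

end BimodWords

/-- A filtered `A_∞`-bimodule over `(C₁, C₀)` whose underlying module is the completed free graded
module with homogeneous basis `ι`. -/
structure AInfBimod {R : Type v} [Field R] (C₁ C₀ : AInfAlgebra.{u} R) where
  ι : Type u
  deg : ι → ℤ
  n : List C₁.ι → ι → List C₀.ι → Nov R ι
  filtered : ∀ x y z, MemF 0 (n x y z)
  degree_one : ∀ x y z,
    IsHomog (fun i => deg i - 1) (C₁.wd x + (deg y - 1) + C₀.wd z + 1) (n x y z)
  sq_zero : lift (bimodOp C₁.sdeg (fun i => deg i - 1) C₀.sdeg C₁.m C₀.m n) ∘ₗ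
    lift (bimodOp C₁.sdeg (fun i => deg i - 1) C₀.sdeg C₁.m C₀.m n) = 0

namespace AInfBimod

variable {R : Type v} [Field R] {C₁ C₀ : AInfAlgebra.{u} R}

/-- The shifted degree. -/
def sdeg (M : AInfBimod C₁ C₀) (i : M.ι) : ℤ := M.deg i - 1

/-- The completed bimodule bar complex, as a module over `Λ_nov`. -/
abbrev Bar (M : AInfBimod C₁ C₀) : Type (max u v) := Nov R (List C₁.ι × M.ι × List C₀.ι)

/-- The differential of the bimodule bar complex. -/
def d (M : AInfBimod C₁ C₀) : M.Bar →ₗ[Novikov R] M.Bar :=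
  lift (bimodOp C₁.sdeg M.sdeg C₀.sdeg C₁.m C₀.m M.n)

/-- `n_{k,l} = ∑_{(λ, q) ∈ G} T^λ e^q n_{k,l,(λ,q)}` for some gapping monoid `G`. -/
def IsGapped (M : AInfBimod C₁ C₀) : Prop :=
  ∃ G : AddSubmonoid (ℝ × ℤ), IsGapMonoid G ∧
    ∀ x y z t i q, (M.n x y z).coef t i q ≠ 0 → (t, q) ∈ G

end AInfBimod

/-- The two kinds of bimodule homomorphisms. -/
inductive HomKind
  | filtered
  | weaklyFiltered

/-- The energy losses allowed. -/
def HomKind.Allows : HomKind → ℝ → Prop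
  | .filtered, c => c = 0
  | .weaklyFiltered, c => 0 ≤ c

/-- A filtered or weakly filtered `A_∞`-bimodule homomorphism over `(f₁, f₀)`. A weakly filtered one
is defined over `Λ_nov` and loses at most a fixed amount `c` of energy; `c = 0` in the filtered
case, where the homomorphism is defined over `Λ_{0,nov}`. -/
structure BimodHom {R : Type v} [Field R] (κ : HomKind) {C₁ C₀ C₁' C₀' : AInfAlgebra.{u} R}
    (M : AInfBimod C₁ C₀) (M' : AInfBimod C₁' C₀') (f₁ : AInfHom C₁ C₁') (f₀ : AInfHom C₀ C₀') where
  φ : List C₁.ι → M.ι → List C₀.ι → Nov R M'.ι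
  energy_loss : ∃ c, κ.Allows c ∧ ∀ x y z, MemF (-c) (φ x y z)
  degree_zero : ∀ x y z, IsHomog M'.sdeg (C₁.wd x + M.sdeg y + C₀.wd z) (φ x y z)
  comm : M'.d ∘ₗ lift (bimodHatOp f₁.f f₀.f φ) = lift (bimodHatOp f₁.f f₀.f φ) ∘ₗ M.d

namespace BimodHom

variable {R : Type v} [Field R] {κ : HomKind} {C₁ C₀ C₁' C₀' : AInfAlgebra.{u} R}
  {M : AInfBimod C₁ C₀} {M' : AInfBimod C₁' C₀'} {f₁ : AInfHom C₁ C₁'} {f₀ : AInfHom C₀ C₀'}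

/-- The induced map of bimodule bar complexes. -/
def hat (φ : BimodHom κ M M' f₁ f₀) : M.Bar →ₗ[Novikov R] M'.Bar :=
  lift (bimodHatOp f₁.f f₀.f φ.φ)

/-- `φ_{k,l} = ∑_{(λ, q) ∈ S} T^λ e^q φ_{k,l,(λ,q)}`, where `S` is a gapping monoid in the filtered
case and a `G`-set for some gapping monoid `G` in the weakly filtered case. -/
def IsGapped (φ : BimodHom κ M M' f₁ f₀) : Prop :=
  ∃ (G : AddSubmonoid (ℝ × ℤ)) (S : Set (ℝ × ℤ)), IsGapMonoid G ∧
    (match κ with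
      | .filtered => S = G
      | .weaklyFiltered => IsGapSet G S) ∧
    ∀ x y z t i q, (φ.φ x y z).coef t i q ≠ 0 → (t, q) ∈ S

/-- `φ_{k,l} = 0` for `(k, l) ≠ (0, 0)`. -/
def IsLinear (φ : BimodHom κ M M' f₁ f₀) : Prop :=
  ∀ x y z, (x, z) ≠ ([], []) → φ.φ x y z = 0

end BimodHom

/-! ### Homotopies -/

section Homotopy

variable {R : Type v} [Field R]

/-- An `R`-linear map of graded vector spaces with homogeneous bases that has degree `k`. -/
def HasDegree {X Y : Type u} (dX : X → ℤ) (dY : Y → ℤ) (k : ℤ)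
    (u : (X →₀ R) →ₗ[R] (Y →₀ R)) : Prop :=
  ∀ x y, u (Finsupp.single x 1) y ≠ 0 → dY y = dX x + k

/-- `u` is a homotopy equivalence of cochain complexes `(X, δ) → (Y, δ')`. -/
def IsCochainHomotopyEquiv {X Y : Type u} (dX : X → ℤ) (dY : Y → ℤ) (δ : (X →₀ R) →ₗ[R] (X →₀ R))
    (δ' : (Y →₀ R) →ₗ[R] (Y →₀ R)) (u : (X →₀ R) →ₗ[R] (Y →₀ R)) : Prop :=
  HasDegree dX dY 0 u ∧ u ∘ₗ δ = δ' ∘ₗ u ∧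
  ∃ (w : (Y →₀ R) →ₗ[R] (X →₀ R)) (h : (X →₀ R) →ₗ[R] (X →₀ R)) (h' : (Y →₀ R) →ₗ[R] (Y →₀ R)),
    HasDegree dY dX 0 w ∧ HasDegree dX dX (-1) h ∧ HasDegree dY dY (-1) h' ∧
    w ∘ₗ δ' = δ ∘ₗ w ∧
    w ∘ₗ u - LinearMap.id = δ ∘ₗ h + h ∘ₗ δ ∧
    u ∘ₗ w - LinearMap.id = δ' ∘ₗ h' + h' ∘ₗ δ'

/-- The reduced differential `m̄₁`. -/
def AInfAlgebra.redDiff (C : AInfAlgebra.{u} R) : (C.ι →₀ R) →ₗ[R] (C.ι →₀ R) :=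
  red fun i => C.m [i]

/-- The reduction of `f₁`. -/
def AInfHom.redLin {C C' : AInfAlgebra.{u} R} (f : AInfHom C C') : (C.ι →₀ R) →ₗ[R] (C'.ι →₀ R) :=
  red fun i => f.f [i]

/-- The component `f₁` of an `A_∞`-homomorphism. -/
def AInfHom.lin {C C' : AInfAlgebra.{u} R} (f : AInfHom C C') :
    Nov R C.ι →ₗ[Novikov R] Nov R C'.ι :=
  lift fun i => f.f [i]

/-- The reduced differential `n̄_{0,0}`. -/
def AInfBimod.redDiff {C₁ C₀ : AInfAlgebra.{u} R} (M : AInfBimod C₁ C₀) :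
    (M.ι →₀ R) →ₗ[R] (M.ι →₀ R) :=
  red fun y => M.n [] y []

/-- The component `φ_{0,0}` of a bimodule homomorphism. -/
def BimodHom.lin {κ : HomKind} {C₁ C₀ C₁' C₀' : AInfAlgebra.{u} R} {M : AInfBimod C₁ C₀}
    {M' : AInfBimod C₁' C₀'} {f₁ : AInfHom C₁ C₁'} {f₀ : AInfHom C₀ C₀'}
    (φ : BimodHom κ M M' f₁ f₀) : Nov R M.ι →ₗ[Novikov R] Nov R M'.ι :=
  lift fun y => φ.φ [] y []

/-- The reduction of `φ_{0,0}`. -/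
def BimodHom.redLin {κ : HomKind} {C₁ C₀ C₁' C₀' : AInfAlgebra.{u} R} {M : AInfBimod C₁ C₀}
    {M' : AInfBimod C₁' C₀'} {f₁ : AInfHom C₁ C₁'} {f₀ : AInfHom C₀ C₀'}
    (φ : BimodHom κ M M' f₁ f₀) : (M.ι →₀ R) →ₗ[R] (M'.ι →₀ R) :=
  red fun y => φ.φ [] y []

/-- A (gapped) model of `[0, 1] × C`; `ev 0` and `ev 1` are the evaluations at `s = 0` and
`s = 1`. -/
structure AInfAlgebra.Model (C : AInfAlgebra.{u} R) where
  alg : AInfAlgebra.{u} R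
  incl : AInfHom C alg
  ev : Fin 2 → AInfHom alg C
  alg_gapped : alg.IsGapped
  incl_gapped : incl.IsGapped
  ev_gapped : ∀ s, (ev s).IsGapped
  incl_linear : incl.IsLinear
  ev_linear : ∀ s, (ev s).IsLinear
  ev_incl : ∀ s, (ev s).hat ∘ₗ incl.hat = LinearMap.id
  incl_equiv : IsCochainHomotopyEquiv C.deg alg.deg C.redDiff alg.redDiff incl.redLin
  ev_equiv : ∀ s, IsCochainHomotopyEquiv alg.deg C.deg alg.redDiff C.redDiff (ev s).redLin
  ev_surjective : ∀ a b : Nov R C.ι, MemF 0 a → MemF 0 b →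
    ∃ z : Nov R alg.ι, MemF 0 z ∧ (ev 0).lin z = a ∧ (ev 1).lin z = b

/-- A (gapped) model of `[0, 1] × M`, over models of `[0, 1] × C₁` and `[0, 1] × C₀`. The splitting
of `(ev 0) ⊕ (ev 1)` is given by its restrictions `σ₀`, `σ₁` to the two summands. -/
structure AInfBimod.Model {C₁ C₀ : AInfAlgebra.{u} R} (M : AInfBimod C₁ C₀) (𝔠₁ : C₁.Model)
    (𝔠₀ : C₀.Model) where
  mod : AInfBimod 𝔠₁.alg 𝔠₀.alg
  incl : BimodHom .filtered M mod 𝔠₁.incl 𝔠₀.incl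
  ev : ∀ s, BimodHom .filtered mod M (𝔠₁.ev s) (𝔠₀.ev s)
  mod_gapped : mod.IsGapped
  incl_gapped : incl.IsGapped
  ev_gapped : ∀ s, (ev s).IsGapped
  incl_linear : incl.IsLinear
  ev_linear : ∀ s, (ev s).IsLinear
  ev_incl : ∀ s, (ev s).hat ∘ₗ incl.hat = LinearMap.id
  ev_split : ∃ σ₀ σ₁ : M.ι → Nov R mod.ι, (∀ y, MemF 0 (σ₀ y) ∧ MemF 0 (σ₁ y)) ∧
    (ev 0).lin ∘ₗ lift σ₀ = LinearMap.id ∧ (ev 1).lin ∘ₗ lift σ₀ = 0 ∧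
    (ev 0).lin ∘ₗ lift σ₁ = 0 ∧ (ev 1).lin ∘ₗ lift σ₁ = LinearMap.id
  incl_equiv : IsCochainHomotopyEquiv M.deg mod.deg M.redDiff mod.redDiff incl.redLin

/-- `F` is a (gapped) homotopy between the `A_∞`-homomorphisms with bar coalgebra maps `u` and
`v`. -/
def IsAInfHomotopy {C C' : AInfAlgebra.{u} R} {𝔠 : C'.Model} (F : AInfHom C 𝔠.alg)
    (u v : C.Bar →ₗ[Novikov R] C'.Bar) : Prop :=
  F.IsGapped ∧ (𝔠.ev 0).hat ∘ₗ F.hat = u ∧ (𝔠.ev 1).hat ∘ₗ F.hat = v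

/-- The `A_∞`-homomorphisms with bar coalgebra maps `u` and `v` are homotopic. -/
def AInfHomotopic {C C' : AInfAlgebra.{u} R} (u v : C.Bar →ₗ[Novikov R] C'.Bar) : Prop :=
  ∃ (𝔠 : C'.Model) (F : AInfHom C 𝔠.alg), IsAInfHomotopy F u v

/-- `g` is a homotopy inverse of `f`. -/
def AInfHom.IsHomotopyInverse {C C' : AInfAlgebra.{u} R} (f : AInfHom C C') (g : AInfHom C' C) :
    Prop :=
  g.IsGapped ∧ AInfHomotopic (f.hat ∘ₗ g.hat) LinearMap.id ∧
    AInfHomotopic (g.hat ∘ₗ f.hat) LinearMap.id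

/-- The `A_∞`-bimodule homomorphisms with maps `α` and `β` of bimodule bar complexes, over
`A_∞`-homomorphisms with bar coalgebra maps `(u₁, u₀)` and `(v₁, v₀)`, are homotopic. -/
def BimodHomotopic (κ : HomKind) {C₁ C₀ C₁' C₀' : AInfAlgebra.{u} R} {M : AInfBimod C₁ C₀}
    {M' : AInfBimod C₁' C₀'} (u₁ v₁ : C₁.Bar →ₗ[Novikov R] C₁'.Bar)
    (u₀ v₀ : C₀.Bar →ₗ[Novikov R] C₀'.Bar) (α β : M.Bar →ₗ[Novikov R] M'.Bar) : Prop :=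
  ∃ (𝔠₁ : C₁'.Model) (𝔠₀ : C₀'.Model) (𝔪 : M'.Model 𝔠₁ 𝔠₀) (F₁ : AInfHom C₁ 𝔠₁.alg)
    (F₀ : AInfHom C₀ 𝔠₀.alg) (Φ : BimodHom κ M 𝔪.mod F₁ F₀),
    IsAInfHomotopy F₁ u₁ v₁ ∧ IsAInfHomotopy F₀ u₀ v₀ ∧
    (𝔪.ev 0).hat ∘ₗ Φ.hat = α ∧ (𝔪.ev 1).hat ∘ₗ Φ.hat = β

/-- A (weakly) filtered `A_∞`-bimodule homomorphism is a homotopy equivalence. -/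
def BimodHom.IsHomotopyEquiv {κ : HomKind} {C₁ C₀ C₁' C₀' : AInfAlgebra.{u} R}
    {M : AInfBimod C₁ C₀} {M' : AInfBimod C₁' C₀'} {f₁ : AInfHom C₁ C₁'} {f₀ : AInfHom C₀ C₀'}
    (φ : BimodHom κ M M' f₁ f₀) : Prop :=
  ∃ (g₁ : AInfHom C₁' C₁) (g₀ : AInfHom C₀' C₀) (ψ : BimodHom κ M' M g₁ g₀),
    f₁.IsHomotopyInverse g₁ ∧ f₀.IsHomotopyInverse g₀ ∧
    BimodHomotopic κ (f₁.hat ∘ₗ g₁.hat) LinearMap.id (f₀.hat ∘ₗ g₀.hat) LinearMap.id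
      (φ.hat ∘ₗ ψ.hat) LinearMap.id ∧
    BimodHomotopic κ (g₁.hat ∘ₗ f₁.hat) LinearMap.id (g₀.hat ∘ₗ f₀.hat) LinearMap.id
      (ψ.hat ∘ₗ φ.hat) LinearMap.id

end Homotopy

/-! ### Homology -/

/-- The coefficient rings `Λ_{0,nov}` and `Λ_nov`. -/
inductive Coeffs
  | nov₀
  | nov

section Homology

variable {R : Type v} [Field R]

/-- The part of degree `0` (that is, without `e`) of `Λ_{0,nov}` or `Λ_nov`. -/
def degZero (R : Type v) [Field R] (k : Coeffs) : Subring (Novikov R) where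
  carrier := {a | (∀ t, a.1.coeff t ∈ (LaurentPolynomial.C : R →+* R[T;T⁻¹]).range) ∧
    (k = .nov₀ → ∀ t, a.1.coeff t ≠ 0 → 0 ≤ t)}
  mul_mem' {a b} ha hb := by
    refine ⟨fun t => ?_, fun hk t ht => ?_⟩
    · change (a.1 * b.1).coeff t ∈ _
      rw [HahnSeries.coeff_mul]
      exact sum_mem fun p _ => mul_mem (ha.1 _) (hb.1 _)
    · obtain ⟨r, hr, s, hs, rfl⟩ := HahnSeries.support_mul_subset (x := a.1) (y := b.1) ht
      exact add_nonneg (ha.2 hk r hr) (hb.2 hk s hs)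
  one_mem' := by
    refine ⟨fun t => ?_, fun _ t ht => ?_⟩
    · change (1 : HahnSeries ℝ R[T;T⁻¹]).coeff t ∈ _
      rw [HahnSeries.coeff_one]
      split_ifs
      · exact one_mem _
      · exact zero_mem _
    · by_contra h
      refine ht ?_
      change (1 : HahnSeries ℝ R[T;T⁻¹]).coeff t = 0
      rw [HahnSeries.coeff_one, if_neg (by rintro rfl; exact h le_rfl)]
  add_mem' {a b} ha hb := by
    refine ⟨fun t => add_mem (ha.1 t) (hb.1 t), fun hk t ht => ?_⟩
    by_contra h
    have h1 : a.1.coeff t = 0 := by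
      by_contra h1; exact h (ha.2 hk t h1)
    have h2 : b.1.coeff t = 0 := by
      by_contra h2; exact h (hb.2 hk t h2)
    refine ht ?_
    change a.1.coeff t + b.1.coeff t = 0
    rw [h1, h2, add_zero]
  zero_mem' := ⟨fun t => zero_mem _, fun _ t ht => absurd rfl ht⟩
  neg_mem' {a} ha := by
    refine ⟨fun t => neg_mem (ha.1 t), fun hk t ht => ha.2 hk t fun h => ht ?_⟩
    change -a.1.coeff t = 0
    rw [h, neg_zero]

instance (k : Coeffs) : Ring (degZero R k) := inferInstance
instance (k : Coeffs) : Semiring (degZero R k) := inferInstance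
instance (X : Type u) (k : Coeffs) : Module (degZero R k) (Nov R X) := inferInstance

instance {X Y : Type u} (k : Coeffs) :
    LinearMap.CompatibleSMul (Nov R X) (Nov R Y) (degZero R k) (Novikov R) :=
  ⟨fun f a z => f.map_smul (a : Novikov R) z⟩

/-- A graded complex of completed `Λ_nov`-modules: the closed submodule `sub` of the completed free
module on the homogeneous basis `X`, with the operator `d` of degree `1`. For the complexes below,
`d ∘ d = 0` on `sub` follows from the `A_∞`-relations; homology is defined as
`ker d / (im d ∩ ker d)`. -/
structure Cplx (R : Type v) [Field R] where
  X : Type u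
  deg : X → ℤ
  sub : Submodule (Novikov R) (Nov R X)
  d : Nov R X →ₗ[Novikov R] Nov R X

namespace Cplx

/-- The chains of degree `n` with coefficients in `Λ_{0,nov}` or `Λ_nov`. -/
def chains (K : Cplx.{u} R) (k : Coeffs) (n : ℤ) : Submodule (degZero R k) (Nov R K.X) where
  carrier := {z | z ∈ K.sub ∧ IsHomog K.deg n z ∧ (k = .nov₀ → MemF 0 z)}
  add_mem' {y z} hy hz := by
    refine ⟨add_mem hy.1 hz.1, fun t x q h => ?_, fun hk t ht => ?_⟩
    · by_cases h1 : y.coef t x q = 0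
      · refine hz.2.1 t x q fun h2 => h ?_
        change y.coef t x q + z.coef t x q = 0
        rw [h1, h2, add_zero]
      · exact hy.2.1 t x q h1
    · by_cases h1 : y.co t = 0
      · refine hz.2.2 hk t fun h2 => ht ?_
        rw [co_add, h1, h2, add_zero]
      · exact hy.2.2 hk t h1
  zero_mem' := ⟨zero_mem _, fun t x q h => absurd rfl h, fun _ => memF_zero⟩
  smul_mem' a z hz := by
    refine ⟨K.sub.smul_mem a.1 hz.1, fun t x q h => ?_, fun hk t ht => ?_⟩
    · by_contra hne
      refine h ?_
      change ((a.1 • z).co t x).coeff q = 0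
      rw [co_smul]
      refine finsum_induction (p := fun v : K.X →₀ R[T;T⁻¹] => (v x).coeff q = 0) rfl ?_ ?_
      · intro v w hv hw
        change (v x).coeff q + (w x).coeff q = 0
        rw [hv, hw, add_zero]
      · intro s
        obtain ⟨r, hr⟩ := a.2.1 s
        rw [← hr, Finsupp.smul_apply, smul_eq_mul, ← LaurentPolynomial.smul_eq_C_mul]
        have : z.coef (t - s) x q = 0 := by
          by_contra h0
          exact hne (hz.2.1 _ _ _ h0)
        change r • ((z.co (t - s)) x).coeff q = 0
        rw [show ((z.co (t - s)) x).coeff q = 0 from this, smul_zero]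
    · change (a.1 • z).co t ≠ 0 at ht
      rw [co_smul] at ht
      obtain ⟨s, hs⟩ := exists_ne_zero_of_finsum_ne_zero' ht
      have h1 := a.2.2 hk s fun h => hs (by rw [h, zero_smul])
      have h2 := hz.2.2 hk (t - s) fun h => hs (by rw [h, smul_zero])
      linarith

/-- The cycles of degree `n`. -/
def cycles (K : Cplx.{u} R) (k : Coeffs) (n : ℤ) : Submodule (degZero R k) (Nov R K.X) :=
  K.chains k n ⊓ LinearMap.ker (K.d.restrictScalars (degZero R k))

/-- The boundaries of degree `n`. -/
def boundaries (K : Cplx.{u} R) (k : Coeffs) (n : ℤ) : Submodule (degZero R k) (Nov R K.X) :=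
  (K.chains k (n - 1)).map (K.d.restrictScalars (degZero R k))

/-- The homology in degree `n`, for a differential of degree `1`. -/
abbrev homology (K : Cplx.{u} R) (k : Coeffs) (n : ℤ) : Type (max u v) :=
  K.cycles k n ⧸ (K.boundaries k n).submoduleOf (K.cycles k n)

/-- `f` maps cycles to cycles and induces an isomorphism on homology in degree `n`. -/
def InducesIso (K L : Cplx.{u} R) (f : Nov R K.X →ₗ[Novikov R] Nov R L.X) (k : Coeffs) (n : ℤ) :
    Prop :=
  ∃ e : K.homology k n ≃ₗ[degZero R k] L.homology k n, ∀ z : K.cycles k n,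
    ∃ hz : f z.1 ∈ L.cycles k n, e (Submodule.Quotient.mk z) = Submodule.Quotient.mk ⟨f z.1, hz⟩

end Cplx

variable {A : AInfAlgebra.{u} R}

/-- The basis of `⊕_k M[1] ⊗ C[1]^{⊗k}`. -/
abbrev HochIdx (M : AInfBimod A A) : Type u := M.ι × List A.ι

/-- The degree `|v|' + |x₁|' + ⋯ + |xₖ|'`. -/
def hochDeg (M : AInfBimod A A) (p : HochIdx M) : ℤ := M.sdeg p.1 + A.wd p.2

/-- The last `i` letters of a word of length `k`, and the rest. -/
def lastPart {X : Type u} (w : List X) (i : ℕ) : List X := w.drop (w.length - i)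

/-- The word without its last `i` letters. -/
def initPart {X : Type u} (w : List X) (i : ℕ) : List X := w.take (w.length - i)

/-- For a family of maps `θ_{i,j} : C^{⊗i} ⊗ M ⊗ C^{⊗j} → N`, the map
`v ⊗ x₁ ⋯ xₖ ↦ ∑_{i+j≤k} ± θ_{i,j}(xₖ₋ᵢ₊₁, …, xₖ, v, x₁, …, xⱼ) ⊗ xⱼ₊₁ ⋯ xₖ₋ᵢ`
with the Koszul sign of moving `xₖ₋ᵢ₊₁, …, xₖ` past `v, x₁, …, xₖ₋ᵢ`. -/
def cyclicOp (M N : AInfBimod A A) (θ : List A.ι → M.ι → List A.ι → Nov R N.ι) :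
    HochIdx M → Nov R (HochIdx N) := fun (v, w) =>
  ∑ i ∈ Finset.range (w.length + 1), ∑ j ∈ Finset.range (w.length + 1 - i),
    sgn (A.wd (lastPart w i) * (M.sdeg v + A.wd (initPart w i))) •
      map (fun y => (y, (initPart w i).drop j)) (θ (lastPart w i) v (w.take j))

/-- The Hochschild differential on `v ⊗ x₁ ⋯ xₖ`. -/
def hochOp (M : AInfBimod A A) : HochIdx M → Nov R (HochIdx M) := fun (v, w) =>
  sgn (M.sdeg v) • map (fun w' => (v, w')) (A.dWord w) + cyclicOp M M M.n (v, w)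

/-- The Hochschild chain complex `C_•(A, M)`. -/
def hoch (M : AInfBimod A A) : Cplx.{u} R where
  X := HochIdx M
  deg := hochDeg M
  sub := ⊤
  d := lift (hochOp M)

/-- The map of Hochschild complexes induced by a bimodule homomorphism over the identity. -/
def hochMap {κ : HomKind} {M N : AInfBimod A A}
    (φ : BimodHom κ M N (AInfHom.id A) (AInfHom.id A)) :
    Nov R (HochIdx M) →ₗ[Novikov R] Nov R (HochIdx N) :=
  lift (cyclicOp M N φ.φ)

/-- The Koszul sign `(-1)^ε` of the permutation `x₁ ⊗ ⋯ ⊗ xₖ ↦ x_{σ(1)} ⊗ ⋯ ⊗ x_{σ(k)}`: `ε` is the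
sum of `|x_{σ(i)}|' |x_{σ(j)}|'` over `i < j` with `σ(i) > σ(j)`. -/
def koszul {k : ℕ} (d : Fin k → ℤ) (σ : Equiv.Perm (Fin k)) : ℤ :=
  sgn (∑ i, ∑ j, if i < j ∧ σ j < σ i then d (σ i) * d (σ j) else 0)

/-- The action of `σ` on `M[1] ⊗ C[1]^{⊗k}` that permutes the factors `C[1]` (and the identity on
words of length different from `k`). -/
def symAct (M : AInfBimod A A) (k : ℕ) (σ : Equiv.Perm (Fin k)) :
    Nov R (HochIdx M) →ₗ[Novikov R] Nov R (HochIdx M) :=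
  lift fun (v, w) =>
    if h : k = w.length then
      koszul (fun i => A.sdeg (w.get (i.cast h))) σ •
        basis (v, List.ofFn fun i => w.get ((σ i).cast h))
    else basis (v, w)

/-- The completion of `⊕_k M[1] ⊗ E_k C`, where `E_k C` consists of the elements of `C[1]^{⊗k}` that
are fixed by the symmetric group. -/
def symChains (M : AInfBimod A A) : Submodule (Novikov R) (Nov R (HochIdx M)) :=
  ⨅ (k : ℕ) (σ : Equiv.Perm (Fin k)), LinearMap.ker (symAct M k σ - LinearMap.id)

/-- The symmetrization of a family of maps `θ_{p,q} : C^{⊗p} ⊗ M ⊗ C^{⊗q} → N`: on `M ⊗ E_k C` it is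
given by `v ⊗ x₁ ⋯ xₖ ↦ ∑_{p+q=k} ± θ_{p,q}(x₁, …, xₚ, v, xₚ₊₁, …, xₖ)`. This is the restriction of
`∑ θ_{p,q}` to the fixed elements `[v, x₁, …, xₖ]` of the symmetric group, which are identified with
`v ⊗ [x₁, …, xₖ]`. For `θ = n` these are the structure maps `η_k` of the induced
`L_∞`-bimodule. -/
def symOp (M N : AInfBimod A A) (θ : List A.ι → M.ι → List A.ι → Nov R N.ι) (v : M.ι)
    (w : List A.ι) : Nov R N.ι :=
  ∑ p ∈ Finset.range (w.length + 1),
    sgn (M.sdeg v * A.wd (w.take p)) • θ (w.take p) v (w.drop p)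

/-- `v ⊗ x₁ ⋯ xₖ ↦ ∑_j η_j(v ⊗ x₁ ⋯ xⱼ) ⊗ xⱼ₊₁ ⋯ xₖ`, for `η` the symmetrization of `θ`. On
`[x₁, …, xₖ]` in place of `x₁ ⋯ xₖ`, cutting words in two is the coproduct of `EC`, so that this is
the sum `∑ ± η_j(v ⊗ [x_{σ(1)}, …, x_{σ(j)}]) ⊗ [x_{σ(j+1)}, …, x_{σ(k)}]` over all
`(j, k - j)`-shuffles. -/
def ceModOp (M N : AInfBimod A A) (θ : List A.ι → M.ι → List A.ι → Nov R N.ι) :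
    HochIdx M → Nov R (HochIdx N) := fun (v, w) =>
  ∑ j ∈ Finset.range (w.length + 1),
    map (fun y => (y, w.drop j)) (symOp M N θ v (w.take j))

/-- The Chevalley-Eilenberg differential. The second term is `± v ⊗ d̂(x₁ ⋯ xₖ)`; the operations
`l_k` of the induced `L_∞`-algebra are the restrictions of `m_k` to `E_k C`, and the restriction of
`d̂` to `EC` sends `[x₁, …, xₖ]` to `∑ ± [l_j([x_{σ(1)}, …, x_{σ(j)}]), x_{σ(j+1)}, …, x_{σ(k)}]`, the
sum over all `(j, k - j)`-shuffles. -/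
def ceOp (M : AInfBimod A A) : HochIdx M → Nov R (HochIdx M) := fun (v, w) =>
  ceModOp M M M.n (v, w) + sgn (M.sdeg v) • map (fun w' => (v, w')) (A.dWord w)

/-- The Chevalley-Eilenberg complex `CE_•(Ã, M)` of the induced `L_∞`-bimodule over the induced
`L_∞`-algebra. -/
def chevEil (M : AInfBimod A A) : Cplx.{u} R where
  X := HochIdx M
  deg := hochDeg M
  sub := symChains M
  d := lift (ceOp M)

/-- The map of Chevalley-Eilenberg complexes induced by a bimodule homomorphism over the
identity. -/
def chevEilMap {κ : HomKind} {M N : AInfBimod A A}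
    (φ : BimodHom κ M N (AInfHom.id A) (AInfHom.id A)) :
    Nov R (HochIdx M) →ₗ[Novikov R] Nov R (HochIdx N) :=
  lift (ceModOp M N φ.φ)

end Homology

end GappedAInf

end

open GappedAInf

/-!
The bimodule bar complexes of `A_∞`-bimodules are cofree bicomodules over bar coalgebras, and
(weakly) filtered bimodule homomorphisms are the bicomodule maps of degree `0` that commute with the
differentials. All maps are treated as operators `Op` between completed free modules, given by their
values on the basis, and bicomodule maps are determined by their components (`IsComod.eq_hat`).
Bicomodule maps of all degrees over fixed coalgebra maps, the pre-homomorphisms `IsHom`, form a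
complex with the commutator `homDiff` as differential; its cohomology classes of degree `0` are the
homotopy classes of homomorphisms referred to below.

The evaluations of a model of `[0, 1] × M` induce bijections on these homotopy classes
(`AInfBimod.Model.postBij_ev`). Indeed, pre-homomorphisms can be lifted along an evaluation by means
of the inclusion, and the pre-homomorphisms with vanishing evaluation form an acyclic complex
(`exists_homDiff_eq`): over `R` the kernel of the evaluation is contractible because the inclusion
is a homotopy equivalence, and a contraction over `R` is a contraction up to positive energy by
gappedness (`exists_contraction`). The error is removed by iteration. It converges because the error
gains a fixed amount of energy or involves shorter words in each step, that is, it gains energy in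
the filtration `WRaises`, which is weighted by word length; the total loss of energy does not
increase.

Since the evaluations of a homotopy between a homomorphism and the identity induce bijections, so
does a homomorphism homotopic to the identity (`BimodHomotopic.postBij`). If `φ` is a homotopy
equivalence with homotopy inverse `ψ`, both composites thus induce bijections on homotopy classes,
and hence so does `φ`. The inverse `ψ` need not lie over the identity of the algebra, but
surjectivity and injectivity for `φ` yield an inverse `U` up to homotopy that does, with homotopies
over the identity and with no loss of energy if `φ` is filtered
(`BimodHom.IsHomotopyEquiv.exists_inverse`).

It remains to pass to chains. The map `cycInc`, which sums over all ways of moving a last part of a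
word to the left of the module element, embeds the Hochschild complex in the bimodule bar complex,
and its image is preserved by the differential and by all pre-homomorphisms over the identity
(`IsHom.preservesHoch`). Hence Hochschild chains are functorial (`onHoch_comp`), and `U` and the
homotopies induce an inverse of `φ` up to chain homotopy. For symmetric elements the coproduct is
cocommutative, so that the Chevalley-Eilenberg operators are the restrictions of the Hochschild
operators to the symmetric Hochschild chains (`IsSym.lin_onCE`), which are preserved
(`IsSym.lin_onCE_hat`). The same homotopies therefore prove both statements
(`BimodHom.IsHomotopyEquiv.inducesIso`).
-/

noncomputable section

namespace GappedAInf

namespace Nov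

variable {R : Type v} [Field R] {X Y Z W : Type u}

/-! ### Energy estimates and continuity -/

theorem MemF.mono {E E' : ℝ} {z : Nov R X} (hz : MemF E z) (h : E' ≤ E) : MemF E' z :=
  fun t ht => h.trans (hz t ht)

theorem MemF.add {E : ℝ} {z w : Nov R X} (hz : MemF E z) (hw : MemF E w) : MemF E (z + w) := by
  intro t ht
  by_cases h : z.co t = 0
  · exact hw t fun h' => ht (by rw [co_add, h, h', add_zero])
  · exact hz t h

theorem MemF.neg {E : ℝ} {z : Nov R X} (hz : MemF E z) : MemF E (-z) := fun t ht =>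
  hz t fun h => ht (by rw [co_neg, h, neg_zero])

theorem MemF.sub {E : ℝ} {z w : Nov R X} (hz : MemF E z) (hw : MemF E w) : MemF E (z - w) := by
  rw [sub_eq_add_neg]
  exact hz.add hw.neg

theorem MemF.sum {ι : Type*} {E : ℝ} {s : Finset ι} {f : ι → Nov R X}
    (h : ∀ i ∈ s, MemF E (f i)) : MemF E (∑ i ∈ s, f i) :=
  Finset.sum_induction _ _ (fun _ _ => MemF.add) memF_zero h

/-- The coefficient of `T^t`, as an additive map. -/
def coHom (t : ℝ) : Nov R X →+ (X →₀ R[T;T⁻¹]) where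
  toFun z := z.co t
  map_zero' := rfl
  map_add' _ _ := rfl

theorem co_sub (z w : Nov R X) (t : ℝ) : (z - w).co t = z.co t - w.co t :=
  map_sub (coHom t) z w

theorem co_sum {ι : Type*} (s : Finset ι) (f : ι → Nov R X) (t : ℝ) :
    (∑ i ∈ s, f i).co t = ∑ i ∈ s, (f i).co t :=
  map_sum (coHom t) f s

theorem co_zsmul (n : ℤ) (z : Nov R X) (t : ℝ) : (n • z).co t = n • z.co t :=
  map_zsmul (coHom t) n z

theorem MemF.zsmul {E : ℝ} {z : Nov R X} (hz : MemF E z) (n : ℤ) : MemF E (n • z) :=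
  fun t ht => hz t fun h => ht (by rw [co_zsmul, h, smul_zero])

theorem exists_memF (z : Nov R X) : ∃ c, MemF c z := by
  obtain ⟨c, hc⟩ := z.2.bddBelow
  exact ⟨c, fun t ht => hc ht⟩

theorem eq_zero_of_memF {z : Nov R X} (h : ∀ E : ℝ, MemF E z) : z = 0 := by
  ext1 t
  by_contra ht
  have := h (t + 1) t ht
  linarith

theorem memF_lift {φ : X → Nov R Y} {c E : ℝ} (hφ : ∀ x, MemF c (φ x)) {z : Nov R X}
    (hz : MemF E z) : MemF (c + E) (lift φ z) := by
  intro t ht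
  rw [co_lift hφ] at ht
  obtain ⟨s, hs⟩ := exists_ne_zero_of_finsum_ne_zero' ht
  have h1 : E ≤ s := hz s fun h => hs (by rw [h, map_zero])
  have h2 : c ≤ t - s := by
    by_contra h
    exact hs (by rw [coeffMap_eq_zero hφ (not_le.1 h), LinearMap.zero_apply])
  linarith

/-- The scalar `p T^t`. -/
def monomial (t : ℝ) (p : R[T;T⁻¹]) : Novikov R :=
  ⟨HahnSeries.single t p, LocFin.of_finite
    ((Set.finite_singleton t).subset HahnSeries.support_single_subset)⟩

theorem co_monomial_smul_basis (t : ℝ) (p : R[T;T⁻¹]) (x : X) (s : ℝ) :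
    (monomial t p • (basis x : Nov R X)).co s = if s = t then Finsupp.single x p else 0 := by
  rw [co_smul, finsum_eq_single _ t]
  · change (HahnSeries.single t p).coeff t • _ = _
    rw [HahnSeries.coeff_single_same, co_basis]
    by_cases h : s = t
    · rw [if_pos (sub_eq_zero.2 h), if_pos h, Finsupp.smul_single, smul_eq_mul, mul_one]
    · rw [if_neg (sub_ne_zero.2 h), if_neg h, smul_zero]
  · intro r hr
    change (HahnSeries.single t p).coeff r • _ = _
    rw [HahnSeries.coeff_single_of_ne hr, zero_smul]

/-- The finite linear combinations of the basis are dense. -/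
theorem exists_approx (z : Nov R X) (E : ℝ) :
    ∃ w ∈ Submodule.span (Novikov R) (Set.range (basis : X → Nov R X)), MemF E (z - w) := by
  refine ⟨∑ t ∈ (z.2 E).toFinset, ∑ x ∈ (z.co t).support, monomial t (z.co t x) • basis x,
    sum_mem fun t _ => sum_mem fun x _ =>
      Submodule.smul_mem _ _ (Submodule.subset_span (Set.mem_range_self x)), fun s hs => ?_⟩
  by_contra hE
  refine hs ?_
  rw [co_sub, co_sum]
  simp only [co_sum, co_monomial_smul_basis]
  by_cases h0 : z.co s = 0
  · rw [h0, Finset.sum_eq_zero, sub_zero]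
    intro t ht
    refine Finset.sum_eq_zero fun x hx => if_neg ?_
    rintro rfl
    rw [h0] at hx
    simp at hx
  · rw [Finset.sum_eq_single s]
    · simp only [if_true]
      rw [sub_eq_zero]
      exact (Finsupp.sum_single (z.co s)).symm
    · intro t _ ht
      exact Finset.sum_eq_zero fun x _ => if_neg (Ne.symm ht)
    · intro h
      refine absurd ?_ h
      rw [Set.Finite.mem_toFinset]
      exact ⟨h0, (not_le.1 hE).le⟩

/-- The linear map loses at most a bounded amount of energy. -/
def IsCont (U : Nov R X →ₗ[Novikov R] Nov R Y) : Prop :=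
  ∃ c : ℝ, ∀ E z, MemF E z → MemF (c + E) (U z)

theorem isCont_lift {φ : X → Nov R Y} {c : ℝ} (hφ : ∀ x, MemF c (φ x)) : IsCont (lift φ) :=
  ⟨c, fun _ _ => memF_lift hφ⟩

theorem IsCont.sub {U V : Nov R X →ₗ[Novikov R] Nov R Y} (hU : IsCont U) (hV : IsCont V) :
    IsCont (U - V) := by
  obtain ⟨c, hc⟩ := hU
  obtain ⟨c', hc'⟩ := hV
  exact ⟨min c c', fun E z hz => ((hc E z hz).mono (by gcongr; exact min_le_left _ _)).sub
    ((hc' E z hz).mono (by gcongr; exact min_le_right _ _))⟩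

theorem IsCont.add {U V : Nov R X →ₗ[Novikov R] Nov R Y} (hU : IsCont U) (hV : IsCont V) :
    IsCont (U + V) := by
  obtain ⟨c, hc⟩ := hU
  obtain ⟨c', hc'⟩ := hV
  exact ⟨min c c', fun E z hz => ((hc E z hz).mono (by gcongr; exact min_le_left _ _)).add
    ((hc' E z hz).mono (by gcongr; exact min_le_right _ _))⟩

theorem IsCont.comp {U : Nov R Y →ₗ[Novikov R] Nov R Z} {V : Nov R X →ₗ[Novikov R] Nov R Y}
    (hU : IsCont U) (hV : IsCont V) : IsCont (U ∘ₗ V) := by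
  obtain ⟨c, hc⟩ := hU
  obtain ⟨c', hc'⟩ := hV
  exact ⟨c + c', fun E z hz => (hc _ _ (hc' E z hz)).mono (by linarith)⟩

/-- A continuous linear map is determined by its values on the basis. -/
theorem IsCont.ext {U V : Nov R X →ₗ[Novikov R] Nov R Y} (hU : IsCont U) (hV : IsCont V)
    (h : ∀ x, U (basis x) = V (basis x)) : U = V := by
  obtain ⟨c, hc⟩ := hU.sub hV
  refine LinearMap.ext fun z => sub_eq_zero.1 (eq_zero_of_memF fun E => ?_)
  obtain ⟨w, hw, hzw⟩ := exists_approx z (E - c)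
  have h0 : (U - V) w = 0 := by
    have : Submodule.span (Novikov R) (Set.range (basis : X → Nov R X)) ≤
        LinearMap.ker (U - V) := by
      rw [Submodule.span_le]
      rintro _ ⟨x, rfl⟩
      simp [h]
    exact this hw
  have h1 := hc _ _ hzw
  rw [map_sub, h0, sub_zero, add_sub_cancel] at h1
  exact h1

theorem lift_lift {φ : Y → Nov R Z} {ψ : X → Nov R Y} {c c' : ℝ} (hφ : ∀ y, MemF c (φ y))
    (hψ : ∀ x, MemF c' (ψ x)) (z : Nov R X) :
    lift φ (lift ψ z) = lift (fun x => lift φ (ψ x)) z := by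
  have h : ∀ x, MemF (c + c') (lift φ (ψ x)) := fun x => memF_lift hφ (hψ x)
  refine LinearMap.congr_fun (((isCont_lift hφ).comp (isCont_lift hψ)).ext (isCont_lift h)
    fun x => ?_) z
  rw [LinearMap.comp_apply, lift_basis hψ, lift_basis h]

theorem memF_map (g : X → Y) {E : ℝ} {z : Nov R X} (hz : MemF E z) : MemF E (map g z) := by
  have := memF_lift (c := 0) (fun x => memF_basis (R := R) (g x)) hz
  rwa [zero_add] at this

theorem isCont_map (g : X → Y) : IsCont (map g : Nov R X →ₗ[Novikov R] Nov R Y) :=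
  isCont_lift fun _ => memF_basis _

/-! ### Homogeneous elements -/

/-- The coefficient vector contributes only to degree `n`. -/
def HomogCoeff (d : X → ℤ) (n : ℤ) (f : X →₀ R[T;T⁻¹]) : Prop :=
  ∀ x q, (f x).coeff q ≠ 0 → d x + 2 * q = n

theorem HomogCoeff.add {d : X → ℤ} {n : ℤ} {f g : X →₀ R[T;T⁻¹]} (hf : HomogCoeff d n f)
    (hg : HomogCoeff d n g) : HomogCoeff d n (f + g) := by
  intro x q h
  by_cases h1 : (f x).coeff q = 0
  · refine hg x q fun h2 => h ?_
    change (f x).coeff q + (g x).coeff q = 0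
    rw [h1, h2, add_zero]
  · exact hf x q h1

theorem homogCoeff_zero {d : X → ℤ} {n : ℤ} : HomogCoeff (R := R) d n 0 :=
  fun _ _ h => absurd rfl h

theorem HomogCoeff.zsmul {d : X → ℤ} {n : ℤ} {f : X →₀ R[T;T⁻¹]} (hf : HomogCoeff d n f)
    (m : ℤ) : HomogCoeff d n (m • f) := by
  intro x q h
  refine hf x q fun h' => h ?_
  change m • (f x).coeff q = 0
  rw [h', smul_zero]

theorem isHomog_zero {d : X → ℤ} {n : ℤ} : IsHomog (R := R) d n 0 := fun _ => homogCoeff_zero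

theorem IsHomog.add {d : X → ℤ} {n : ℤ} {z w : Nov R X} (hz : IsHomog d n z)
    (hw : IsHomog d n w) : IsHomog d n (z + w) := fun t => HomogCoeff.add (hz t) (hw t)

theorem IsHomog.zsmul {d : X → ℤ} {n : ℤ} {z : Nov R X} (hz : IsHomog d n z) (m : ℤ) :
    IsHomog d n (m • z) := fun t => by
  change HomogCoeff d n ((m • z).co t)
  rw [co_zsmul]
  exact HomogCoeff.zsmul (hz t) m

theorem IsHomog.neg {d : X → ℤ} {n : ℤ} {z : Nov R X} (hz : IsHomog d n z) :
    IsHomog d n (-z) := by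
  rw [← neg_one_zsmul]
  exact hz.zsmul _

theorem IsHomog.sub {d : X → ℤ} {n : ℤ} {z w : Nov R X} (hz : IsHomog d n z)
    (hw : IsHomog d n w) : IsHomog d n (z - w) := by
  rw [sub_eq_add_neg]
  exact hz.add hw.neg

theorem IsHomog.sum {ι : Type*} {d : X → ℤ} {n : ℤ} {s : Finset ι} {f : ι → Nov R X}
    (h : ∀ i ∈ s, IsHomog d n (f i)) : IsHomog d n (∑ i ∈ s, f i) :=
  Finset.sum_induction _ _ (fun _ _ => IsHomog.add) isHomog_zero h

theorem isHomog_basis (d : X → ℤ) (x : X) : IsHomog (R := R) d (d x) (basis x) := by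
  classical
  intro t y q h
  rw [coef, co_basis] at h
  split_ifs at h with ht
  · rw [Finsupp.single_apply] at h
    split_ifs at h with hxy
    · subst hxy
      have hq : q = 0 := by
        by_contra hq
        refine h ?_
        rw [AddMonoidAlgebra.one_def, AddMonoidAlgebra.coeff_single, Finsupp.single_apply,
          if_neg (Ne.symm hq)]
      simp [hq]
    · exact absurd rfl h
  · exact absurd rfl h

theorem HomogCoeff.smul {d : X → ℤ} {m n : ℤ} {p : R[T;T⁻¹]} {f : X →₀ R[T;T⁻¹]}
    (hp : ∀ q, p.coeff q ≠ 0 → 2 * q = m) (hf : HomogCoeff d n f) :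
    HomogCoeff d (m + n) (p • f) := by
  classical
  intro x q h
  rw [Finsupp.smul_apply, smul_eq_mul, AddMonoidAlgebra.coeff_mul] at h
  obtain ⟨q₁, h1, h⟩ := Finset.exists_ne_zero_of_sum_ne_zero h
  obtain ⟨q₂, h2, h⟩ := Finset.exists_ne_zero_of_sum_ne_zero h
  have e1 := hp q₁ (Finsupp.mem_support_iff.1 h1)
  have e2 := hf x q₂ (Finsupp.mem_support_iff.1 h2)
  have e3 : q₁ + q₂ = q := by
    by_contra hne
    exact h (if_neg hne)
  omega

theorem IsHomog.lift {φ : X → Nov R Y} {c : ℝ} (hφ : ∀ x, MemF c (φ x)) {d : X → ℤ} {d' : Y → ℤ}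
    {k n : ℤ} (hd : ∀ x, IsHomog d' (d x + k) (φ x)) {z : Nov R X} (hz : IsHomog d n z) :
    IsHomog d' (n + k) (Nov.lift φ z) := by
  intro t
  change HomogCoeff d' (n + k) ((Nov.lift φ z).co t)
  rw [co_lift hφ]
  refine finsum_induction (p := HomogCoeff d' (n + k)) homogCoeff_zero
    (fun _ _ => HomogCoeff.add) fun s => ?_
  rw [coeffMap, Finsupp.linearCombination_apply, Finsupp.sum]
  refine Finset.sum_induction _ (HomogCoeff d' (n + k)) (fun _ _ => HomogCoeff.add)
    homogCoeff_zero fun x _ => ?_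
  have h := HomogCoeff.smul (m := n - d x) (p := z.co s x)
    (fun q hq => by have := hz s x q hq; omega) (hd x (t - s))
  rwa [show n - d x + (d x + k) = n + k by ring] at h

theorem sgn_add (a b : ℤ) : sgn (a + b) = sgn a * sgn b := by
  simp [sgn, Int.negOnePow_add]

theorem sgn_mul_self (a : ℤ) : sgn a * sgn a = 1 := by
  rw [← sgn_add, sgn, Int.negOnePow_even _ (by simp)]
  rfl

theorem sgn_zero : sgn 0 = 1 := by simp [sgn]

theorem sgn_one : sgn 1 = -1 := by simp [sgn]

theorem sgn_congr {a b : ℤ} (h : Even (a - b)) : sgn a = sgn b := by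
  rw [sgn, sgn, (Int.negOnePow_eq_iff a b).2 h]

/-- The value on a homogeneous element of a linear map that acts on each basis element by a sign
depending on the parity of the degree. -/
theorem lift_sgn_apply {d : X → ℤ} {n : ℤ} {z : Nov R X} (hz : IsHomog d n z) (a b : ℤ) :
    Nov.lift (fun x => sgn (a * d x + b) • (basis x : Nov R X)) z = sgn (a * n + b) • z := by
  have hb : ∀ x, MemF 0 (sgn (a * d x + b) • (basis x : Nov R X)) :=
    fun x => (memF_basis x).zsmul _
  ext1 t
  rw [co_lift hb, finsum_eq_single _ t]
  · rw [coeffMap, sub_self, co_zsmul, Finsupp.linearCombination_apply]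
    conv_rhs => rw [← Finsupp.sum_single (z.co t), Finsupp.sum, Finset.smul_sum]
    refine Finset.sum_congr rfl fun x hx => ?_
    have hp : ∃ q, (z.co t x).coeff q ≠ 0 := by
      by_contra! h
      exact Finsupp.mem_support_iff.1 hx (AddMonoidAlgebra.ext (by ext q; exact h q))
    obtain ⟨q, hq⟩ := hp
    have h1 : d x + 2 * q = n := hz t x q hq
    beta_reduce
    rw [co_zsmul, co_basis, if_pos rfl, smul_comm, Finsupp.smul_single, smul_eq_mul, mul_one]
    congr 1
    refine sgn_congr ⟨-(a * q), ?_⟩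
    rw [← h1]; ring
  · intro s hs
    have h0 : (fun x : X => (sgn (a * d x + b) • (basis x : Nov R X)).co (t - s)) = 0 := by
      funext x
      rw [co_zsmul, co_basis, if_neg (sub_ne_zero.2 hs.symm), smul_zero]
      rfl
    rw [coeffMap, h0, Finsupp.linearCombination_zero, LinearMap.zero_apply]

end Nov

end GappedAInf

end

noncomputable section

namespace GappedAInf

open Nov

/-! ### The calculus of continuous operators -/

/-- A continuous linear map `Nov R X → Nov R Y` that loses a bounded amount of energy, encoded by
its kernel: the values on the basis. -/
def Op (R : Type v) [Field R] (X Y : Type u) : Type (max u v) :=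
  {φ : X → Nov R Y // ∃ c : ℝ, ∀ x, MemF c (φ x)}

namespace Op

variable {R : Type v} [Field R] {X Y Z W X' Y' Z' X'' Y'' : Type u}

/-- The kernel of an operator: its values on the basis. -/
def app (φ : Op R X Y) : X → Nov R Y := φ.1

instance : CoeFun (Op R X Y) fun _ => X → Nov R Y := ⟨app⟩

theorem exists_memF_app (φ : Op R X Y) : ∃ c : ℝ, ∀ x, MemF c (φ x) := φ.2

@[ext] theorem ext' {φ ψ : Op R X Y} (h : ∀ x, φ x = ψ x) : φ = ψ := Subtype.ext (funext h)

instance : AddCommGroup (Op R X Y) :=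
  inferInstanceAs (AddCommGroup (show AddSubgroup (X → Nov R Y) from
    { carrier := {φ | ∃ c : ℝ, ∀ x, MemF c (φ x)}
      add_mem' := fun ⟨c, hc⟩ ⟨c', hc'⟩ =>
        ⟨min c c', fun x => ((hc x).mono (min_le_left _ _)).add ((hc' x).mono (min_le_right _ _))⟩
      zero_mem' := ⟨0, fun _ => memF_zero⟩
      neg_mem' := fun ⟨c, hc⟩ => ⟨c, fun x => (hc x).neg⟩ }))

@[simp] theorem add_apply (φ ψ : Op R X Y) (x : X) : (φ + ψ) x = φ x + ψ x := rfl
@[simp] theorem zero_apply (x : X) : (0 : Op R X Y) x = 0 := rfl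
@[simp] theorem neg_apply (φ : Op R X Y) (x : X) : (-φ) x = -φ x := rfl
@[simp] theorem sub_apply (φ ψ : Op R X Y) (x : X) : (φ - ψ) x = φ x - ψ x :=
  (sub_eq_add_neg (φ x) (ψ x)).symm ▸ congrArg (fun χ : Op R X Y => χ x) (sub_eq_add_neg φ ψ)

@[simp] theorem zsmul_apply (n : ℤ) (φ : Op R X Y) (x : X) : (n • φ) x = n • φ x :=
  map_zsmul (⟨⟨fun φ : Op R X Y => φ x, rfl⟩, fun _ _ => rfl⟩ : Op R X Y →+ Nov R Y) n φ

@[simp] theorem sum_apply {ι : Type*} (s : Finset ι) (φ : ι → Op R X Y) (x : X) :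
    (∑ i ∈ s, φ i) x = ∑ i ∈ s, φ i x :=
  map_sum (⟨⟨fun φ : Op R X Y => φ x, rfl⟩, fun _ _ => rfl⟩ : Op R X Y →+ Nov R Y) φ s

/-- The continuous linear map with the given kernel. -/
def lin (φ : Op R X Y) : Nov R X →ₗ[Novikov R] Nov R Y := lift φ.app

theorem isCont_lin (φ : Op R X Y) : IsCont φ.lin := by
  obtain ⟨c, hc⟩ := φ.exists_memF_app
  exact isCont_lift hc

@[simp] theorem lin_basis (φ : Op R X Y) (x : X) : φ.lin (basis x) = φ x := by
  obtain ⟨c, hc⟩ := φ.exists_memF_app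
  exact lift_basis hc x

theorem eq_lin (φ : Op R X Y) {U : Nov R X →ₗ[Novikov R] Nov R Y} (hU : IsCont U)
    (h : ∀ x, U (basis x) = φ x) : U = φ.lin :=
  hU.ext φ.isCont_lin fun x => by rw [h, lin_basis]

theorem lin_injective : Function.Injective (lin : Op R X Y → _) := fun φ ψ h => by
  ext1 x
  rw [← lin_basis, h, lin_basis]

/-- A continuous linear map as an operator. -/
def mk' (U : Nov R X →ₗ[Novikov R] Nov R Y) (hU : IsCont U) : Op R X Y :=
  ⟨fun x => U (basis x), by
    obtain ⟨c, hc⟩ := hU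
    exact ⟨c + 0, fun x => hc 0 _ (memF_basis x)⟩⟩

theorem lin_mk' (U : Nov R X →ₗ[Novikov R] Nov R Y) (hU : IsCont U) : (mk' U hU).lin = U :=
  ((mk' U hU).eq_lin hU fun _ => rfl).symm

theorem lin_add (φ ψ : Op R X Y) : (φ + ψ).lin = φ.lin + ψ.lin :=
  ((φ + ψ).eq_lin (φ.isCont_lin.add ψ.isCont_lin) fun x => by simp).symm

theorem lin_add_apply (φ ψ : Op R X Y) (z : Nov R X) : (φ + ψ).lin z = φ.lin z + ψ.lin z := by
  rw [lin_add, LinearMap.add_apply]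

/-- The additive map sending an operator to the value at `z` of its linear extension. -/
def linHom (z : Nov R X) : Op R X Y →+ Nov R Y := AddMonoidHom.mk' (fun φ => φ.lin z) fun φ ψ =>
  lin_add_apply φ ψ z

theorem lin_zero_apply (z : Nov R X) : (0 : Op R X Y).lin z = 0 := map_zero (linHom z)

theorem lin_neg_apply (φ : Op R X Y) (z : Nov R X) : (-φ).lin z = -φ.lin z :=
  map_neg (linHom z) φ

theorem lin_sub_apply (φ ψ : Op R X Y) (z : Nov R X) : (φ - ψ).lin z = φ.lin z - ψ.lin z :=
  map_sub (linHom z) φ ψ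

theorem lin_zsmul_apply (n : ℤ) (φ : Op R X Y) (z : Nov R X) :
    (n • φ).lin z = n • φ.lin z :=
  map_zsmul (linHom z) n φ

/-- Composition. -/
def comp (φ : Op R Y Z) (ψ : Op R X Y) : Op R X Z := mk' (φ.lin ∘ₗ ψ.lin)
  (φ.isCont_lin.comp ψ.isCont_lin)

notation:80 a:81 " ⊚ " b:80 => Op.comp a b

theorem lin_comp (φ : Op R Y Z) (ψ : Op R X Y) : (φ ⊚ ψ).lin = φ.lin ∘ₗ ψ.lin := lin_mk' _ _

theorem lin_comp_apply (φ : Op R Y Z) (ψ : Op R X Y) (z : Nov R X) :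
    (φ ⊚ ψ).lin z = φ.lin (ψ.lin z) := by rw [lin_comp, LinearMap.comp_apply]

theorem comp_apply (φ : Op R Y Z) (ψ : Op R X Y) (x : X) : (φ ⊚ ψ) x = φ.lin (ψ x) := by
  rw [← lin_basis, lin_comp_apply, lin_basis]

theorem comp_assoc (φ : Op R Z W) (ψ : Op R Y Z) (χ : Op R X Y) : (φ ⊚ ψ) ⊚ χ = φ ⊚ ψ ⊚ χ :=
  ext' fun x => by rw [comp_apply, comp_apply, comp_apply, lin_comp_apply]

/-- The operator induced by a map of bases. -/
def of (g : X → Y) : Op R X Y := ⟨fun x => basis (g x), 0, fun _ => memF_basis _⟩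

theorem of_apply (g : X → Y) (x : X) : (of g : Op R X Y) x = basis (g x) := rfl

theorem lin_of (g : X → Y) : (of g : Op R X Y).lin = map g := rfl

/-- The identity operator. -/
def one (R : Type v) [Field R] (X : Type u) : Op R X X := of id

theorem one_apply (x : X) : one R X x = basis x := rfl

@[simp] theorem lin_one : (one R X).lin = LinearMap.id := lift_basis_eq_id

theorem lin_one_apply (z : Nov R X) : (one R X).lin z = z := by simp

@[simp] theorem one_comp (φ : Op R X Y) : one R Y ⊚ φ = φ :=
  ext' fun x => by rw [comp_apply, lin_one_apply]

@[simp] theorem comp_one (φ : Op R X Y) : φ ⊚ one R X = φ :=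
  ext' fun x => by rw [comp_apply, one_apply, lin_basis]

theorem of_comp_of (g : Y → Z) (f : X → Y) : (of g : Op R Y Z) ⊚ of f = of (g ∘ f) :=
  ext' fun x => by rw [comp_apply, of_apply, lin_basis]; rfl

theorem comp_of_apply (φ : Op R Y Z) (f : X → Y) (x : X) : (φ ⊚ of f) x = φ (f x) := by
  rw [comp_apply, of_apply, lin_basis]

theorem add_comp (φ φ' : Op R Y Z) (ψ : Op R X Y) : (φ + φ') ⊚ ψ = φ ⊚ ψ + φ' ⊚ ψ :=
  ext' fun x => by simp only [comp_apply, add_apply, lin_add_apply]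

theorem comp_add (φ : Op R Y Z) (ψ ψ' : Op R X Y) : φ ⊚ (ψ + ψ') = φ ⊚ ψ + φ ⊚ ψ' :=
  ext' fun x => by simp only [comp_apply, add_apply, map_add]

theorem sub_comp (φ φ' : Op R Y Z) (ψ : Op R X Y) : (φ - φ') ⊚ ψ = φ ⊚ ψ - φ' ⊚ ψ :=
  ext' fun x => by simp only [comp_apply, sub_apply, lin_sub_apply]

theorem comp_sub (φ : Op R Y Z) (ψ ψ' : Op R X Y) : φ ⊚ (ψ - ψ') = φ ⊚ ψ - φ ⊚ ψ' :=
  ext' fun x => by simp only [comp_apply, sub_apply, map_sub]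

theorem neg_comp (φ : Op R Y Z) (ψ : Op R X Y) : (-φ) ⊚ ψ = -(φ ⊚ ψ) :=
  ext' fun x => by simp only [comp_apply, neg_apply, lin_neg_apply]

theorem comp_neg (φ : Op R Y Z) (ψ : Op R X Y) : φ ⊚ (-ψ) = -(φ ⊚ ψ) :=
  ext' fun x => by simp only [comp_apply, neg_apply, map_neg]

theorem zsmul_comp (n : ℤ) (φ : Op R Y Z) (ψ : Op R X Y) : (n • φ) ⊚ ψ = n • φ ⊚ ψ :=
  ext' fun x => by simp only [comp_apply, zsmul_apply, lin_zsmul_apply]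

theorem comp_zsmul (n : ℤ) (φ : Op R Y Z) (ψ : Op R X Y) : φ ⊚ (n • ψ) = n • φ ⊚ ψ :=
  ext' fun x => by simp only [comp_apply, zsmul_apply, map_zsmul]

@[simp] theorem zero_comp (ψ : Op R X Y) : (0 : Op R Y Z) ⊚ ψ = 0 :=
  ext' fun x => by rw [comp_apply, lin_zero_apply, zero_apply]

@[simp] theorem comp_zero (φ : Op R Y Z) : φ ⊚ (0 : Op R X Y) = 0 :=
  ext' fun x => by rw [comp_apply, zero_apply, map_zero, zero_apply]

/-! ### Tensor products -/

theorem memF_smul {c E : ℝ} {a : Novikov R} (ha : ∀ t, a.1.coeff t ≠ 0 → c ≤ t) {z : Nov R X}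
    (hz : MemF E z) : MemF (c + E) (a • z) := by
  intro t ht
  rw [co_smul] at ht
  obtain ⟨s, hs⟩ := exists_ne_zero_of_finsum_ne_zero' ht
  have h1 := ha s fun h => hs (by rw [h, zero_smul])
  have h2 := hz (t - s) fun h => hs (by rw [h, smul_zero])
  linarith

theorem isCont_smul (a : Novikov R) {U : Nov R X →ₗ[Novikov R] Nov R Y} (hU : IsCont U) :
    IsCont (a • U) := by
  obtain ⟨c, hc⟩ := hU
  obtain ⟨c', hc'⟩ := LocFin.bddBelow a.2
  exact ⟨c' + c, fun E z hz => (memF_smul (fun t ht => hc' ht) (hc E z hz)).mono (by linarith)⟩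

/-- The tensor product of two elements. -/
def prod (a : Nov R X) (b : Nov R Y) : Nov R (X × Y) :=
  lift.{u, v} (fun x => map.{u, v} (fun y => (x, y)) b) a

/-- The operator `x ↦ x ⊗ b`. -/
def prodRight (b : Nov R Y) : Op R X (X × Y) := ⟨fun x => map (fun y => (x, y)) b, by
  obtain ⟨c, hc⟩ := exists_memF b
  exact ⟨c, fun x => memF_map _ hc⟩⟩

theorem prod_eq (a : Nov R X) (b : Nov R Y) : prod a b = (prodRight b).lin a := rfl

theorem memF_prod {c E : ℝ} {a : Nov R X} {b : Nov R Y} (ha : MemF c a) (hb : MemF E b) :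
    MemF (c + E) (prod a b) := by
  rw [add_comm]
  exact memF_lift (fun x => memF_map _ hb) ha

/-- The tensor product as a linear map of its second argument. -/
def prodLeft (a : Nov R X) : Nov R Y →ₗ[Novikov R] Nov R (X × Y) where
  toFun := prod a
  map_add' b b' := by
    rw [prod_eq, prod_eq, prod_eq, ← lin_add_apply]
    congr 2
    ext1 x
    exact map_add (map fun y => (x, y)) b b'
  map_smul' r b := by
    rw [RingHom.id_apply, prod_eq, prod_eq, ← LinearMap.smul_apply]
    refine LinearMap.congr_fun (eq_lin _ (isCont_smul r (isCont_lin _)) fun x => ?_).symm a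
    rw [LinearMap.smul_apply, lin_basis]
    exact ((map fun y => (x, y)).map_smul r b).symm

theorem isCont_prodLeft (a : Nov R X) :
    IsCont (prodLeft a : Nov R Y →ₗ[Novikov R] Nov R (X × Y)) := by
  obtain ⟨c, hc⟩ := exists_memF a
  exact ⟨c, fun E z hz => memF_prod hc hz⟩

theorem prod_add_left (a a' : Nov R X) (b : Nov R Y) : prod (a + a') b = prod a b + prod a' b :=
  map_add _ a a'

theorem prod_add_right (a : Nov R X) (b b' : Nov R Y) : prod a (b + b') = prod a b + prod a b' :=
  map_add (prodLeft a) b b'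

theorem prod_zsmul_left (n : ℤ) (a : Nov R X) (b : Nov R Y) : prod (n • a) b = n • prod a b :=
  map_zsmul (prodRight b).lin n a

theorem prod_zsmul_right (n : ℤ) (a : Nov R X) (b : Nov R Y) : prod a (n • b) = n • prod a b :=
  map_zsmul (prodLeft a) n b

@[simp] theorem prod_zero_left (b : Nov R Y) : prod (0 : Nov R X) b = 0 :=
  map_zero (prodRight b).lin

@[simp] theorem prod_zero_right (a : Nov R X) : prod a (0 : Nov R Y) = 0 :=
  map_zero (prodLeft a)

theorem prod_sum_left {ι : Type*} (s : Finset ι) (a : ι → Nov R X) (b : Nov R Y) :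
    prod (∑ i ∈ s, a i) b = ∑ i ∈ s, prod (a i) b :=
  map_sum (prodRight b).lin a s

theorem prod_sum_right {ι : Type*} (s : Finset ι) (a : Nov R X) (b : ι → Nov R Y) :
    prod a (∑ i ∈ s, b i) = ∑ i ∈ s, prod a (b i) :=
  map_sum (prodLeft a) b s

theorem prod_basis_left (x : X) (b : Nov R Y) : prod (basis x) b = map (fun y => (x, y)) b :=
  lin_basis (prodRight b) x

theorem prod_basis (x : X) (y : Y) : prod (basis x : Nov R X) (basis y) = basis (x, y) := by
  rw [prod_basis_left, map_basis]

theorem prod_basis_right (a : Nov R X) (y : Y) : prod a (basis y) = map (fun x => (x, y)) a := by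
  rw [prod_eq]
  refine LinearMap.congr_fun ((isCont_lin _).ext (isCont_map _) fun x => ?_) a
  rw [map_basis, ← prod_eq, prod_basis]

theorem isHomog_map {d : X → ℤ} {d' : Y → ℤ} {k n : ℤ} {g : X → Y} (hg : ∀ x, d' (g x) = d x + k)
    {z : Nov R X} (hz : IsHomog d n z) : IsHomog d' (n + k) (map g z) :=
  IsHomog.lift (c := 0) (fun _ => memF_basis _)
    (fun x => by rw [← hg]; exact isHomog_basis d' (g x)) hz

theorem isHomog_prod {d : X → ℤ} {d' : Y → ℤ} {m n : ℤ} {a : Nov R X} {b : Nov R Y}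
    (ha : IsHomog d m a) (hb : IsHomog d' n b) :
    IsHomog (fun p : X × Y => d p.1 + d' p.2) (m + n) (prod a b) := by
  obtain ⟨c, hc⟩ := exists_memF b
  refine IsHomog.lift (fun x => memF_map _ hc) (fun x => ?_) ha
  rw [add_comm]
  exact isHomog_map.{u, v} (d' := fun p : X × Y => d p.1 + d' p.2) (g := fun y => (x, y))
    (fun y => add_comm _ _) hb

/-- The tensor product of two operators. -/
def tensor (φ : Op R X X') (ψ : Op R Y Y') : Op R (X × Y) (X' × Y') :=
  ⟨fun p => prod (φ p.1) (ψ p.2), by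
    obtain ⟨c, hc⟩ := φ.exists_memF_app
    obtain ⟨c', hc'⟩ := ψ.exists_memF_app
    exact ⟨c + c', fun p => memF_prod (hc _) (hc' _)⟩⟩

notation:90 a:91 " ⊠ " b:90 => Op.tensor a b

theorem tensor_apply (φ : Op R X X') (ψ : Op R Y Y') (x : X) (y : Y) :
    (φ ⊠ ψ) (x, y) = prod (φ x) (ψ y) := rfl

theorem lin_tensor_prod (φ : Op R X X') (ψ : Op R Y Y') (a : Nov R X) (b : Nov R Y) :
    (φ ⊠ ψ).lin (prod a b) = prod (φ.lin a) (ψ.lin b) := by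
  have h1 : ∀ x, (φ ⊠ ψ).lin (prod (basis x) b) = prod (φ x) (ψ.lin b) := fun x => by
    refine LinearMap.congr_fun ((φ ⊠ ψ).isCont_lin.comp (isCont_prodLeft (basis x)) |>.ext
      ((isCont_prodLeft (φ x)).comp ψ.isCont_lin) fun y => ?_) b
    change (φ ⊠ ψ).lin (prod (basis x) (basis y)) = prod (φ x) (ψ.lin (basis y))
    rw [prod_basis, lin_basis, lin_basis, tensor_apply]
  refine LinearMap.congr_fun ((φ ⊠ ψ).isCont_lin.comp (prodRight b).isCont_lin |>.ext
      ((prodRight (ψ.lin b)).isCont_lin.comp φ.isCont_lin) fun x => ?_) a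
  change (φ ⊠ ψ).lin (prod (basis x) b) = prod (φ.lin (basis x)) (ψ.lin b)
  rw [h1, lin_basis]

theorem tensor_comp (φ : Op R X' X'') (ψ : Op R Y' Y'') (φ' : Op R X X') (ψ' : Op R Y Y') :
    (φ ⊠ ψ) ⊚ (φ' ⊠ ψ') = (φ ⊚ φ') ⊠ (ψ ⊚ ψ') := by
  ext1 ⟨x, y⟩
  rw [comp_apply, tensor_apply, tensor_apply, lin_tensor_prod, comp_apply, comp_apply]

theorem of_tensor_of (f : X → X') (g : Y → Y') :
    (of f : Op R X X') ⊠ (of g : Op R Y Y') = of (Prod.map f g) := by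
  ext1 ⟨x, y⟩
  rw [tensor_apply, of_apply, of_apply, of_apply, prod_basis]
  rfl

@[simp] theorem one_tensor_one : one R X ⊠ one R Y = one R (X × Y) := of_tensor_of _ _

theorem add_tensor (φ φ' : Op R X X') (ψ : Op R Y Y') : (φ + φ') ⊠ ψ = φ ⊠ ψ + φ' ⊠ ψ :=
  ext' fun _ => prod_add_left _ _ _

theorem tensor_add (φ : Op R X X') (ψ ψ' : Op R Y Y') : φ ⊠ (ψ + ψ') = φ ⊠ ψ + φ ⊠ ψ' :=
  ext' fun _ => prod_add_right _ _ _

theorem zsmul_tensor (n : ℤ) (φ : Op R X X') (ψ : Op R Y Y') : (n • φ) ⊠ ψ = n • φ ⊠ ψ :=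
  ext' fun p => by
    rw [zsmul_apply]
    change prod ((n • φ) p.1) _ = _
    rw [zsmul_apply, prod_zsmul_left]
    rfl

theorem tensor_zsmul (n : ℤ) (φ : Op R X X') (ψ : Op R Y Y') : φ ⊠ (n • ψ) = n • φ ⊠ ψ :=
  ext' fun p => by
    rw [zsmul_apply]
    change prod _ ((n • ψ) p.2) = _
    rw [zsmul_apply, prod_zsmul_right]
    rfl

@[simp] theorem tensor_zero (φ : Op R X X') : φ ⊠ (0 : Op R Y Y') = 0 :=
  ext' fun _ => prod_zero_right _

@[simp] theorem zero_tensor (ψ : Op R Y Y') : (0 : Op R X X') ⊠ ψ = 0 :=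
  ext' fun _ => prod_zero_left _

theorem tensor_sub (φ : Op R X X') (ψ ψ' : Op R Y Y') : φ ⊠ (ψ - ψ') = φ ⊠ ψ - φ ⊠ ψ' :=
  eq_sub_of_add_eq (by rw [← tensor_add, sub_add_cancel])

theorem sub_tensor (φ φ' : Op R X X') (ψ : Op R Y Y') : (φ - φ') ⊠ ψ = φ ⊠ ψ - φ' ⊠ ψ :=
  eq_sub_of_add_eq (by rw [← add_tensor, sub_add_cancel])

/-! ### Degrees and energy of operators -/

/-- The operator has degree `k`. -/
def Homog (d : X → ℤ) (d' : Y → ℤ) (k : ℤ) (φ : Op R X Y) : Prop :=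
  ∀ x, IsHomog d' (d x + k) (φ x)

/-- The operator raises the energy by at least `c`. -/
def Raises (c : ℝ) (φ : Op R X Y) : Prop := ∀ x, MemF c (φ x)

section Homog

variable {d : X → ℤ} {d' : Y → ℤ} {d'' : Z → ℤ} {k l : ℤ}

theorem Homog.lin {φ : Op R X Y} (hφ : Homog d d' k φ) {n : ℤ} {z : Nov R X}
    (hz : IsHomog d n z) : IsHomog d' (n + k) (φ.lin z) := by
  obtain ⟨c, hc⟩ := φ.exists_memF_app
  exact IsHomog.lift hc hφ hz

theorem Homog.comp {φ : Op R Y Z} {ψ : Op R X Y} (hφ : Homog d' d'' l φ) (hψ : Homog d d' k ψ) :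
    Homog d d'' (k + l) (φ ⊚ ψ) := fun x => by
  rw [comp_apply, ← add_assoc]
  exact hφ.lin (hψ x)

theorem Homog.add {φ ψ : Op R X Y} (hφ : Homog d d' k φ) (hψ : Homog d d' k ψ) :
    Homog d d' k (φ + ψ) := fun x => (hφ x).add (hψ x)

theorem Homog.sub {φ ψ : Op R X Y} (hφ : Homog d d' k φ) (hψ : Homog d d' k ψ) :
    Homog d d' k (φ - ψ) := fun x => by
  rw [sub_apply]
  exact (hφ x).sub (hψ x)

theorem Homog.neg {φ : Op R X Y} (hφ : Homog d d' k φ) : Homog d d' k (-φ) :=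
  fun x => (hφ x).neg

theorem Homog.zsmul {φ : Op R X Y} (hφ : Homog d d' k φ) (n : ℤ) : Homog d d' k (n • φ) :=
  fun x => by
    rw [zsmul_apply]
    exact (hφ x).zsmul n

theorem homog_zero : Homog (R := R) d d' k 0 := fun _ => isHomog_zero

theorem homog_of {g : X → Y} (hg : ∀ x, d' (g x) = d x + k) : Homog (R := R) d d' k (of g) :=
  fun x => by
    rw [← hg]
    exact isHomog_basis d' (g x)

theorem homog_one : Homog d d 0 (one R X) := homog_of fun x => (add_zero (d x)).symm

theorem Homog.tensor {e : X' → ℤ} {e' : Y' → ℤ} {φ : Op R X X'} {ψ : Op R Y Y'}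
    (hφ : Homog d e k φ) (hψ : Homog d' e' l ψ) :
    Homog (fun p : X × Y => d p.1 + d' p.2) (fun p : X' × Y' => e p.1 + e' p.2) (k + l)
      (φ ⊠ ψ) := fun p => by
  have := isHomog_prod (hφ p.1) (hψ p.2)
  rwa [add_add_add_comm] at this

end Homog

theorem Raises.mono {c c' : ℝ} {φ : Op R X Y} (hφ : Raises c φ) (h : c' ≤ c) : Raises c' φ :=
  fun x => (hφ x).mono h

theorem Raises.lin {c E : ℝ} {φ : Op R X Y} (hφ : Raises c φ) {z : Nov R X} (hz : MemF E z) :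
    MemF (c + E) (φ.lin z) := memF_lift hφ hz

theorem Raises.comp {c c' : ℝ} {φ : Op R Y Z} {ψ : Op R X Y} (hφ : Raises c φ)
    (hψ : Raises c' ψ) : Raises (c + c') (φ ⊚ ψ) := fun x => by
  rw [comp_apply]
  exact hφ.lin (hψ x)

theorem Raises.add {c : ℝ} {φ ψ : Op R X Y} (hφ : Raises c φ) (hψ : Raises c ψ) :
    Raises c (φ + ψ) := fun x => (hφ x).add (hψ x)

theorem Raises.neg {c : ℝ} {φ : Op R X Y} (hφ : Raises c φ) : Raises c (-φ) :=
  fun x => (hφ x).neg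

theorem Raises.sub {c : ℝ} {φ ψ : Op R X Y} (hφ : Raises c φ) (hψ : Raises c ψ) :
    Raises c (φ - ψ) := by
  rw [sub_eq_add_neg]
  exact hφ.add hψ.neg

theorem Raises.zsmul {c : ℝ} {φ : Op R X Y} (hφ : Raises c φ) (n : ℤ) : Raises c (n • φ) :=
  fun x => by
    rw [zsmul_apply]
    exact (hφ x).zsmul n

theorem raises_of (g : X → Y) : Raises 0 (of g : Op R X Y) := fun _ => memF_basis _

theorem raises_one : Raises 0 (one R X) := raises_of _

theorem raises_zero {c : ℝ} : Raises c (0 : Op R X Y) := fun _ => memF_zero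

theorem Raises.tensor {c c' : ℝ} {φ : Op R X X'} {ψ : Op R Y Y'} (hφ : Raises c φ)
    (hψ : Raises c' ψ) : Raises (c + c') (φ ⊠ ψ) := fun p => memF_prod (hφ p.1) (hψ p.2)

/-- The operator that multiplies elements of degree `n` by `(-1)^{k n}`. -/
def sign (d : X → ℤ) (k : ℤ) : Op R X X :=
  ⟨fun x => sgn (k * d x) • basis x, 0, fun x => (memF_basis x).zsmul _⟩

theorem sign_apply (d : X → ℤ) (k : ℤ) (x : X) :
    (sign d k : Op R X X) x = sgn (k * d x) • basis x := rfl

theorem lin_sign {d : X → ℤ} {n : ℤ} {z : Nov R X} (hz : IsHomog d n z) (k : ℤ) :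
    (sign d k).lin z = sgn (k * n) • z := by
  have := lift_sgn_apply hz k 0
  simp only [add_zero] at this
  exact this

theorem Homog.sign_comp {d : X → ℤ} {d' : Y → ℤ} {k : ℤ} {φ : Op R X Y} (hφ : Homog d d' k φ)
    (l : ℤ) : sign d' l ⊚ φ = sgn (l * k) • φ ⊚ sign d l := by
  ext1 x
  rw [comp_apply, lin_sign (hφ x), zsmul_apply, comp_apply, sign_apply, map_zsmul, lin_basis,
    smul_smul, ← sgn_add]
  congr 2
  ring

theorem sign_comp_sign (d : X → ℤ) (k l : ℤ) :
    (sign d k : Op R X X) ⊚ sign d l = sign d (k + l) := by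
  ext1 x
  rw [comp_apply, sign_apply, map_zsmul, lin_basis, sign_apply, sign_apply, smul_smul, ← sgn_add]
  congr 2
  ring

@[simp] theorem sign_zero (d : X → ℤ) : (sign d 0 : Op R X X) = one R X := by
  ext1 x
  rw [sign_apply, zero_mul, sgn_zero, one_smul, one_apply]

theorem homog_sign (d : X → ℤ) (k : ℤ) : Homog (R := R) d d 0 (sign d k) := fun x => by
  rw [sign_apply, add_zero]
  exact (isHomog_basis d x).zsmul _

theorem raises_sign (d : X → ℤ) (k : ℤ) : Raises 0 (sign d k : Op R X X) :=
  fun x => (memF_basis x).zsmul _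

end Op

theorem conc_eq {R : Type v} [Field R] {X : Type u} (a b : Nov R (List X)) :
    conc a b = map (fun p : List X × List X => p.1 ++ p.2) (Op.prod a b) := by
  rw [conc, Op.prod]
  obtain ⟨c, hc⟩ := exists_memF b
  rw [Nov.map, lift_lift (fun _ => memF_basis _) fun x => memF_map _ hc]
  congr 2
  funext x
  rw [Nov.map, Nov.map, lift_lift (fun _ => memF_basis _) fun x => memF_basis _]
  congr 2
  funext y
  rw [lift_basis fun _ => memF_basis _]

theorem tri_eq {R : Type v} [Field R] {X J Y : Type u} (a : Nov R (List X)) (b : Nov R J)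
    (c : Nov R (List Y)) : tri a b c = Op.prod a (Op.prod b c) := by
  rw [tri, Op.prod, Op.prod]
  obtain ⟨e, he⟩ := exists_memF c
  congr 2
  funext x
  rw [Nov.map, lift_lift (fun _ => memF_basis _) fun x => memF_map _ he]
  congr 2
  funext y
  rw [Nov.map, Nov.map, lift_lift (fun _ => memF_basis _) fun x => memF_basis _]
  congr 2
  funext z
  rw [lift_basis fun _ => memF_basis _]

end GappedAInf

end

noncomputable section

namespace GappedAInf

open Nov Op

section

variable {R : Type v} [Field R] {X Y Z W : Type u}

theorem map_map (g : Y → Z) (f : X → Y) (z : Nov R X) : map g (map f z) = map (g ∘ f) z := by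
  rw [← lin_of, ← lin_of, ← lin_of, ← lin_comp_apply, of_comp_of]

theorem prod_map_left (g : X → Z) (a : Nov R X) (b : Nov R Y) :
    Op.prod (map g a) b = map (fun p => (g p.1, p.2)) (Op.prod a b) := by
  have := lin_tensor_prod (of g) (one R Y) a b
  rw [lin_of, lin_one_apply] at this
  rw [← this, one, of_tensor_of, lin_of]
  rfl

theorem prod_map_right (g : Y → Z) (a : Nov R X) (b : Nov R Y) :
    Op.prod a (map g b) = map (fun p => (p.1, g p.2)) (Op.prod a b) := by
  have := lin_tensor_prod (one R X) (of g) a b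
  rw [lin_of, lin_one_apply] at this
  rw [← this, one, of_tensor_of, lin_of]
  rfl

theorem prod_assoc (a : Nov R X) (b : Nov R Y) (c : Nov R Z) :
    map (fun p : (X × Y) × Z => (p.1.1, p.1.2, p.2)) (Op.prod (Op.prod a b) c) =
      Op.prod a (Op.prod b c) := by
  have h1 : ∀ x y, map (fun p : (X × Y) × Z => (p.1.1, p.1.2, p.2))
      (Op.prod (Op.prod (basis x) (basis y)) c) = Op.prod (basis x) (Op.prod (basis y) c) := by
    intro x y
    rw [prod_basis, prod_basis_left, prod_basis_left, prod_basis_left, map_map, map_map]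
    rfl
  have h2 : ∀ x, map (fun p : (X × Y) × Z => (p.1.1, p.1.2, p.2))
      (Op.prod (Op.prod (basis x) b) c) = Op.prod (basis x) (Op.prod b c) := fun x =>
    LinearMap.congr_fun (((isCont_map _).comp
      ((prodRight c).isCont_lin.comp (isCont_prodLeft (basis x)))).ext
      ((isCont_prodLeft (basis x)).comp (prodRight c).isCont_lin) (h1 x)) b
  exact LinearMap.congr_fun (((isCont_map _).comp
      ((prodRight c).isCont_lin.comp (prodRight b).isCont_lin)).ext
      (prodRight (Op.prod b c)).isCont_lin h2) a

/-! ### Sums over the ways of cutting a word in two -/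

section CutSum

variable {M N : Type*} [AddCommMonoid M] [AddCommMonoid N]

/-- The sum of `g a b` over all ways of writing `w = a ++ b`. -/
def cutSum (g : List X → List X → M) (w : List X) : M :=
  ∑ i ∈ Finset.range (w.length + 1), g (w.take i) (w.drop i)

@[simp] theorem cutSum_nil (g : List X → List X → M) : cutSum g [] = g [] [] := by
  simp [cutSum]

theorem cutSum_cons (g : List X → List X → M) (x : X) (w : List X) :
    cutSum g (x :: w) = g [] (x :: w) + cutSum (fun a b => g (x :: a) b) w := by
  rw [cutSum, List.length_cons, Finset.sum_range_succ', add_comm]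
  rfl

theorem cutSum_congr {g g' : List X → List X → M} {w : List X}
    (h : ∀ a b, a ++ b = w → g a b = g' a b) : cutSum g w = cutSum g' w :=
  Finset.sum_congr rfl fun i _ => h _ _ (List.take_append_drop i w)

theorem cutSum_add (g g' : List X → List X → M) (w : List X) :
    cutSum (fun a b => g a b + g' a b) w = cutSum g w + cutSum g' w := Finset.sum_add_distrib

theorem cutSum_comm (g : List X → List X → List Y → List Y → M) (w : List X) (w' : List Y) :
    cutSum (fun a b => cutSum (fun c d => g a b c d) w') w =
      cutSum (fun c d => cutSum (fun a b => g a b c d) w) w' := Finset.sum_comm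

theorem map_cutSum {F : Type*} [FunLike F M N] [AddMonoidHomClass F M N] (f : F)
    (g : List X → List X → M) (w : List X) :
    f (cutSum g w) = cutSum (fun a b => f (g a b)) w := map_sum f _ _

/-- Coassociativity of deconcatenation. -/
theorem cutSum_assoc (g : List X → List X → List X → M) (w : List X) :
    cutSum (fun a c => cutSum (fun a' b => g a' b c) a) w =
      cutSum (fun a b => cutSum (fun b' c => g a b' c) b) w := by
  induction w generalizing g with
  | nil => simp
  | cons x w ih =>
    rw [cutSum_cons, cutSum_cons, cutSum_nil, cutSum_cons]
    simp only [cutSum_cons _ x]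
    rw [cutSum_add, ih, add_assoc]

theorem cutSum_append_cons (g : List X → List X → M) (a : List X) (y : X) (c : List X) :
    cutSum g (a ++ y :: c) = cutSum (fun a₁ a₂ => g a₁ (a₂ ++ y :: c)) a +
      cutSum (fun c₁ c₂ => g (a ++ y :: c₁) c₂) c := by
  induction a generalizing g with
  | nil => rw [List.nil_append, cutSum_cons, cutSum_nil]; rfl
  | cons x a ih => rw [List.cons_append, cutSum_cons, cutSum_cons, ih, add_assoc]; rfl

end CutSum

theorem memF_cutSum {E : ℝ} {g : List X → List X → Nov R Y} {w : List X}
    (h : ∀ a b, a ++ b = w → MemF E (g a b)) : MemF E (cutSum g w) :=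
  MemF.sum fun i _ => h _ _ (List.take_append_drop i w)

theorem isHomog_cutSum {d : Y → ℤ} {n : ℤ} {g : List X → List X → Nov R Y} {w : List X}
    (h : ∀ a b, a ++ b = w → IsHomog d n (g a b)) : IsHomog d n (cutSum g w) :=
  IsHomog.sum fun i _ => h _ _ (List.take_append_drop i w)

theorem zsmul_cutSum (n : ℤ) (g : List X → List X → Nov R Y) (w : List X) :
    n • cutSum g w = cutSum (fun a b => n • g a b) w := Finset.smul_sum

theorem prod_cutSum_left (g : List X → List X → Nov R Y) (w : List X) (b : Nov R Z) :
    Op.prod (cutSum g w) b = cutSum (fun a c => Op.prod (g a c) b) w := prod_sum_left _ _ _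

theorem prod_cutSum_right (g : List X → List X → Nov R Y) (w : List X) (b : Nov R Z) :
    Op.prod b (cutSum g w) = cutSum (fun a c => Op.prod b (g a c)) w := prod_sum_right _ _ _

theorem lin_cutSum_apply (φ : List X → List X → Op R Y Z) (w : List X) (z : Nov R Y) :
    (cutSum φ w).lin z = cutSum (fun a b => (φ a b).lin z) w := map_cutSum (linHom z) φ w

theorem cutSum_apply (φ : List X → List X → Op R Y Z) (w : List X) (y : Y) :
    (cutSum φ w) y = cutSum (fun a b => φ a b y) w := Op.sum_apply _ _ _

@[simp] theorem wdeg_nil (d : X → ℤ) : wdeg d [] = 0 := rfl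

@[simp] theorem wdeg_cons (d : X → ℤ) (x : X) (w : List X) : wdeg d (x :: w) = d x + wdeg d w := by
  simp [wdeg]

@[simp] theorem wdeg_append (d : X → ℤ) (a b : List X) :
    wdeg d (a ++ b) = wdeg d a + wdeg d b := by
  simp [wdeg]

/-! ### The bar coalgebra -/

/-- The deconcatenation coproduct. -/
def deconc (R : Type v) [Field R] (X : Type u) : Op R (List X) (List X × List X) :=
  ⟨cutSum fun a b => basis (a, b), 0, fun _ => memF_cutSum fun _ _ _ => memF_basis _⟩

theorem deconc_apply (w : List X) : deconc R X w = cutSum (fun a b => basis (a, b)) w := rfl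

theorem barOp_eq (d : X → ℤ) (m : List X → Nov R X) (w : List X) :
    barOp d m w = cutSum (fun a r => cutSum (fun b c =>
      sgn (wdeg d a) • map (fun y => a ++ y :: c) (m b)) r) w := by
  refine Finset.sum_congr rfl fun i hi => ?_
  beta_reduce
  unfold cutSum
  rw [List.length_drop, Nat.sub_add_comm (Finset.mem_range_succ_iff.1 hi)]
  exact Finset.sum_congr rfl fun j _ => by rw [List.drop_drop]

/-- The coderivation of the bar coalgebra defined by `m`. -/
def coder (d : X → ℤ) (m : Op R (List X) X) : Op R (List X) (List X) :=
  ⟨barOp d m, by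
    obtain ⟨c, hc⟩ := m.exists_memF_app
    refine ⟨c, fun w => ?_⟩
    rw [barOp_eq]
    exact memF_cutSum fun a r _ => memF_cutSum fun b c' _ => (memF_map _ (hc b)).zsmul _⟩

theorem coder_apply (d : X → ℤ) (m : Op R (List X) X) (w : List X) :
    coder d m w = cutSum (fun a r => cutSum (fun b c =>
      sgn (wdeg d a) • map (fun y => a ++ y :: c) (m b)) r) w := barOp_eq d m w

theorem deconc_map_append_cons (a c : List X) (z : Nov R X) :
    (deconc R X).lin (map (fun y => a ++ y :: c) z) =
      cutSum (fun a₁ a₂ => map (fun y => (a₁, a₂ ++ y :: c)) z) a +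
      cutSum (fun c₁ c₂ => map (fun y => (a ++ y :: c₁, c₂)) z) c := by
  have h : deconc R X ⊚ of (fun y => a ++ y :: c) =
      cutSum (fun a₁ a₂ => of (fun y => (a₁, a₂ ++ y :: c))) a +
      cutSum (fun c₁ c₂ => of (fun y => (a ++ y :: c₁, c₂))) c := by
    ext1 y
    rw [comp_of_apply, deconc_apply, cutSum_append_cons, Op.add_apply]
    rw [cutSum_apply, cutSum_apply]
    rfl
  rw [← lin_of, ← lin_comp_apply, h, lin_add_apply, lin_cutSum_apply, lin_cutSum_apply]
  rfl

theorem deconc_comp_coder (d : X → ℤ) (m : Op R (List X) X) :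
    deconc R X ⊚ coder d m =
      (coder d m ⊠ one R _ + sign (wdeg d) 1 ⊠ coder d m) ⊚ deconc R X := by
  ext1 w
  have h1 : ∀ a b c : List X, (deconc R X).lin (sgn (wdeg d a) • map (fun y => a ++ y :: c) (m b)) =
      cutSum (fun a₁ a₂ => sgn (wdeg d a) • map (fun y => (a₁, a₂ ++ y :: c)) (m b)) a +
      cutSum (fun c₁ c₂ => sgn (wdeg d a) • map (fun y => (a ++ y :: c₁, c₂)) (m b)) c := by
    intro a b c
    rw [map_zsmul, deconc_map_append_cons, smul_add, zsmul_cutSum, zsmul_cutSum]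
  rw [comp_apply, coder_apply, map_cutSum]
  simp only [map_cutSum, h1, cutSum_add]
  rw [add_comm, add_comp, Op.add_apply]
  congr 1
  · rw [comp_apply, deconc_apply, map_cutSum]
    have h2 : ∀ w₁ w₂ : List X, (coder d m ⊠ one R (List X)).lin (basis (w₁, w₂)) =
        cutSum (fun a r => cutSum (fun b c =>
          sgn (wdeg d a) • map (fun y => (a ++ y :: c, w₂)) (m b)) r) w₁ := by
      intro w₁ w₂
      rw [lin_basis, tensor_apply, one_apply, prod_basis_right, coder_apply, map_cutSum]
      simp only [map_cutSum, map_zsmul, map_map]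
      rfl
    simp only [h2]
    rw [cutSum_assoc fun a r w₂ => cutSum (fun b c =>
          sgn (wdeg d a) • map (fun y => (a ++ y :: c, w₂)) (m b)) r]
    refine cutSum_congr fun a r _ => ?_
    rw [cutSum_assoc fun b c w₂ => sgn (wdeg d a) • map (fun y => (a ++ y :: c, w₂)) (m b)]
  · rw [comp_apply, deconc_apply, map_cutSum]
    have h2 : ∀ w₁ w₂ : List X, (sign (wdeg d) 1 ⊠ coder d m).lin (basis (w₁, w₂)) =
        cutSum (fun a r => cutSum (fun b c =>
          sgn (wdeg d w₁ + wdeg d a) • map (fun y => (w₁, a ++ y :: c)) (m b)) r) w₂ := by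
      intro w₁ w₂
      rw [lin_basis, tensor_apply, Op.sign_apply, prod_zsmul_left, prod_basis_left, coder_apply,
        map_cutSum, zsmul_cutSum, one_mul]
      simp only [map_cutSum, map_zsmul, map_map, zsmul_cutSum, smul_smul, ← sgn_add]
      rfl
    simp only [h2]
    rw [← cutSum_assoc fun w₁ a r => cutSum (fun b c =>
          sgn (wdeg d w₁ + wdeg d a) • map (fun y => (w₁, a ++ y :: c)) (m b)) r]
    refine cutSum_congr fun a r _ => ?_
    rw [cutSum_comm]
    refine cutSum_congr fun a₁ a₂ h => ?_
    rw [← h, wdeg_append]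

/-- The value of the counit on a word. -/
def counitFun : List X → Nov R PUnit.{u + 1}
  | [] => basis PUnit.unit
  | _ :: _ => 0

/-- The counit. -/
def counit (R : Type v) [Field R] (X : Type u) : Op R (List X) PUnit.{u + 1} :=
  ⟨counitFun, 0, fun w => match w with
    | [] => memF_basis _
    | _ :: _ => memF_zero⟩

@[simp] theorem counit_nil : counit R X [] = basis PUnit.unit := rfl

@[simp] theorem counit_cons (x : X) (w : List X) : counit R X (x :: w) = 0 := rfl

/-! ### Projections to a part of the basis -/

open Classical in
/-- The projection to the span of the basis elements in `s`. -/
def proj (R : Type v) [Field R] (s : Set X) : Op R X X :=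
  ⟨fun x => if x ∈ s then basis x else 0, 0, fun x => by
    beta_reduce
    split_ifs
    · exact memF_basis _
    · exact memF_zero⟩

theorem proj_of_mem {s : Set X} {x : X} (h : x ∈ s) : proj R s x = basis x := if_pos h

theorem proj_of_notMem {s : Set X} {x : X} (h : x ∉ s) : proj R s x = 0 := if_neg h

theorem raises_proj (s : Set X) : Raises 0 (proj R s) := fun x => by
  by_cases h : x ∈ s
  · rw [proj_of_mem h]; exact memF_basis _
  · rw [proj_of_notMem h]; exact memF_zero

open Classical in
theorem co_proj (s : Set X) (z : Nov R X) (t : ℝ) :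
    ((proj R s).lin z).co t = (z.co t).filter (· ∈ s) := by
  have h0 : ∀ x r, (proj R s x).co r = if r = 0 then (if x ∈ s then Finsupp.single x 1 else 0)
      else 0 := by
    intro x r
    by_cases h : x ∈ s
    · rw [proj_of_mem h, co_basis, if_pos h]
    · rw [proj_of_notMem h, if_neg h, ite_self]
      rfl
  rw [Op.lin, co_lift (raises_proj s), finsum_eq_single _ t]
  · rw [coeffMap, sub_self, Finsupp.linearCombination_apply]
    ext1 x
    rw [Finsupp.sum_apply, Finsupp.filter_apply]
    simp only [h0, if_true]
    rw [Finsupp.sum, Finset.sum_eq_single x]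
    · by_cases h : x ∈ s
      · simp [h]
      · simp [h]
    · intro y _ hy
      by_cases h : y ∈ s
      · simp [h, hy]
      · simp [h]
    · intro h
      rw [Finsupp.notMem_support_iff.1 h]
      simp
  · intro r hr
    have : (fun x : X => (proj R s x).co (t - r)) = 0 := by
      funext x
      rw [h0, if_neg (sub_ne_zero.2 hr.symm)]
      rfl
    rw [coeffMap, this, Finsupp.linearCombination_zero, LinearMap.zero_apply]

/-- The projections to the fibres of a map of the basis determine an element. -/
theorem eq_of_proj {ι : Type*} (c : X → ι) {z z' : Nov R X}
    (h : ∀ i, (proj R (c ⁻¹' {i})).lin z = (proj R (c ⁻¹' {i})).lin z') : z = z' := by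
  classical
  ext1 t
  ext1 x
  have := congrArg (fun w => w.co t x) (h (c x))
  simpa only [co_proj, Finsupp.filter_apply, Set.mem_preimage, Set.mem_singleton_iff, if_true]
    using this

theorem memF_of_proj {ι : Type*} (c : X → ι) {E : ℝ} {z : Nov R X}
    (h : ∀ i, MemF E ((proj R (c ⁻¹' {i})).lin z)) : MemF E z := by
  classical
  intro t ht
  obtain ⟨x, hx⟩ := Finsupp.ne_iff.1 ht
  refine h (c x) t fun h0 => hx ?_
  have := congrArg (fun w => w x) h0
  simpa only [co_proj, Finsupp.filter_apply, Set.mem_preimage, Set.mem_singleton_iff, if_true]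
    using this

theorem isHomog_of_proj {ι : Type*} (c : X → ι) {d : X → ℤ} {n : ℤ} {z : Nov R X}
    (h : ∀ i, IsHomog d n ((proj R (c ⁻¹' {i})).lin z)) : IsHomog d n z := by
  classical
  intro t x q hq
  refine h (c x) t x q ?_
  rwa [coef, co_proj, Finsupp.filter_apply, if_pos (show x ∈ c ⁻¹' {c x} from rfl)]

end

end GappedAInf

end

noncomputable section

namespace GappedAInf

open Nov Op

section

variable {R : Type v} [Field R] {X Y Z : Type u}

/-! ### The coalgebra maps defined by `A_∞`-homomorphisms -/

/-- Words of length `n`. -/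
abbrev ofLength (X : Type u) (n : ℕ) : Set (List X) := List.length ⁻¹' {n}

theorem proj_ofLength_comp_proj (n m : ℕ) :
    proj R (ofLength X n) ⊚ proj R (ofLength X m) =
      if m = n then proj R (ofLength X n) else 0 := by
  ext1 w
  rw [comp_apply]
  by_cases h : w.length = m
  · rw [proj_of_mem (R := R) (show w ∈ ofLength X m from h), lin_basis]
    split_ifs with hm
    · rfl
    · exact proj_of_notMem fun h' => hm (h.symm.trans h')
  · rw [proj_of_notMem (show w ∉ ofLength X m from h), map_zero]
    split_ifs with hm
    · subst hm
      exact (proj_of_notMem (R := R) (show w ∉ ofLength X m from h)).symm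
    · rfl

/-- The map `y ⊗ w ↦ y w`. -/
def consOp (R : Type v) [Field R] (Y : Type u) : Op R (Y × List Y) (List Y) :=
  of fun p => p.1 :: p.2

theorem blocks_succ (f : List X → Nov R Y) (n : ℕ) (w : List X) :
    blocks f (n + 1) w =
      cutSum (fun a b => (consOp R Y).lin (Op.prod (f a) (blocks f n b))) w := by
  refine Finset.sum_congr rfl fun i _ => ?_
  rw [consOp, lin_of, conc_eq, prod_map_left, map_map]
  rfl

theorem blocks_zero_cons (f : List X → Nov R Y) (x : X) (w : List X) :
    blocks f 0 (x :: w) = 0 := rfl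

theorem blocks_zero_nil (f : List X → Nov R Y) : blocks f 0 [] = basis [] := rfl

theorem proj_blocks (f : List X → Nov R Y) (n : ℕ) (w : List X) :
    (proj R (ofLength Y n)).lin (blocks f n w) = blocks f n w := by
  cases n with
  | zero =>
    cases w with
    | nil => rw [blocks_zero_nil, lin_basis]; exact proj_of_mem rfl
    | cons x w => rw [blocks_zero_cons, map_zero]
  | succ n =>
    induction n generalizing w with
    | zero =>
      rw [blocks_succ, map_cutSum]
      refine cutSum_congr fun a b _ => ?_
      cases b with
      | nil =>
        have h : (proj R (ofLength Y 1) ⊚ consOp R Y) ⊚ (of fun y => (y, [])) =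
            consOp R Y ⊚ of fun y => (y, []) := by
          ext1 y
          rw [comp_of_apply, consOp, comp_of_apply, comp_of_apply]
          exact proj_of_mem rfl
        rw [blocks_zero_nil, prod_basis_right, ← lin_of, ← lin_comp_apply, ← lin_comp_apply, h,
          lin_comp_apply]
      | cons x b => rw [blocks_zero_cons, prod_zero_right, map_zero, map_zero]
    | succ n ih =>
      rw [blocks_succ, map_cutSum]
      refine cutSum_congr fun a b _ => ?_
      have h : proj R (ofLength Y (n + 1 + 1)) ⊚ consOp R Y =
          consOp R Y ⊚ (one R Y ⊠ proj R (ofLength Y (n + 1))) := by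
        ext1 ⟨y, l⟩
        rw [consOp, comp_of_apply, comp_apply, tensor_apply]
        by_cases hl : l.length = n + 1
        · rw [proj_of_mem (show l ∈ ofLength Y (n + 1) from hl), one_apply, prod_basis, lin_basis]
          exact proj_of_mem (by simpa using hl)
        · rw [proj_of_notMem (show l ∉ ofLength Y (n + 1) from hl), prod_zero_right, map_zero]
          exact proj_of_notMem (by simpa using hl)
      rw [← lin_comp_apply, h, lin_comp_apply, lin_tensor_prod, ih, lin_one_apply]

theorem memF_blocks {f : List X → Nov R Y} (hf : ∀ w, MemF 0 (f w)) {c : ℝ} (hc : 0 ≤ c)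
    (h0 : MemF c (f [])) (n : ℕ) (w : List X) :
    MemF (c * ((n : ℝ) - w.length)) (blocks f n w) := by
  induction n generalizing w with
  | zero =>
    cases w with
    | nil => simpa [blocks_zero_nil] using memF_basis (R := R) ([] : List Y)
    | cons x w => exact memF_zero
  | succ n ih =>
    rw [blocks_succ]
    refine memF_cutSum fun a b h => memF_map _ ?_
    subst h
    cases a with
    | nil =>
      refine (memF_prod h0 (ih b)).mono (le_of_eq ?_)
      push_cast
      simp only [List.nil_append]
      ring
    | cons x a =>
      refine (memF_prod (hf _) (ih b)).mono ?_
      rw [zero_add]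
      refine mul_le_mul_of_nonneg_left ?_ hc
      push_cast [List.length_append, List.length_cons]
      have : (0 : ℝ) ≤ a.length := Nat.cast_nonneg _
      linarith

theorem memF_zero_blocks {f : List X → Nov R Y} (hf : ∀ w, MemF 0 (f w)) (n : ℕ) (w : List X) :
    MemF 0 (blocks f n w) := by
  simpa using memF_blocks hf le_rfl (hf []) n w

theorem isHomog_blocks {dX : X → ℤ} {dY : Y → ℤ} {f : List X → Nov R Y}
    (hd : ∀ w, IsHomog dY (wdeg dX w) (f w)) (n : ℕ) (w : List X) :
    IsHomog (wdeg dY) (wdeg dX w) (blocks f n w) := by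
  induction n generalizing w with
  | zero =>
    cases w with
    | nil => exact isHomog_basis _ _
    | cons x w => exact isHomog_zero
  | succ n ih =>
    rw [blocks_succ]
    refine isHomog_cutSum fun a b h => ?_
    subst h
    have h1 := isHomog_prod (hd a) (ih b)
    have h2 : Homog (R := R) (fun p : Y × List Y => dY p.1 + wdeg dY p.2) (wdeg dY) 0
        (consOp R Y) := homog_of fun p => by simp
    rw [wdeg_append, ← add_zero (wdeg dX a + _)]
    exact h2.lin h1

/-- The words of length `n` in the value of the coalgebra map come from the cuttings into `n`
blocks: as empty blocks have positive energy, the sum over all cuttings converges. -/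
theorem proj_hatOp {f : List X → Nov R Y} (hf : ∀ w, MemF 0 (f w)) {c : ℝ} (hc : 0 < c)
    (h0 : MemF c (f [])) (n : ℕ) (w : List X) :
    (proj R (ofLength Y n)).lin (hatOp f w) = blocks f n w := by
  classical
  have h : ∀ E : ℝ, {m | ¬ MemF E (blocks f m w)}.Finite := by
    intro E
    obtain ⟨N, hN⟩ := exists_nat_ge (E / c + w.length)
    refine (Set.finite_lt_nat N).subset fun m hm => ?_
    by_contra hlt
    refine hm ((memF_blocks hf hc.le h0 m w).mono ?_)
    have : (N : ℝ) ≤ m := by exact_mod_cast not_lt.1 hlt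
    rw [← div_le_iff₀' hc]
    linarith
  ext1 t
  have hfin : (Function.support fun m => (blocks f m w).co t).Finite :=
    (h (t + 1)).subset fun m hm hF => by
      have := hF t hm
      linarith
  rw [co_proj, hatOp, seriesSum, dif_pos h, co_mk]
  have h1 := AddMonoidHom.map_finsum (Finsupp.filterAddHom (M := R[T;T⁻¹]) (· ∈ ofLength Y n)) hfin
  refine h1.trans ?_
  rw [finsum_eq_single _ n]
  · change Finsupp.filter _ ((blocks f n w).co t) = _
    rw [← co_proj, proj_blocks]
  · intro m hm
    change Finsupp.filter _ ((blocks f m w).co t) = _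
    rw [← co_proj, ← proj_blocks, ← lin_comp_apply, proj_ofLength_comp_proj, if_neg hm,
      lin_zero_apply, co_zero]

/-- The part of the coproduct in bidegree `(i, j)`. -/
def deconcPart (R : Type v) [Field R] (X : Type u) (i j : ℕ) : Op R (List X) (List X × List X) :=
  (proj R (ofLength X i) ⊠ proj R (ofLength X j)) ⊚ deconc R X

theorem deconcPart_apply (i j : ℕ) (w : List X) : deconcPart R X i j w =
    cutSum (fun a b => Op.prod (proj R (ofLength X i) a) (proj R (ofLength X j) b)) w := by
  rw [deconcPart, comp_apply, deconc_apply, map_cutSum]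
  exact cutSum_congr fun a b _ => by rw [lin_basis, tensor_apply]

theorem deconcPart_eq_comp_proj (i j : ℕ) :
    deconcPart R X i j = deconcPart R X i j ⊚ proj R (ofLength X (i + j)) := by
  ext1 w
  rw [comp_apply]
  by_cases h : w.length = i + j
  · rw [proj_of_mem (show w ∈ ofLength X (i + j) from h), lin_basis]
  · rw [proj_of_notMem (show w ∉ ofLength X (i + j) from h), map_zero, deconcPart_apply]
    refine Finset.sum_eq_zero fun k hk => ?_
    beta_reduce
    by_cases h1 : (w.take k).length = i
    · have h2 : w.drop k ∉ ofLength X j := fun h2 => h (by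
        rw [← List.take_append_drop k w, List.length_append, h1]
        exact congrArg (i + ·) h2)
      rw [proj_of_notMem h2, prod_zero_right]
    · rw [proj_of_notMem (show w.take k ∉ ofLength X i from h1), prod_zero_left]

theorem deconcPart_zero (j : ℕ) :
    deconcPart R X 0 j = of (fun w => ([], w)) ⊚ proj R (ofLength X j) := by
  ext1 w
  have h0 : proj R (ofLength X 0) [] = basis [] := proj_of_mem rfl
  have h1 : ∀ x a, proj R (ofLength X 0) (x :: a) = 0 := fun x a =>
    proj_of_notMem fun h => by simp at h
  rw [deconcPart_apply, comp_apply, lin_of]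
  cases w with
  | nil => rw [cutSum_nil, h0, prod_basis_left]
  | cons x w =>
    rw [cutSum_cons, h0, prod_basis_left]
    simp only [h1, prod_zero_left]
    rw [cutSum, Finset.sum_const_zero, add_zero]

theorem deconcPart_succ_comp_consOp (i j : ℕ) :
    deconcPart R X (i + 1) j ⊚ consOp R X =
      of (fun p : X × List X × List X => (p.1 :: p.2.1, p.2.2)) ⊚
        (one R X ⊠ deconcPart R X i j) := by
  ext1 ⟨x, w⟩
  have h0 : proj R (ofLength X (i + 1)) [] = 0 := proj_of_notMem fun h => by simp at h
  have h1 : ∀ a, proj R (ofLength X (i + 1)) (x :: a) =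
      map (fun l => x :: l) (proj R (ofLength X i) a) := fun a => by
    by_cases h : a.length = i
    · rw [proj_of_mem (show a ∈ ofLength X i from h), map_basis]
      exact proj_of_mem (by simpa using h)
    · rw [proj_of_notMem (show a ∉ ofLength X i from h), map_zero]
      exact proj_of_notMem (by simpa using h)
  rw [consOp, comp_of_apply, deconcPart_apply, cutSum_cons, h0, prod_zero_left, zero_add,
    comp_apply, tensor_apply, one_apply, deconcPart_apply, prod_cutSum_right, map_cutSum]
  refine cutSum_congr fun a b _ => ?_
  rw [h1, prod_map_left, prod_basis_left, lin_of, map_map]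
  rfl

theorem deconcPart_blocks (f : List X → Nov R Y) (i j : ℕ) (w : List X) :
    (deconcPart R Y i j).lin (blocks f (i + j) w) =
      cutSum (fun a b => Op.prod (blocks f i a) (blocks f j b)) w := by
  induction i generalizing w with
  | zero =>
    rw [zero_add, deconcPart_zero, lin_comp_apply, proj_blocks, lin_of]
    cases w with
    | nil => rw [cutSum_nil, blocks_zero_nil, prod_basis_left]
    | cons x w =>
      rw [cutSum_cons, blocks_zero_nil, prod_basis_left]
      simp only [blocks_zero_cons, prod_zero_left]
      rw [cutSum, Finset.sum_const_zero, add_zero]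
  | succ i ih =>
    rw [add_right_comm, blocks_succ, map_cutSum]
    simp only [blocks_succ, prod_cutSum_left]
    rw [cutSum_assoc fun a b c => Op.prod ((consOp R Y).lin (Op.prod (f a) (blocks f i b)))
      (blocks f j c)]
    refine cutSum_congr fun a b _ => ?_
    rw [← lin_comp_apply, deconcPart_succ_comp_consOp, lin_comp_apply, lin_tensor_prod,
      lin_one_apply, ih, prod_cutSum_right, map_cutSum]
    refine cutSum_congr fun b₁ b₂ _ => ?_
    rw [consOp, lin_of, lin_of, prod_map_left, ← prod_assoc, map_map]
    rfl

/-- The operator is a morphism of the (curved) bar coalgebras of filtered `A_∞`-algebras: a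
coalgebra map of degree `0` that preserves the energy filtration and preserves the empty word up
to terms of positive energy. -/
structure IsCoalgMap (dX : X → ℤ) (dY : Y → ℤ) (u : Op R (List X) (List Y)) : Prop where
  deconc : deconc R Y ⊚ u = (u ⊠ u) ⊚ deconc R X
  counit : counit R Y ⊚ u = counit R X
  homog : Homog (wdeg dX) (wdeg dY) 0 u
  raises : Raises 0 u
  nil : ∃ c > 0, MemF c (u [] - basis [])

/-- The coalgebra map with components `f`. -/
def hatO (f : List X → Nov R Y) (hf : ∀ w, MemF 0 (f w)) (h0 : ∃ c > 0, MemF c (f [])) :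
    Op R (List X) (List Y) :=
  ⟨hatOp f, 0, fun w => by
    obtain ⟨c, hc, h0⟩ := h0
    refine memF_of_proj List.length fun n => ?_
    rw [proj_hatOp hf hc h0]
    exact memF_zero_blocks hf n w⟩

theorem counit_eq_comp_proj : counit R X = counit R X ⊚ proj R (ofLength X 0) := by
  ext1 w
  rw [comp_apply]
  cases w with
  | nil => rw [proj_of_mem (show [] ∈ ofLength X 0 from rfl), lin_basis]
  | cons x w => rw [proj_of_notMem (fun h => by simp at h), map_zero, counit_cons]

theorem isCoalgMap_hatO {dX : X → ℤ} {dY : Y → ℤ} {f : List X → Nov R Y}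
    (hf : ∀ w, MemF 0 (f w)) (h0 : ∃ c > 0, MemF c (f []))
    (hd : ∀ w, IsHomog dY (wdeg dX w) (f w)) : IsCoalgMap dX dY (hatO f hf h0) := by
  have h0' := h0
  obtain ⟨c, hc, h0⟩ := h0
  have hp : ∀ n w, (proj R (ofLength Y n)).lin (hatO f hf h0' w) = blocks f n w :=
    proj_hatOp hf hc h0
  refine ⟨?_, ?_, fun w => ?_, fun w => ?_, c, hc, ?_⟩
  · ext1 w
    refine eq_of_proj (fun p : List Y × List Y => (p.1.length, p.2.length)) fun ⟨i, j⟩ => ?_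
    have h1 : proj R ((fun p : List Y × List Y => (p.1.length, p.2.length)) ⁻¹' {(i, j)}) =
        proj R (ofLength Y i) ⊠ proj R (ofLength Y j) := by
      ext1 ⟨a, b⟩
      rw [tensor_apply]
      by_cases ha : a.length = i
      · rw [proj_of_mem (show a ∈ ofLength Y i from ha)]
        by_cases hb : b.length = j
        · rw [proj_of_mem (show b ∈ ofLength Y j from hb), prod_basis]
          exact proj_of_mem (by simp [ha, hb])
        · rw [proj_of_notMem (show b ∉ ofLength Y j from hb), prod_zero_right]
          exact proj_of_notMem (by simp [hb])
      · rw [proj_of_notMem (show a ∉ ofLength Y i from ha), prod_zero_left]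
        exact proj_of_notMem (by simp [ha])
    rw [h1, ← comp_apply, ← comp_assoc, ← comp_apply, ← comp_assoc, tensor_comp]
    change ((deconcPart R Y i j) ⊚ _) w = _
    rw [deconcPart_eq_comp_proj, comp_assoc, comp_apply, comp_apply, hp, deconcPart_blocks,
      comp_apply, deconc_apply, map_cutSum]
    refine cutSum_congr fun a b _ => ?_
    rw [lin_basis, tensor_apply, comp_apply, comp_apply, hp, hp]
  · rw [counit_eq_comp_proj, comp_assoc]
    ext1 w
    rw [comp_apply, comp_apply, hp]
    cases w with
    | nil => rw [blocks_zero_nil, lin_basis]; rfl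
    | cons x w =>
      rw [blocks_zero_cons, map_zero]; rfl
  · rw [add_zero]
    refine isHomog_of_proj List.length fun n => ?_
    rw [hp]
    exact isHomog_blocks hd n w
  · refine memF_of_proj List.length fun n => ?_
    rw [hp]
    exact memF_zero_blocks hf n w
  · refine memF_of_proj List.length fun n => ?_
    rw [map_sub, hp, lin_basis]
    cases n with
    | zero =>
      rw [blocks_zero_nil, proj_of_mem (by rfl), sub_self]
      exact memF_zero
    | succ n =>
      rw [proj_of_notMem (fun h => by simp at h), sub_zero]
      refine (memF_blocks hf hc.le h0 _ _).mono ?_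
      simp only [List.length_nil, Nat.cast_zero, sub_zero]
      push_cast
      have : (0 : ℝ) ≤ n := Nat.cast_nonneg n
      nlinarith

theorem IsCoalgMap.comp {dX : X → ℤ} {dY : Y → ℤ} {dZ : Z → ℤ} {u : Op R (List Y) (List Z)}
    {u' : Op R (List X) (List Y)} (hu : IsCoalgMap dY dZ u) (hu' : IsCoalgMap dX dY u') :
    IsCoalgMap dX dZ (u ⊚ u') where
  deconc := by
    rw [← comp_assoc, hu.deconc, comp_assoc, hu'.deconc, ← comp_assoc, tensor_comp]
  counit := by rw [← comp_assoc, hu.counit, hu'.counit]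
  homog := hu.homog.comp hu'.homog
  raises := by simpa using hu.raises.comp hu'.raises
  nil := by
    obtain ⟨c, hc, h⟩ := hu.nil
    obtain ⟨c', hc', h'⟩ := hu'.nil
    refine ⟨min c c', lt_min hc hc', ?_⟩
    have h1 : (u ⊚ u') [] - basis [] = u.lin (u' [] - basis []) + (u [] - basis []) := by
      rw [map_sub, lin_basis, comp_apply, sub_add_sub_cancel]
    rw [h1]
    have h2 := hu.raises.lin h'
    rw [zero_add] at h2
    exact (h2.mono (min_le_right _ _)).add (h.mono (min_le_left _ _))

theorem isCoalgMap_one (d : X → ℤ) : IsCoalgMap d d (one R (List X)) where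
  deconc := by simp
  counit := by simp
  homog := homog_one
  raises := raises_one
  nil := ⟨1, one_pos, by rw [one_apply, sub_self]; exact memF_zero⟩

end

end GappedAInf

end

noncomputable section

namespace GappedAInf

open Nov Op

section

variable {R : Type v} [Field R] {X Y Z X₁ X₀ J Y₁ Y₀ K Z₁ Z₀ L : Type u}

/-! ### Comodules over bar coalgebras -/

theorem cutSum_eq_first {M : Type*} [AddCommMonoid M] {g : List X → List X → M}
    (h : ∀ x a b, g (x :: a) b = 0) (w : List X) : cutSum g w = g [] w := by
  cases w with
  | nil => rw [cutSum_nil]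
  | cons x w =>
    rw [cutSum_cons]
    simp only [h]
    rw [cutSum, Finset.sum_const_zero, add_zero]

theorem cutSum_eq_last {M : Type*} [AddCommMonoid M] {g : List X → List X → M}
    (h : ∀ a x b, g a (x :: b) = 0) (w : List X) : cutSum g w = g w [] := by
  induction w generalizing g with
  | nil => rw [cutSum_nil]
  | cons x w ih => rw [cutSum_cons, h, zero_add, ih fun a y b => h _ y b]

theorem prod_assoc_symm (a : Nov R X) (b : Nov R Y) (c : Nov R Z) :
    Op.prod (Op.prod a b) c =
      map (fun p : X × Y × Z => ((p.1, p.2.1), p.2.2)) (Op.prod a (Op.prod b c)) := by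
  rw [← prod_assoc, map_map]
  exact (lin_one_apply _).symm

theorem deconc_comp_sign (d : X → ℤ) (k : ℤ) :
    deconc R X ⊚ sign (wdeg d) k = (sign (wdeg d) k ⊠ sign (wdeg d) k) ⊚ deconc R X := by
  ext1 w
  rw [comp_apply, comp_apply, Op.sign_apply, map_zsmul, lin_basis, deconc_apply, map_cutSum,
    zsmul_cutSum]
  refine cutSum_congr fun a b h => ?_
  rw [lin_basis, tensor_apply, Op.sign_apply, Op.sign_apply, prod_zsmul_left, prod_zsmul_right,
    prod_basis, smul_smul, ← sgn_add, ← h, wdeg_append, mul_add]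

theorem counit_comp_sign (d : X → ℤ) (k : ℤ) :
    counit R X ⊚ sign (wdeg d) k = counit R X := by
  ext1 w
  rw [comp_apply, Op.sign_apply, map_zsmul, lin_basis]
  cases w with
  | nil => rw [wdeg_nil, mul_zero, sgn_zero, one_smul]
  | cons x w => rw [counit_cons, smul_zero]

/-- The regrouping of tensor factors in the two-sided coaction. -/
def regroup {A B C D E : Type u} (p : (A × B) × C × D × E) : A × (B × C × D) × E :=
  (p.1.1, (p.1.2, p.2.1, p.2.2.1), p.2.2.2)

theorem regroup_natural {A B C D E A' B' C' D' E' : Type u} (a : Op R A A') (b : Op R B B')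
    (c : Op R C C') (d : Op R D D') (e : Op R E E') :
    of regroup ⊚ ((a ⊠ b) ⊠ (c ⊠ (d ⊠ e))) = (a ⊠ ((b ⊠ (c ⊠ d)) ⊠ e)) ⊚ of regroup := by
  ext1 ⟨⟨x, y⟩, z, s, t⟩
  rw [comp_apply, comp_of_apply, lin_of]
  change map regroup (Op.prod (Op.prod (a x) (b y)) (Op.prod (c z) (Op.prod (d s) (e t)))) =
    Op.prod (a x) (Op.prod (Op.prod (b y) (Op.prod (c z) (d s))) (e t))
  rw [prod_assoc_symm, prod_assoc_symm (b y), prod_assoc_symm (c z), prod_map_right,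
    prod_map_right, prod_map_right, map_map, map_map]
  rfl

/-- The two-sided coaction `x ⊗ y ⊗ z ↦ ∑ x' ⊗ (x'' ⊗ y ⊗ z') ⊗ z''` on the cofree bicomodule over
two bar coalgebras. -/
def coact (R : Type v) [Field R] (X₁ J X₀ : Type u) :
    Op R (List X₁ × J × List X₀) (List X₁ × (List X₁ × J × List X₀) × List X₀) :=
  of regroup ⊚ (deconc R X₁ ⊠ (one R J ⊠ deconc R X₀))

theorem coact_apply (x : List X₁) (y : J) (z : List X₀) : coact R X₁ J X₀ (x, y, z) =
    cutSum (fun a b => cutSum (fun c e => basis (a, (b, y, c), e)) z) x := by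
  rw [coact, comp_apply, tensor_apply, tensor_apply, deconc_apply, deconc_apply, one_apply,
    prod_cutSum_left, map_cutSum]
  refine cutSum_congr fun a b _ => ?_
  rw [prod_cutSum_right, prod_cutSum_right, map_cutSum]
  refine cutSum_congr fun c e _ => ?_
  rw [prod_basis, prod_basis, lin_basis]
  rfl

/-- The projection of the cofree bicomodule to its cogenerators. -/
def cogen (R : Type v) [Field R] (X₁ J X₀ : Type u) : Op R (List X₁ × J × List X₀) J :=
  of (fun p : PUnit.{u + 1} × J × PUnit.{u + 1} => p.2.1) ⊚
    (counit R X₁ ⊠ (one R J ⊠ counit R X₀))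

theorem cogen_nil (y : J) : cogen R X₁ J X₀ ([], y, []) = basis y := by
  rw [cogen, comp_apply, tensor_apply, tensor_apply, counit_nil, counit_nil, one_apply, prod_basis,
    prod_basis, lin_basis]
  rfl

theorem cogen_cons_left (x : X₁) (a : List X₁) (y : J) (z : List X₀) :
    cogen R X₁ J X₀ (x :: a, y, z) = 0 := by
  rw [cogen, comp_apply, tensor_apply, counit_cons, prod_zero_left, map_zero]

theorem cogen_cons_right (x : List X₁) (y : J) (z : X₀) (c : List X₀) :
    cogen R X₁ J X₀ (x, y, z :: c) = 0 := by
  rw [cogen, comp_apply, tensor_apply, tensor_apply, counit_cons, prod_zero_right, prod_zero_right,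
    map_zero]

theorem raises_cogen : Raises 0 (cogen R X₁ J X₀) := fun ⟨x, y, z⟩ => by
  match x, z with
  | [], [] => rw [cogen_nil]; exact memF_basis _
  | _ :: _, _ => rw [cogen_cons_left]; exact memF_zero
  | _, _ :: _ => rw [cogen_cons_right]; exact memF_zero

theorem cogen_comp_coact :
    (one R (List X₁) ⊠ (cogen R X₁ J X₀ ⊠ one R (List X₀))) ⊚ coact R X₁ J X₀ =
      one R (List X₁ × J × List X₀) := by
  ext1 ⟨x, y, z⟩
  rw [comp_apply, coact_apply]
  simp only [map_cutSum, lin_basis, tensor_apply, one_apply]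
  rw [cutSum_eq_last, cutSum_eq_first, cogen_nil, prod_basis, prod_basis]
  · intro z' a b
    rw [cogen_cons_right, prod_zero_left, prod_zero_right]
  · intro a x' b
    simp only [cogen_cons_left, prod_zero_left, prod_zero_right]
    rw [cutSum, Finset.sum_const_zero]

theorem counit_comp_coact :
    of (fun p : PUnit.{u + 1} × (List X₁ × J × List X₀) × PUnit.{u + 1} => p.2.1) ⊚
      (counit R X₁ ⊠ (one R _ ⊠ counit R X₀)) ⊚ coact R X₁ J X₀ = one R _ := by
  ext1 ⟨x, y, z⟩
  rw [comp_apply, comp_apply, coact_apply]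
  simp only [map_cutSum, lin_basis, tensor_apply, one_apply]
  rw [cutSum_eq_first, cutSum_eq_last, counit_nil, counit_nil, prod_basis, prod_basis, lin_basis]
  · rfl
  · intro a z' b
    rw [counit_cons, prod_zero_right, prod_zero_right, map_zero]
  · intro x' a b
    simp only [counit_cons, prod_zero_left, map_zero]
    rw [cutSum, Finset.sum_const_zero]

theorem coact_comp_coact :
    coact R X₁ (List X₁ × J × List X₀) X₀ ⊚ coact R X₁ J X₀ =
      (one R _ ⊠ (coact R X₁ J X₀ ⊠ one R _)) ⊚ coact R X₁ J X₀ := by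
  ext1 ⟨x, y, z⟩
  rw [comp_apply, comp_apply, coact_apply]
  simp only [map_cutSum, lin_basis, tensor_apply, one_apply, coact_apply, prod_cutSum_left,
    prod_cutSum_right, prod_basis]
  -- Both sides are sums over all ways of cutting `x` and `z` into three pieces.
  rw [cutSum_congr fun a b _ => cutSum_comm (fun c e a' b' =>
    cutSum (fun c' e' => (basis (a', (b', (b, y, c), c'), e') : Nov R _)) e) z a,
    cutSum_assoc fun a' b' b => cutSum (fun c e =>
      cutSum (fun c' e' => (basis (a', (b', (b, y, c), c'), e') : Nov R _)) e) z]
  refine cutSum_congr fun a b _ => ?_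
  rw [cutSum_comm (fun c e b₁ b₂ => cutSum (fun c₁ c₂ =>
    (basis (a, (b₁, (b₂, y, c₁), c₂), e) : Nov R _)) c) z b]
  refine cutSum_congr fun b₁ b₂ _ => ?_
  exact (cutSum_assoc (fun c c' e => (basis (a, (b₁, (b₂, y, c), c'), e) : Nov R _)) z).symm

theorem coact_natural {u : Op R (List X₁) (List Y₁)} {v : Op R (List X₀) (List Y₀)}
    (hu : deconc R Y₁ ⊚ u = (u ⊠ u) ⊚ deconc R X₁) (hv : deconc R Y₀ ⊚ v = (v ⊠ v) ⊚ deconc R X₀)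
    (θ : Op R J K) :
    coact R Y₁ K Y₀ ⊚ (u ⊠ (θ ⊠ v)) = (u ⊠ ((u ⊠ (θ ⊠ v)) ⊠ v)) ⊚ coact R X₁ J X₀ := by
  rw [coact, coact, comp_assoc, tensor_comp, tensor_comp, hu, hv, one_comp, ← comp_assoc,
    ← regroup_natural, comp_assoc, tensor_comp, tensor_comp, comp_one]

/-- The bicomodule map of degree `k` over the coalgebra maps `u`, `v` with components `θ`. -/
def hat (d : X₁ → ℤ) (k : ℤ) (u : Op R (List X₁) (List Y₁)) (v : Op R (List X₀) (List Y₀))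
    (θ : Op R (List X₁ × J × List X₀) K) : Op R (List X₁ × J × List X₀) (List Y₁ × K × List Y₀) :=
  ((u ⊚ sign (wdeg d) k) ⊠ (θ ⊠ v)) ⊚ coact R X₁ J X₀

theorem hat_apply (d : X₁ → ℤ) (k : ℤ) (u : Op R (List X₁) (List Y₁)) (v : Op R (List X₀) (List Y₀))
    (θ : Op R (List X₁ × J × List X₀) K) (x : List X₁) (y : J) (z : List X₀) :
    hat d k u v θ (x, y, z) = cutSum (fun a b => cutSum (fun c e =>
      sgn (k * wdeg d a) • Op.prod (u a) (Op.prod (θ (b, y, c)) (v e))) z) x := by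
  rw [hat, comp_apply, coact_apply]
  simp only [map_cutSum, lin_basis, tensor_apply, comp_apply, Op.sign_apply, map_zsmul,
    prod_zsmul_left]

/-- `U` is a bicomodule map of degree `k` over the coalgebra maps `u`, `v`, up to the parity of its
degree. -/
structure IsComod (d : X₁ → ℤ) (k : ℤ) (u : Op R (List X₁) (List Y₁))
    (v : Op R (List X₀) (List Y₀))
    (U : Op R (List X₁ × J × List X₀) (List Y₁ × K × List Y₀)) : Prop where
  eq : coact R Y₁ K Y₀ ⊚ U = ((u ⊚ sign (wdeg d) k) ⊠ (U ⊠ v)) ⊚ coact R X₁ J X₀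

section

variable {d : X₁ → ℤ} {d₀ : X₀ → ℤ} {k : ℤ} {e : Y₁ → ℤ} {e₀ : Y₀ → ℤ}
  {u : Op R (List X₁) (List Y₁)} {v : Op R (List X₀) (List Y₀)}

/-- A bicomodule map to a cofree bicomodule is determined by its components. -/
theorem IsComod.eq_hat {U : Op R (List X₁ × J × List X₀) (List Y₁ × K × List Y₀)}
    (hU : IsComod d k u v U) : U = hat d k u v (cogen R Y₁ K Y₀ ⊚ U) := by
  calc U = (one R (List Y₁) ⊠ (cogen R Y₁ K Y₀ ⊠ one R (List Y₀))) ⊚ coact R Y₁ K Y₀ ⊚ U := by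
        rw [← comp_assoc, cogen_comp_coact, one_comp]
    _ = _ := by
        rw [hU.eq, ← comp_assoc, tensor_comp, tensor_comp, one_comp, one_comp, hat]

theorem IsComod.ext {U V : Op R (List X₁ × J × List X₀) (List Y₁ × K × List Y₀)}
    (hU : IsComod d k u v U) (hV : IsComod d k u v V)
    (h : cogen R Y₁ K Y₀ ⊚ U = cogen R Y₁ K Y₀ ⊚ V) : U = V := by
  rw [hU.eq_hat, hV.eq_hat, h]

theorem cogen_comp_hat (hu : IsCoalgMap d e u) (hv : IsCoalgMap d₀ e₀ v)
    (θ : Op R (List X₁ × J × List X₀) K) :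
    cogen R Y₁ K Y₀ ⊚ hat d k u v θ = θ := by
  have h : of (fun p : PUnit.{u + 1} × K × PUnit.{u + 1} => p.2.1) ⊚
      (counit R X₁ ⊠ (θ ⊠ counit R X₀)) = θ ⊚
      of (fun p : PUnit.{u + 1} × (List X₁ × J × List X₀) × PUnit.{u + 1} => p.2.1) ⊚
      (counit R X₁ ⊠ (one R _ ⊠ counit R X₀)) := by
    have h1 : of (fun p : PUnit.{u + 1} × K × PUnit.{u + 1} => p.2.1) ⊚
        (one R _ ⊠ (θ ⊠ one R _)) = θ ⊚
        of (fun p : PUnit.{u + 1} × (List X₁ × J × List X₀) × PUnit.{u + 1} => p.2.1) := by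
      ext1 ⟨x, y, z⟩
      rw [comp_of_apply, comp_apply, tensor_apply, tensor_apply, one_apply (X := PUnit.{u + 1}) x,
        prod_basis_right, prod_basis_left, map_map, lin_of, map_map]
      exact lin_one_apply _
    rw [← comp_assoc, ← h1, comp_assoc, tensor_comp, tensor_comp, one_comp, comp_one, one_comp]
  rw [hat, cogen, comp_assoc, ← comp_assoc (counit R Y₁ ⊠ _), tensor_comp, tensor_comp, hv.counit,
    ← comp_assoc (counit R Y₁), hu.counit, counit_comp_sign, one_comp, ← comp_assoc, h,
    comp_assoc, comp_assoc, counit_comp_coact, comp_one]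

theorem deconc_comp_comp_sign (hu : IsCoalgMap d e u) (k : ℤ) :
    deconc R Y₁ ⊚ (u ⊚ sign (wdeg d) k) =
      ((u ⊚ sign (wdeg d) k) ⊠ (u ⊚ sign (wdeg d) k)) ⊚ deconc R X₁ := by
  rw [← comp_assoc, hu.deconc, comp_assoc, deconc_comp_sign, ← comp_assoc, tensor_comp]

theorem isComod_hat (hu : IsCoalgMap d e u) (hv : IsCoalgMap d₀ e₀ v)
    (θ : Op R (List X₁ × J × List X₀) K) : IsComod d k u v (hat d k u v θ) := by
  constructor
  rw [hat, ← comp_assoc, coact_natural (deconc_comp_comp_sign hu k) hv.deconc, comp_assoc,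
    coact_comp_coact, ← comp_assoc, tensor_comp, tensor_comp, comp_one, comp_one]

theorem IsComod.sub {U V : Op R (List X₁ × J × List X₀) (List Y₁ × K × List Y₀)}
    (hU : IsComod d k u v U) (hV : IsComod d k u v V) : IsComod d k u v (U - V) := by
  constructor
  rw [comp_sub, hU.eq, hV.eq, sub_tensor, tensor_sub, sub_comp]

theorem IsComod.add {U V : Op R (List X₁ × J × List X₀) (List Y₁ × K × List Y₀)}
    (hU : IsComod d k u v U) (hV : IsComod d k u v V) : IsComod d k u v (U + V) := by
  constructor
  rw [comp_add, hU.eq, hV.eq, add_tensor, tensor_add, add_comp]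

theorem isComod_zero :
    IsComod d k u v (0 : Op R (List X₁ × J × List X₀) (List Y₁ × K × List Y₀)) := by
  constructor
  rw [comp_zero, zero_tensor, tensor_zero, zero_comp]

theorem IsComod.comp {l : ℤ} {u' : Op R (List Y₁) (List Z₁)} {v' : Op R (List Y₀) (List Z₀)}
    {U : Op R (List X₁ × J × List X₀) (List Y₁ × K × List Y₀)}
    {V : Op R (List Y₁ × K × List Y₀) (List Z₁ × L × List Z₀)}
    (hV : IsComod e l u' v' V) (hU : IsComod d k u v U) (hu : IsCoalgMap d e u) :
    IsComod d (k + l) (u' ⊚ u) (v' ⊚ v) (V ⊚ U) := by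
  have h : u' ⊚ (sign (wdeg e) l ⊚ u) ⊚ sign (wdeg d) k = (u' ⊚ u) ⊚ sign (wdeg d) (k + l) := by
    rw [hu.homog.sign_comp, mul_zero, sgn_zero, one_smul, comp_assoc, sign_comp_sign, comp_assoc,
      add_comm]
  constructor
  rw [← comp_assoc, hV.eq, comp_assoc, hU.eq, ← comp_assoc, tensor_comp, tensor_comp, ← h,
    comp_assoc, comp_assoc]

end

/-! ### Differentials on cofree bicomodules -/

/-- The degree on the bimodule bar complex. -/
def barDeg (d₁ : X₁ → ℤ) (dJ : J → ℤ) (d₀ : X₀ → ℤ) (p : List X₁ × J × List X₀) : ℤ :=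
  wdeg d₁ p.1 + (dJ p.2.1 + wdeg d₀ p.2.2)

theorem sign_tensor_sign (d : X → ℤ) (d' : Y → ℤ) (k : ℤ) :
    (sign d k : Op R X X) ⊠ (sign d' k : Op R Y Y) = sign (fun p => d p.1 + d' p.2) k := by
  ext1 ⟨x, y⟩
  rw [tensor_apply, Op.sign_apply, Op.sign_apply, Op.sign_apply, prod_zsmul_left, prod_zsmul_right,
    prod_basis, smul_smul, ← sgn_add, mul_add]

theorem sign_barDeg (d₁ : X₁ → ℤ) (dJ : J → ℤ) (d₀ : X₀ → ℤ) (k : ℤ) :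
    (sign (barDeg d₁ dJ d₀) k : Op R _ _) =
      sign (wdeg d₁) k ⊠ (sign dJ k ⊠ sign (wdeg d₀) k) := by
  rw [sign_tensor_sign, sign_tensor_sign]
  rfl

/-- The differential on the cofree bicomodule on `J` defined by coderivations of the bar coalgebras
and by components `n`. -/
def bimodDiff (d₁ : X₁ → ℤ) (dJ : J → ℤ) (D₁ : Op R (List X₁) (List X₁))
    (D₀ : Op R (List X₀) (List X₀)) (n : Op R (List X₁ × J × List X₀) J) :
    Op R (List X₁ × J × List X₀) (List X₁ × J × List X₀) :=
  D₁ ⊠ one R _ + hat d₁ 1 (one R _) (one R _) n +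
    sign (wdeg d₁) 1 ⊠ (sign dJ 1 ⊠ D₀)

section

variable {d₁ : X₁ → ℤ} {dJ : J → ℤ} {d₀ : X₀ → ℤ} {D₁ : Op R (List X₁) (List X₁)}
  {D₀ : Op R (List X₀) (List X₀)}

theorem coact_comp_bimodDiff
    (h₁ : deconc R X₁ ⊚ D₁ = (D₁ ⊠ one R _ + sign (wdeg d₁) 1 ⊠ D₁) ⊚ deconc R X₁)
    (h₀ : deconc R X₀ ⊚ D₀ = (D₀ ⊠ one R _ + sign (wdeg d₀) 1 ⊠ D₀) ⊚ deconc R X₀)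
    (n : Op R (List X₁ × J × List X₀) J) :
    coact R X₁ J X₀ ⊚ bimodDiff d₁ dJ D₁ D₀ n =
      (D₁ ⊠ one R _ + sign (wdeg d₁) 1 ⊠ (bimodDiff d₁ dJ D₁ D₀ n ⊠ one R _) +
        sign (wdeg d₁) 1 ⊠ (sign (barDeg d₁ dJ d₀) 1 ⊠ D₀)) ⊚ coact R X₁ J X₀ := by
  have e1 : coact R X₁ J X₀ ⊚ (D₁ ⊠ one R _) =
      (D₁ ⊠ one R _ + sign (wdeg d₁) 1 ⊠ ((D₁ ⊠ one R _) ⊠ one R _)) ⊚ coact R X₁ J X₀ := by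
    rw [coact, comp_assoc, tensor_comp, comp_one, h₁, ← one_comp (one R J ⊠ deconc R X₀),
      ← tensor_comp, ← comp_assoc, add_tensor, comp_add, ← one_tensor_one (R := R) (X := J),
      ← one_tensor_one (R := R) (X := List X₀), regroup_natural, regroup_natural, ← add_comp,
      comp_assoc]
    simp only [one_tensor_one, one_comp]
  have e2 : coact R X₁ J X₀ ⊚ hat d₁ 1 (one R _) (one R _) n =
      (sign (wdeg d₁) 1 ⊠ (hat d₁ 1 (one R _) (one R _) n ⊠ one R _)) ⊚ coact R X₁ J X₀ := by
    have := isComod_hat (k := 1) (isCoalgMap_one (R := R) d₁) (isCoalgMap_one d₀) n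
    simpa only [one_comp] using this.eq
  have e3 : coact R X₁ J X₀ ⊚ (sign (wdeg d₁) 1 ⊠ (sign dJ 1 ⊠ D₀)) =
      (sign (wdeg d₁) 1 ⊠ ((sign (wdeg d₁) 1 ⊠ (sign dJ 1 ⊠ D₀)) ⊠ one R _) +
        sign (wdeg d₁) 1 ⊠ (sign (barDeg d₁ dJ d₀) 1 ⊠ D₀)) ⊚ coact R X₁ J X₀ := by
    rw [coact, comp_assoc, tensor_comp, tensor_comp, deconc_comp_sign, h₀, one_comp,
      ← comp_one (sign dJ 1), ← tensor_comp, ← tensor_comp, comp_one, tensor_add, tensor_add,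
      ← comp_assoc, comp_add, regroup_natural, regroup_natural, ← add_comp, comp_assoc,
      sign_barDeg]
  rw [bimodDiff, comp_add, comp_add, e1, e2, e3, ← add_comp, ← add_comp]
  congr 1
  rw [add_tensor, add_tensor, tensor_add, tensor_add]
  abel

variable {Y₁ Y₀ : Type u} {e₁ : Y₁ → ℤ} {e₀ : Y₀ → ℤ} {dK : K → ℤ} {E₁ : Op R (List Y₁) (List Y₁)}
  {E₀ : Op R (List Y₀) (List Y₀)} {k : ℤ} {u : Op R (List X₁) (List Y₁)}
  {v : Op R (List X₀) (List Y₀)}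

/-- The commutator of a bicomodule map with the differentials is a bicomodule map: the terms in
which only the differentials of the coalgebras act cancel. -/
theorem IsComod.commutator
    {δ : Op R (List X₁ × J × List X₀) (List X₁ × J × List X₀)}
    {δ' : Op R (List Y₁ × K × List Y₀) (List Y₁ × K × List Y₀)}
    (hδ : coact R X₁ J X₀ ⊚ δ = (D₁ ⊠ one R _ + sign (wdeg d₁) 1 ⊠ (δ ⊠ one R _) +
        sign (wdeg d₁) 1 ⊠ (sign (barDeg d₁ dJ d₀) 1 ⊠ D₀)) ⊚ coact R X₁ J X₀)
    (hδ' : coact R Y₁ K Y₀ ⊚ δ' = (E₁ ⊠ one R _ + sign (wdeg e₁) 1 ⊠ (δ' ⊠ one R _) +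
        sign (wdeg e₁) 1 ⊠ (sign (barDeg e₁ dK e₀) 1 ⊠ E₀)) ⊚ coact R Y₁ K Y₀)
    (hD : Homog (wdeg d₁) (wdeg d₁) 1 D₁) (hu : Homog (wdeg d₁) (wdeg e₁) 0 u)
    (hu' : E₁ ⊚ u = u ⊚ D₁) (hv' : E₀ ⊚ v = v ⊚ D₀)
    {U : Op R (List X₁ × J × List X₀) (List Y₁ × K × List Y₀)} (hU : IsComod d₁ k u v U)
    (hUd : Homog (barDeg d₁ dJ d₀) (barDeg e₁ dK e₀) k U) :
    IsComod d₁ (k + 1) u v (δ' ⊚ U - sgn k • U ⊚ δ) := by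
  set s := sign (R := R) (wdeg d₁) k with hs
  have hsD : s ⊚ D₁ = sgn k • D₁ ⊚ s := by
    rw [hs, hD.sign_comp, mul_one]
  have hsu : sign (wdeg e₁) 1 ⊚ u ⊚ s = u ⊚ sign (wdeg d₁) (k + 1) := by
    rw [← comp_assoc, hu.sign_comp, mul_zero, sgn_zero, one_smul, comp_assoc, hs, sign_comp_sign,
      add_comm]
  have hss : (u ⊚ s) ⊚ sign (wdeg d₁) 1 = u ⊚ sign (wdeg d₁) (k + 1) := by
    rw [comp_assoc, hs, sign_comp_sign]
  have hsU : sign (barDeg e₁ dK e₀) 1 ⊚ U = sgn k • U ⊚ sign (barDeg d₁ dJ d₀) 1 := by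
    rw [hUd.sign_comp, one_mul]
  have e1 : coact R Y₁ K Y₀ ⊚ δ' ⊚ U = ((u ⊚ D₁ ⊚ s) ⊠ (U ⊠ v) +
      (u ⊚ sign (wdeg d₁) (k + 1)) ⊠ ((δ' ⊚ U) ⊠ v) +
      (u ⊚ sign (wdeg d₁) (k + 1)) ⊠ ((sgn k • U ⊚ sign (barDeg d₁ dJ d₀) 1) ⊠ (v ⊚ D₀))) ⊚
        coact R X₁ J X₀ := by
    rw [← comp_assoc, hδ', comp_assoc, hU.eq, ← comp_assoc]
    congr 1
    rw [add_comp, add_comp, tensor_comp, tensor_comp, tensor_comp, tensor_comp, tensor_comp,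
      one_comp, one_comp, ← comp_assoc, hu',
      hsu, hsU, hv', comp_assoc]
  have e2 : coact R Y₁ K Y₀ ⊚ U ⊚ δ = ((sgn k • u ⊚ D₁ ⊚ s) ⊠ (U ⊠ v) +
      (u ⊚ sign (wdeg d₁) (k + 1)) ⊠ ((U ⊚ δ) ⊠ v) +
      (u ⊚ sign (wdeg d₁) (k + 1)) ⊠ ((U ⊚ sign (barDeg d₁ dJ d₀) 1) ⊠ (v ⊚ D₀))) ⊚
        coact R X₁ J X₀ := by
    rw [← comp_assoc, hU.eq, comp_assoc, hδ, ← comp_assoc]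
    congr 1
    rw [comp_add, comp_add, tensor_comp, tensor_comp, tensor_comp, tensor_comp, tensor_comp,
      comp_one, comp_one, hss, comp_assoc,
      hsD, comp_zsmul]
  constructor
  rw [comp_sub, comp_zsmul, e1, e2, ← zsmul_comp (sgn k) (_ + _), ← sub_comp]
  congr 1
  simp only [smul_add, zsmul_tensor, tensor_zsmul, sub_tensor, tensor_sub, smul_smul, sgn_mul_self,
    one_smul]
  abel

end

end

end GappedAInf

end

noncomputable section

namespace GappedAInf

open Nov Op

variable {R : Type v} [Field R]

/-! ### The operators of `A_∞`-algebras, bimodules and their homomorphisms -/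

namespace AInfAlgebra

/-- The structure operations as an operator on the bar coalgebra. -/
def mOp (A : AInfAlgebra.{u} R) : Op R (List A.ι) A.ι := ⟨A.m, 0, A.filtered⟩

/-- The bar differential as an operator. -/
def dOp (A : AInfAlgebra.{u} R) : Op R (List A.ι) (List A.ι) := coder A.sdeg A.mOp

theorem homog_dOp (A : AInfAlgebra.{u} R) : Homog (wdeg A.sdeg) (wdeg A.sdeg) 1 A.dOp := fun w => by
  rw [dOp, coder_apply]
  refine isHomog_cutSum fun a r h => isHomog_cutSum fun b c h' => IsHomog.zsmul ?_ _
  have h1 := isHomog_map (g := fun y => a ++ y :: c) (d := A.sdeg) (d' := wdeg A.sdeg)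
    (k := wdeg A.sdeg a + wdeg A.sdeg c) (fun y => by simp; ring) (A.degree_one b)
  have h2 : wdeg A.sdeg b + 1 + (wdeg A.sdeg a + wdeg A.sdeg c) = wdeg A.sdeg w + 1 := by
    rw [← h, ← h', wdeg_append, wdeg_append]
    ring
  rw [← h2]
  exact h1

theorem raises_dOp (A : AInfAlgebra.{u} R) : Raises 0 A.dOp := fun w => by
  rw [dOp, coder_apply]
  exact memF_cutSum fun a r _ => memF_cutSum fun b c _ => (memF_map _ (A.filtered b)).zsmul _

theorem deconc_comp_dOp (A : AInfAlgebra.{u} R) : deconc R A.ι ⊚ A.dOp =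
    (A.dOp ⊠ one R _ + sign (wdeg A.sdeg) 1 ⊠ A.dOp) ⊚ deconc R A.ι :=
  deconc_comp_coder _ _

theorem counit_comp_dOp (A : AInfAlgebra.{u} R) : counit R A.ι ⊚ A.dOp = 0 := by
  ext1 w
  rw [comp_apply, AInfAlgebra.dOp, coder_apply, map_cutSum]
  refine Finset.sum_eq_zero fun i _ => ?_
  beta_reduce
  rw [map_cutSum]
  refine Finset.sum_eq_zero fun j _ => ?_
  beta_reduce
  have h : counit R A.ι ⊚ of (fun y => List.take i w ++ y :: List.drop j (List.drop i w)) =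
      0 := by
    ext1 y
    rw [comp_of_apply]
    cases List.take i w <;> rfl
  rw [map_zsmul, ← lin_of, ← lin_comp_apply, h, lin_zero_apply, smul_zero]

end AInfAlgebra

namespace AInfHom

variable {C C' : AInfAlgebra.{u} R}

/-- The map of bar coalgebras as an operator. -/
def op (f : AInfHom C C') : Op R (List C.ι) (List C'.ι) := hatO f.f f.filtered f.zero_pos

theorem lin_op (f : AInfHom C C') : f.op.lin = f.hat := rfl

theorem isCoalgMap_op (f : AInfHom C C') : IsCoalgMap C.sdeg C'.sdeg f.op :=
  isCoalgMap_hatO f.filtered f.zero_pos f.degree_zero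

theorem dOp_comp_op (f : AInfHom C C') : C'.dOp ⊚ f.op = f.op ⊚ C.dOp := by
  refine lin_injective ?_
  rw [lin_comp, lin_comp]
  exact f.comm

theorem op_id (C : AInfAlgebra.{u} R) : (AInfHom.id C).op = one R _ := by
  refine lin_injective ?_
  rw [lin_op, hat_id, lin_one]

end AInfHom

section Coaction

variable {X₁ J X₀ Y₁ K Y₀ : Type u}

theorem homog_coact (d₁ : X₁ → ℤ) (dJ : J → ℤ) (d₀ : X₀ → ℤ) :
    Homog (barDeg d₁ dJ d₀) (fun p => wdeg d₁ p.1 + (barDeg d₁ dJ d₀ p.2.1 + wdeg d₀ p.2.2)) 0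
      (coact R X₁ J X₀) := fun ⟨x, y, z⟩ => by
  rw [coact_apply]
  refine isHomog_cutSum fun a b h => isHomog_cutSum fun c e h' => ?_
  have h1 := isHomog_basis (R := R)
    (fun p : List X₁ × (List X₁ × J × List X₀) × List X₀ =>
      wdeg d₁ p.1 + (barDeg d₁ dJ d₀ p.2.1 + wdeg d₀ p.2.2)) (a, (b, y, c), e)
  convert h1 using 1
  simp only [barDeg, ← h, ← h', wdeg_append]
  ring

theorem raises_coact : Raises 0 (coact R X₁ J X₀) := fun ⟨x, y, z⟩ => by
  rw [coact_apply]
  exact memF_cutSum fun a b _ => memF_cutSum fun c e _ => memF_basis _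

theorem homog_hat {d₁ : X₁ → ℤ} {dJ : J → ℤ} {d₀ : X₀ → ℤ} {e₁ : Y₁ → ℤ} {dK : K → ℤ}
    {e₀ : Y₀ → ℤ} {u : Op R (List X₁) (List Y₁)} {v : Op R (List X₀) (List Y₀)}
    (hu : Homog (wdeg d₁) (wdeg e₁) 0 u) (hv : Homog (wdeg d₀) (wdeg e₀) 0 v) {k : ℤ}
    {θ : Op R (List X₁ × J × List X₀) K} (hθ : Homog (barDeg d₁ dJ d₀) dK k θ) :
    Homog (barDeg d₁ dJ d₀) (barDeg e₁ dK e₀) k (hat d₁ k u v θ) := by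
  have h1 := ((hu.comp (homog_sign (wdeg d₁) k)).tensor (hθ.tensor hv)).comp
    (homog_coact (R := R) d₁ dJ d₀)
  have h2 : 0 + (0 + 0 + (k + 0)) = k := by ring
  rw [h2] at h1
  exact h1

theorem raises_hat {d₁ : X₁ → ℤ} {u : Op R (List X₁) (List Y₁)} {v : Op R (List X₀) (List Y₀)}
    (hu : Raises 0 u) (hv : Raises 0 v) {k : ℤ} {c : ℝ}
    {θ : Op R (List X₁ × J × List X₀) K} (hθ : Raises c θ) :
    Raises c (hat d₁ k u v θ) := by
  have h1 := ((hu.comp (raises_sign (wdeg d₁) k)).tensor (hθ.tensor hv)).comp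
    (raises_coact (R := R) (X₁ := X₁) (J := J) (X₀ := X₀))
  have h2 : 0 + 0 + (c + 0) + 0 = c := by ring
  rw [h2] at h1
  exact h1

theorem homog_cogen (d₁ : X₁ → ℤ) (dJ : J → ℤ) (d₀ : X₀ → ℤ) :
    Homog (barDeg d₁ dJ d₀) dJ 0 (cogen R X₁ J X₀) := fun ⟨x, y, z⟩ => by
  match x, z with
  | [], [] =>
    rw [cogen_nil]
    have := isHomog_basis (R := R) dJ y
    simpa [barDeg] using this
  | _ :: _, _ => rw [cogen_cons_left]; exact isHomog_zero
  | _, _ :: _ => rw [cogen_cons_right]; exact isHomog_zero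

end Coaction

namespace AInfBimod

variable {C₁ C₀ : AInfAlgebra.{u} R}

/-- The degree on the bimodule bar complex. -/
def bdeg (M : AInfBimod C₁ C₀) : List C₁.ι × M.ι × List C₀.ι → ℤ := barDeg C₁.sdeg M.sdeg C₀.sdeg

/-- The structure operations as an operator on the bimodule bar complex. -/
def nOp (M : AInfBimod C₁ C₀) : Op R (List C₁.ι × M.ι × List C₀.ι) M.ι :=
  ⟨fun p => M.n p.1 p.2.1 p.2.2, 0, fun _ => M.filtered _ _ _⟩

theorem homog_nOp (M : AInfBimod C₁ C₀) : Homog M.bdeg M.sdeg 1 M.nOp := fun ⟨x, y, z⟩ => by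
  have := M.degree_one x y z
  rw [add_assoc (C₁.wd x)] at this
  exact this

theorem raises_nOp (M : AInfBimod C₁ C₀) : Raises 0 M.nOp := fun _ => M.filtered _ _ _

/-- The differential of the bimodule bar complex as an operator. -/
def dOp (M : AInfBimod C₁ C₀) :
    Op R (List C₁.ι × M.ι × List C₀.ι) (List C₁.ι × M.ι × List C₀.ι) :=
  bimodDiff C₁.sdeg M.sdeg C₁.dOp C₀.dOp M.nOp

theorem dOp_apply (M : AInfBimod C₁ C₀) (x : List C₁.ι) (y : M.ι) (z : List C₀.ι) :
    M.dOp (x, y, z) = map (fun x' => (x', y, z)) (C₁.dOp x) +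
      cutSum (fun a b => cutSum (fun c e =>
        sgn (C₁.wd a) • map (fun y' => (a, y', e)) (M.n b y c)) z) x +
      sgn (C₁.wd x + M.sdeg y) • map (fun z' => (x, y, z')) (C₀.dOp z) := by
  rw [dOp, bimodDiff, Op.add_apply, Op.add_apply, tensor_apply, one_apply, prod_basis_right,
    hat_apply, tensor_apply, tensor_apply, Op.sign_apply, Op.sign_apply, prod_zsmul_left,
    prod_zsmul_left, prod_zsmul_right, prod_basis_left, prod_basis_left, map_map, smul_smul,
    ← sgn_add, one_mul, one_mul]
  simp only [one_apply, prod_basis_left, prod_basis_right, map_map, one_mul]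
  rfl

theorem lin_dOp (M : AInfBimod C₁ C₀) : M.dOp.lin = M.d := by
  have h : M.dOp.app = bimodOp C₁.sdeg M.sdeg C₀.sdeg C₁.m C₀.m M.n :=
    funext fun ⟨x, y, z⟩ => M.dOp_apply x y z
  rw [Op.lin, h, d]

theorem dOp_comp_dOp (M : AInfBimod C₁ C₀) : M.dOp ⊚ M.dOp = 0 := by
  refine lin_injective ?_
  rw [lin_comp, lin_dOp]
  exact M.sq_zero.trans (LinearMap.ext fun z => (lin_zero_apply z).symm)

theorem homog_dOp (M : AInfBimod C₁ C₀) : Homog M.bdeg M.bdeg 1 M.dOp := by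
  have h1 := C₁.homog_dOp.tensor (homog_one (R := R) (d := fun p : M.ι × List C₀.ι =>
    M.sdeg p.1 + wdeg C₀.sdeg p.2))
  have h2 := homog_hat (homog_one (R := R) (d := wdeg C₁.sdeg))
    (homog_one (R := R) (d := wdeg C₀.sdeg)) M.homog_nOp
  have h3 := (homog_sign (R := R) (wdeg C₁.sdeg) 1).tensor
    ((homog_sign (R := R) M.sdeg 1).tensor C₀.homog_dOp)
  exact (Homog.add h1 h2).add h3

theorem raises_dOp (M : AInfBimod C₁ C₀) : Raises 0 M.dOp := by
  have h1 := C₁.raises_dOp.tensor (raises_one (R := R) (X := M.ι × List C₀.ι))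
  have h2 := raises_hat (d₁ := C₁.sdeg) (k := 1) (raises_one (R := R) (X := List C₁.ι))
    (raises_one (R := R) (X := List C₀.ι)) M.raises_nOp
  have h3 := (raises_sign (R := R) (wdeg C₁.sdeg) 1).tensor
    ((raises_sign (R := R) M.sdeg 1).tensor C₀.raises_dOp)
  simp only [add_zero] at h1 h3
  exact (Raises.add h1 h2).add h3

theorem coact_comp_dOp (M : AInfBimod C₁ C₀) : coact R C₁.ι M.ι C₀.ι ⊚ M.dOp =
    (C₁.dOp ⊠ one R _ + sign (wdeg C₁.sdeg) 1 ⊠ (M.dOp ⊠ one R _) +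
      sign (wdeg C₁.sdeg) 1 ⊠ (sign M.bdeg 1 ⊠ C₀.dOp)) ⊚ coact R C₁.ι M.ι C₀.ι :=
  coact_comp_bimodDiff C₁.deconc_comp_dOp C₀.deconc_comp_dOp M.nOp

theorem cogen_comp_dOp (M : AInfBimod C₁ C₀) : cogen R C₁.ι M.ι C₀.ι ⊚ M.dOp = M.nOp := by
  have h2 : cogen R C₁.ι M.ι C₀.ι ⊚ (C₁.dOp ⊠ one R _) = 0 := by
    rw [cogen, comp_assoc, tensor_comp, C₁.counit_comp_dOp, zero_tensor,
      comp_zero]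
  have h3 : cogen R C₁.ι M.ι C₀.ι ⊚ (sign (wdeg C₁.sdeg) 1 ⊠ (sign M.sdeg 1 ⊠ C₀.dOp)) = 0 := by
    rw [cogen, comp_assoc, tensor_comp, tensor_comp, C₀.counit_comp_dOp,
      tensor_zero, tensor_zero, comp_zero]
  rw [dOp, bimodDiff, comp_add, comp_add, h2, h3, add_zero, zero_add,
    cogen_comp_hat (isCoalgMap_one C₁.sdeg) (isCoalgMap_one C₀.sdeg)]

end AInfBimod

theorem HomKind.Allows.add {κ : HomKind} {c c' : ℝ} (h : κ.Allows c) (h' : κ.Allows c') :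
    κ.Allows (c + c') := by
  cases κ
  · change c + c' = 0
    rw [show c = 0 from h, show c' = 0 from h', add_zero]
  · exact add_nonneg (show 0 ≤ c from h) h'

theorem HomKind.Allows.nonneg {κ : HomKind} {c : ℝ} (h : κ.Allows c) : 0 ≤ c := by
  cases κ
  · exact (show c = 0 from h).ge
  · exact h

theorem HomKind.allows_zero (κ : HomKind) : κ.Allows 0 := by
  cases κ
  · exact rfl
  · exact le_refl (0 : ℝ)

/-! ### The complexes of pre-homomorphisms -/

section Hom

variable {A₁ A₀ C₁ C₀ B₁ B₀ : AInfAlgebra.{u} R}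

/-- `U` is a pre-homomorphism of degree `k` of bimodules over the coalgebra maps `u`, `v`: a
homogeneous bicomodule map of bar complexes, not necessarily compatible with the differentials, that
loses an amount of energy allowed by `κ`. -/
structure IsHom (κ : HomKind) (k : ℤ) (P : AInfBimod A₁ A₀) (M : AInfBimod C₁ C₀)
    (u : Op R (List A₁.ι) (List C₁.ι)) (v : Op R (List A₀.ι) (List C₀.ι))
    (U : Op R (List A₁.ι × P.ι × List A₀.ι) (List C₁.ι × M.ι × List C₀.ι)) : Prop where
  comod : IsComod A₁.sdeg k u v U
  homog : Homog P.bdeg M.bdeg k U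
  loss : ∃ c, κ.Allows c ∧ Raises (-c) U

/-- The commutator with the differentials. -/
def homDiff (P : AInfBimod A₁ A₀) (M : AInfBimod C₁ C₀) (k : ℤ)
    (U : Op R (List A₁.ι × P.ι × List A₀.ι) (List C₁.ι × M.ι × List C₀.ι)) :
    Op R (List A₁.ι × P.ι × List A₀.ι) (List C₁.ι × M.ι × List C₀.ι) :=
  M.dOp ⊚ U - sgn k • U ⊚ P.dOp

variable {κ : HomKind} {k l : ℤ} {P : AInfBimod A₁ A₀} {M : AInfBimod C₁ C₀} {N : AInfBimod B₁ B₀}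
  {u : Op R (List A₁.ι) (List C₁.ι)} {v : Op R (List A₀.ι) (List C₀.ι)}
  {u' : Op R (List C₁.ι) (List B₁.ι)} {v' : Op R (List C₀.ι) (List B₀.ι)}
  {U V : Op R (List A₁.ι × P.ι × List A₀.ι) (List C₁.ι × M.ι × List C₀.ι)}
  {W : Op R (List C₁.ι × M.ι × List C₀.ι) (List B₁.ι × N.ι × List B₀.ι)}

theorem exists_allows_add (hU : ∃ c, κ.Allows c ∧ Raises (-c) U)
    (hV : ∃ c, κ.Allows c ∧ Raises (-c) V) :
    ∃ c, κ.Allows c ∧ Raises (-c) U ∧ Raises (-c) V := by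
  obtain ⟨c, hc, h⟩ := hU
  obtain ⟨c', hc', h'⟩ := hV
  have h1 := hc.nonneg
  have h2 := hc'.nonneg
  exact ⟨c + c', hc.add hc', h.mono (by linarith), h'.mono (by linarith)⟩

theorem IsHom.add (hU : IsHom κ k P M u v U) (hV : IsHom κ k P M u v V) :
    IsHom κ k P M u v (U + V) := by
  obtain ⟨c, hc, h, h'⟩ := exists_allows_add hU.loss hV.loss
  exact ⟨hU.comod.add hV.comod, hU.homog.add hV.homog, c, hc, h.add h'⟩

theorem IsHom.sub (hU : IsHom κ k P M u v U) (hV : IsHom κ k P M u v V) :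
    IsHom κ k P M u v (U - V) := by
  obtain ⟨c, hc, h, h'⟩ := exists_allows_add hU.loss hV.loss
  exact ⟨hU.comod.sub hV.comod, hU.homog.sub hV.homog, c, hc, h.sub h'⟩

theorem isHom_zero : IsHom κ k P M u v 0 :=
  ⟨isComod_zero, homog_zero, 0, κ.allows_zero, raises_zero⟩

theorem IsHom.comp (hW : IsHom κ l M N u' v' W) (hU : IsHom κ k P M u v U)
    (hu : IsCoalgMap A₁.sdeg C₁.sdeg u) : IsHom κ (k + l) P N (u' ⊚ u) (v' ⊚ v) (W ⊚ U) := by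
  obtain ⟨c, hc, h⟩ := hW.loss
  obtain ⟨c', hc', h'⟩ := hU.loss
  exact ⟨hW.comod.comp hU.comod hu, hW.homog.comp hU.homog, c + c', hc.add hc',
    (h.comp h').mono (by linarith)⟩

theorem isHom_one (κ : HomKind) (P : AInfBimod A₁ A₀) :
    IsHom κ 0 P P (one R _) (one R _) (one R _) :=
  ⟨⟨by rw [comp_one, Op.sign_zero, comp_one, one_tensor_one, one_tensor_one, one_comp]⟩, homog_one,
    0, κ.allows_zero, by rw [neg_zero]; exact raises_one⟩

theorem isHom_hat (hu : IsCoalgMap A₁.sdeg C₁.sdeg u) (hv : IsCoalgMap A₀.sdeg C₀.sdeg v)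
    {θ : Op R (List A₁.ι × P.ι × List A₀.ι) M.ι} (hθ : Homog P.bdeg M.sdeg k θ)
    (hc : ∃ c, κ.Allows c ∧ Raises (-c) θ) :
    IsHom κ k P M u v (hat A₁.sdeg k u v θ) := by
  obtain ⟨c, hc, h⟩ := hc
  exact ⟨isComod_hat hu hv θ, homog_hat hu.homog hv.homog hθ, c, hc,
    raises_hat hu.raises hv.raises h⟩

/-- The coalgebra map is compatible with the bar differentials. -/
structure IsDGMap (C C' : AInfAlgebra.{u} R) (u : Op R (List C.ι) (List C'.ι)) : Prop
    extends IsCoalgMap C.sdeg C'.sdeg u where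
  comm : C'.dOp ⊚ u = u ⊚ C.dOp

theorem isDGMap_one (C : AInfAlgebra.{u} R) : IsDGMap C C (one R _) :=
  { isCoalgMap_one C.sdeg with comm := by rw [comp_one, one_comp] }

theorem IsDGMap.comp {C C' C'' : AInfAlgebra.{u} R} {u : Op R (List C'.ι) (List C''.ι)}
    {w : Op R (List C.ι) (List C'.ι)} (hu : IsDGMap C' C'' u) (hw : IsDGMap C C' w) :
    IsDGMap C C'' (u ⊚ w) :=
  { hu.toIsCoalgMap.comp hw.toIsCoalgMap with
    comm := by rw [← comp_assoc, hu.comm, comp_assoc, hw.comm, comp_assoc] }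

theorem AInfHom.isDGMap_op {C C' : AInfAlgebra.{u} R} (f : AInfHom C C') : IsDGMap C C' f.op :=
  { f.isCoalgMap_op with comm := f.dOp_comp_op }

theorem IsHom.homDiff (hu : IsDGMap A₁ C₁ u) (hv : IsDGMap A₀ C₀ v) (hU : IsHom κ k P M u v U) :
    IsHom κ (k + 1) P M u v (homDiff P M k U) := by
  refine ⟨hU.comod.commutator P.coact_comp_dOp M.coact_comp_dOp A₁.homog_dOp hu.homog hu.comm
    hv.comm hU.homog, (M.homog_dOp.comp hU.homog).sub (Homog.zsmul ?_ _), ?_⟩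
  · rw [add_comm]
    exact hU.homog.comp P.homog_dOp
  · obtain ⟨c, hc, h⟩ := hU.loss
    refine ⟨c, hc, Raises.sub ?_ (Raises.zsmul ?_ _)⟩
    · simpa using M.raises_dOp.comp h
    · simpa using h.comp P.raises_dOp

theorem homDiff_sub (U V : Op R (List A₁.ι × P.ι × List A₀.ι) (List C₁.ι × M.ι × List C₀.ι)) :
    homDiff P M k (U - V) = homDiff P M k U - homDiff P M k V := by
  rw [homDiff, homDiff, homDiff, comp_sub, sub_comp, smul_sub]
  abel

theorem homDiff_add (U V : Op R (List A₁.ι × P.ι × List A₀.ι) (List C₁.ι × M.ι × List C₀.ι)) :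
    homDiff P M k (U + V) = homDiff P M k U + homDiff P M k V := by
  rw [homDiff, homDiff, homDiff, comp_add, add_comp, smul_add]
  abel

theorem homDiff_zero : homDiff P M k 0 = 0 := by
  rw [homDiff, comp_zero, zero_comp, smul_zero, sub_zero]

theorem homDiff_homDiff (U : Op R (List A₁.ι × P.ι × List A₀.ι) (List C₁.ι × M.ι × List C₀.ι)) :
    homDiff P M (k + 1) (homDiff P M k U) = 0 := by
  rw [homDiff, homDiff, comp_sub, sub_comp, ← comp_assoc, M.dOp_comp_dOp, zero_comp, comp_zsmul,
    zsmul_comp, comp_assoc U, P.dOp_comp_dOp, comp_zero, smul_zero, sub_zero, zero_sub, sgn_add,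
    sgn_one, comp_assoc]
  simp

theorem homDiff_comp_of_closed (hW : GappedAInf.homDiff M N 0 W = 0) :
    homDiff P N k (W ⊚ U) = W ⊚ homDiff P M k U := by
  have h : N.dOp ⊚ W = W ⊚ M.dOp := by
    rw [GappedAInf.homDiff, sgn_zero, one_smul] at hW
    exact sub_eq_zero.1 hW
  rw [GappedAInf.homDiff, GappedAInf.homDiff, ← comp_assoc, h, comp_assoc, comp_assoc, comp_sub,
    comp_zsmul]

theorem homDiff_comp_closed (hU : GappedAInf.homDiff P M 0 U = 0) :
    homDiff P N k (W ⊚ U) = homDiff M N k W ⊚ U := by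
  have h : M.dOp ⊚ U = U ⊚ P.dOp := by
    rw [GappedAInf.homDiff, sgn_zero, one_smul] at hU
    exact sub_eq_zero.1 hU
  rw [GappedAInf.homDiff, GappedAInf.homDiff, sub_comp, zsmul_comp, comp_assoc, comp_assoc,
    comp_assoc, h]

end Hom

namespace BimodHom

variable {κ : HomKind} {C₁ C₀ C₁' C₀' : AInfAlgebra.{u} R}
  {M : AInfBimod C₁ C₀} {M' : AInfBimod C₁' C₀'} {f₁ : AInfHom C₁ C₁'} {f₀ : AInfHom C₀ C₀'}

/-- The components as an operator. -/
def φOp (φ : BimodHom κ M M' f₁ f₀) : Op R (List C₁.ι × M.ι × List C₀.ι) M'.ι :=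
  ⟨fun p => φ.φ p.1 p.2.1 p.2.2, by
    obtain ⟨c, _, hc⟩ := φ.energy_loss
    exact ⟨-c, fun p => hc _ _ _⟩⟩

theorem φOp_apply (φ : BimodHom κ M M' f₁ f₀) (x : List C₁.ι) (y : M.ι) (z : List C₀.ι) :
    φ.φOp (x, y, z) = φ.φ x y z := rfl

/-- The map of bimodule bar complexes as an operator. -/
def op (φ : BimodHom κ M M' f₁ f₀) :
    Op R (List C₁.ι × M.ι × List C₀.ι) (List C₁'.ι × M'.ι × List C₀'.ι) :=
  GappedAInf.hat C₁.sdeg 0 f₁.op f₀.op φ.φOp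

theorem lin_op (φ : BimodHom κ M M' f₁ f₀) : φ.op.lin = φ.hat := by
  have h : φ.op.app = bimodHatOp f₁.f f₀.f φ.φ := funext fun ⟨x, y, z⟩ => by
    rw [op, GappedAInf.hat_apply]
    refine Finset.sum_congr rfl fun i _ => Finset.sum_congr rfl fun j _ => ?_
    beta_reduce
    rw [zero_mul, sgn_zero, one_smul, tri_eq]
    rfl
  rw [Op.lin, h, hat]

theorem homog_φOp (φ : BimodHom κ M M' f₁ f₀) : Homog M.bdeg M'.sdeg 0 φ.φOp :=
  fun ⟨x, y, z⟩ => by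
    have := φ.degree_zero x y z
    rw [add_assoc (C₁.wd x)] at this
    rw [add_zero]
    exact this

theorem isHom_op (φ : BimodHom κ M M' f₁ f₀) : IsHom κ 0 M M' f₁.op f₀.op φ.op := by
  refine isHom_hat f₁.isCoalgMap_op f₀.isCoalgMap_op φ.homog_φOp ?_
  obtain ⟨c, hc, h⟩ := φ.energy_loss
  exact ⟨c, hc, fun p => h _ _ _⟩

theorem homDiff_op (φ : BimodHom κ M M' f₁ f₀) : homDiff M M' 0 φ.op = 0 := by
  rw [homDiff, sgn_zero, one_smul, sub_eq_zero]
  refine lin_injective ?_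
  rw [lin_comp, lin_comp, lin_op, M.lin_dOp, M'.lin_dOp]
  exact φ.comm

end BimodHom

end GappedAInf

end

noncomputable section

namespace GappedAInf

open Nov Op

variable {R : Type v} [Field R] {X Y Z : Type u}

/-! ### Reduction to energy zero -/

/-- A vector over `R`, as an element of energy `0` without `e`. -/
def constHom : (X →₀ R) →+ Nov R X where
  toFun v := Nov.mk (Pi.single 0 (v.mapRange (LaurentPolynomial.C : R →+* R[T;T⁻¹]) (map_zero _)))
    (LocFin.of_finite ((Set.finite_singleton 0).subset fun t ht => by
      by_contra h
      exact ht (Pi.single_eq_of_ne h _)))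
  map_zero' := by
    ext1 t
    rw [co_mk, Finsupp.mapRange_zero, Pi.single_zero]
    rfl
  map_add' v w := by
    ext1 t
    rw [co_add, co_mk, co_mk, co_mk, Finsupp.mapRange_add (map_add _), Pi.single_add]
    rfl

theorem co_constHom (v : X →₀ R) (t : ℝ) : (constHom v).co t =
    if t = 0 then v.mapRange (LaurentPolynomial.C : R →+* R[T;T⁻¹]) (map_zero _) else 0 := by
  change (Pi.single 0 (v.mapRange (LaurentPolynomial.C : R →+* R[T;T⁻¹]) (map_zero _)) :
    ℝ → X →₀ R[T;T⁻¹]) t = _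
  rw [Pi.single_apply]

theorem memF_constHom (v : X →₀ R) : MemF 0 (constHom v) := by
  intro t ht
  rw [co_constHom] at ht
  by_contra h
  exact ht (if_neg (by rintro rfl; exact h le_rfl))

theorem constHom_single (x : X) (r : R) :
    constHom (Finsupp.single x r) = monomial 0 (LaurentPolynomial.C r) • basis x := by
  ext1 t
  rw [co_constHom, co_monomial_smul_basis, Finsupp.mapRange_single]

theorem constHom_smul (r : R) (v : X →₀ R) :
    constHom (r • v) = monomial 0 (LaurentPolynomial.C r) • constHom v := by
  ext1 t
  rw [co_smul, co_constHom, finsum_eq_single _ 0]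
  · change _ = (HahnSeries.single (0 : ℝ) (LaurentPolynomial.C r)).coeff 0 • _
    rw [HahnSeries.coeff_single_same, sub_zero, co_constHom]
    split_ifs
    · ext1 x
      simp
    · rw [smul_zero]
  · intro s hs
    change (HahnSeries.single (0 : ℝ) (LaurentPolynomial.C r)).coeff s • _ = _
    rw [HahnSeries.coeff_single_of_ne hs, zero_smul]

/-- The operator that is the extension of an `R`-linear map. -/
def extOp (f : (X →₀ R) →ₗ[R] (Y →₀ R)) : Op R X Y :=
  ⟨fun x => constHom (f (Finsupp.single x 1)), 0, fun _ => memF_constHom _⟩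

theorem extOp_apply (f : (X →₀ R) →ₗ[R] (Y →₀ R)) (x : X) :
    extOp f x = constHom (f (Finsupp.single x 1)) := rfl

theorem raises_extOp (f : (X →₀ R) →ₗ[R] (Y →₀ R)) : Raises 0 (extOp f) :=
  fun _ => memF_constHom _

theorem lin_extOp_constHom (f : (X →₀ R) →ₗ[R] (Y →₀ R)) (v : X →₀ R) :
    (extOp f).lin (constHom v) = constHom (f v) := by
  induction v using Finsupp.induction_linear with
  | zero => rw [map_zero, map_zero, map_zero, map_zero]
  | add v w hv hw => rw [map_add, map_add, hv, hw, map_add, map_add]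
  | single x r =>
    rw [constHom_single, map_smul, lin_basis, extOp_apply, ← constHom_smul, ← map_smul,
      Finsupp.smul_single, smul_eq_mul, mul_one]

theorem extOp_comp (g : (Y →₀ R) →ₗ[R] (Z →₀ R)) (f : (X →₀ R) →ₗ[R] (Y →₀ R)) :
    extOp (g ∘ₗ f) = extOp g ⊚ extOp f :=
  ext' fun x => by rw [comp_apply, extOp_apply, extOp_apply, lin_extOp_constHom]; rfl

theorem extOp_add (f g : (X →₀ R) →ₗ[R] (Y →₀ R)) : extOp (f + g) = extOp f + extOp g :=
  ext' fun x => by rw [Op.add_apply, extOp_apply, LinearMap.add_apply, map_add]; rfl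

theorem extOp_sub (f g : (X →₀ R) →ₗ[R] (Y →₀ R)) : extOp (f - g) = extOp f - extOp g :=
  ext' fun x => by rw [Op.sub_apply, extOp_apply, LinearMap.sub_apply, map_sub]; rfl

theorem extOp_id : extOp (LinearMap.id : (X →₀ R) →ₗ[R] (X →₀ R)) = one R X :=
  ext' fun x => by
    ext1 t
    rw [extOp_apply, LinearMap.id_apply, co_constHom, one_apply, co_basis, Finsupp.mapRange_single,
      map_one]

theorem homog_extOp {dX : X → ℤ} {dY : Y → ℤ} {k : ℤ} {f : (X →₀ R) →ₗ[R] (Y →₀ R)}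
    (hf : HasDegree dX dY k f) : Homog dX dY k (extOp f) := by
  intro x t y q h
  rw [coef, extOp_apply, co_constHom] at h
  split_ifs at h with ht
  · rw [Finsupp.mapRange_apply, LaurentPolynomial.C_apply] at h
    split_ifs at h with hq
    · rw [hq, mul_zero, add_zero]
      exact hf x y h
    · exact absurd rfl h
  · exact absurd rfl h

/-- A gapped operator agrees with the extension of its reduction up to energies that are bounded
away from `0`. -/
theorem exists_raises_sub_extOp {φ : Op R X Y} {G : AddSubmonoid (ℝ × ℤ)} (hG : IsGapMonoid G)
    (hφ : ∀ x t y q, (φ x).coef t y q ≠ 0 → (t, q) ∈ G) :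
    ∃ ε > 0, Raises ε (φ - extOp (red φ.app)) := by
  obtain ⟨ε, hε, hb⟩ : ∃ ε > 0, ∀ t ∈ Prod.fst '' (G : Set (ℝ × ℤ)), |t| < ε → t = 0 := by
    have h1 := hG.discrete
    have h0 : (0 : ℝ) ∈ Prod.fst '' (G : Set (ℝ × ℤ)) := ⟨0, G.zero_mem, rfl⟩
    have h2 := h1.to_subtype
    obtain ⟨ε, hε, h⟩ := Metric.isOpen_iff.1
      (isOpen_discrete ({⟨0, h0⟩} : Set (Prod.fst '' (G : Set (ℝ × ℤ))))) _ rfl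
    refine ⟨ε, hε, fun t ht hlt => ?_⟩
    have h3 : (⟨t, ht⟩ : Prod.fst '' (G : Set (ℝ × ℤ))) ∈ Metric.ball ⟨0, h0⟩ ε := by
      rw [Metric.mem_ball, Subtype.dist_eq, Real.dist_eq, sub_zero]
      exact hlt
    exact congrArg Subtype.val (h h3)
  refine ⟨ε, hε, fun x t ht => ?_⟩
  have hne : ∃ y q, (φ x).coef t y q ≠ ((extOp (red φ.app)) x).coef t y q := by
    by_contra! h
    refine ht ?_
    rw [Op.sub_apply, co_sub, sub_eq_zero]
    ext1 y
    exact AddMonoidAlgebra.ext (Finsupp.ext fun q => h y q)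
  obtain ⟨y, q, hne⟩ := hne
  rw [coef, coef, extOp_apply, co_constHom] at hne
  have hred : red φ.app (Finsupp.single x 1) =
      ((φ x).co 0).mapRange (fun p => p.coeff 0) rfl := by
    rw [red, Finsupp.linearCombination_single, one_smul]
  by_cases ht0 : t = 0
  · refine absurd ?_ hne
    subst ht0
    rw [if_pos rfl, hred, Finsupp.mapRange_apply]
    change _ = (LaurentPolynomial.C ((((φ x).co 0) y).coeff 0)).coeff q
    rw [LaurentPolynomial.C_apply]
    split_ifs with hq
    · rw [hq]
    · by_contra h
      have := hG.energy_zero _ (hφ x 0 y q h) rfl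
      exact hq (congrArg Prod.snd this)
  · rw [if_neg ht0] at hne
    have hG' : (t, q) ∈ G := hφ x t y q hne
    by_contra hlt
    refine ht0 (hb t ⟨_, hG', rfl⟩ ?_)
    rw [abs_of_nonneg (hG.nonneg _ hG')]
    exact not_le.1 hlt

end GappedAInf

end

noncomputable section

namespace GappedAInf

open Nov Op

variable {R : Type v} [Field R]

/-! ### Convergent series of operators -/

section Series

variable {X Y Z W : Type u}

/-- A sequence of operators that is uniformly bounded and tends to `0` pointwise. -/
structure IsNull (θ : ℕ → Op R X Y) : Prop where
  bounded : ∃ c, ∀ n, Raises c (θ n)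
  tendsto : ∀ x E, ∃ N, ∀ n ≥ N, MemF E (θ n x)

theorem IsNull.lin {θ : ℕ → Op R X Y} (hθ : IsNull θ) (z : Nov R X) (E : ℝ) :
    ∃ N, ∀ n ≥ N, MemF E ((θ n).lin z) := by
  obtain ⟨c, hc⟩ := hθ.bounded
  obtain ⟨w, hw, hzw⟩ := exists_approx z (E - c)
  suffices h1 : ∀ E, ∃ N, ∀ n ≥ N, MemF E ((θ n).lin w) by
    obtain ⟨N, hN⟩ := h1 E
    refine ⟨N, fun n hn => ?_⟩
    have h2 := (hc n).lin hzw
    rw [add_sub_cancel, map_sub] at h2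
    have := h2.add (hN n hn)
    rwa [sub_add_cancel] at this
  clear hzw
  induction hw using Submodule.span_induction with
  | mem x hx =>
    intro E
    obtain ⟨x, rfl⟩ := hx
    obtain ⟨N, hN⟩ := hθ.tendsto x E
    exact ⟨N, fun n hn => by rw [lin_basis]; exact hN n hn⟩
  | zero => exact fun E => ⟨0, fun n _ => by rw [map_zero]; exact memF_zero⟩
  | add a b _ _ ha hb =>
    intro E
    obtain ⟨N, hN⟩ := ha E
    obtain ⟨N', hN'⟩ := hb E
    refine ⟨max N N', fun n hn => ?_⟩
    rw [map_add]
    exact (hN n (le_of_max_le_left hn)).add (hN' n (le_of_max_le_right hn))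
  | smul r a _ ha =>
    intro E
    obtain ⟨b, hb⟩ := LocFin.bddBelow r.2
    obtain ⟨N, hN⟩ := ha (E - b)
    refine ⟨N, fun n hn => ?_⟩
    rw [map_smul]
    have := memF_smul (fun t ht => hb ht) (hN n hn)
    rwa [add_sub_cancel] at this

theorem IsNull.comp_left {θ : ℕ → Op R X Y} (hθ : IsNull θ) (φ : Op R Y Z) :
    IsNull fun n => φ ⊚ θ n := by
  obtain ⟨c, hc⟩ := hθ.bounded
  obtain ⟨b, hb⟩ := φ.exists_memF_app
  refine ⟨⟨b + c, fun n => Raises.comp hb (hc n)⟩, fun x E => ?_⟩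
  obtain ⟨N, hN⟩ := hθ.tendsto x (E - b)
  refine ⟨N, fun n hn => ?_⟩
  rw [comp_apply]
  have := Raises.lin hb (hN n hn)
  rwa [add_sub_cancel] at this

theorem IsNull.comp_right {θ : ℕ → Op R Y Z} (hθ : IsNull θ) (φ : Op R X Y) :
    IsNull fun n => θ n ⊚ φ := by
  obtain ⟨c, hc⟩ := hθ.bounded
  obtain ⟨b, hb⟩ := φ.exists_memF_app
  refine ⟨⟨c + b, fun n => (hc n).comp hb⟩, fun x E => ?_⟩
  simp only [comp_apply]
  exact hθ.lin _ _

theorem IsNull.tensor_left {θ : ℕ → Op R X Y} (hθ : IsNull θ) (φ : Op R Z W) :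
    IsNull fun n => φ ⊠ θ n := by
  obtain ⟨c, hc⟩ := hθ.bounded
  obtain ⟨b, hb⟩ := φ.exists_memF_app
  refine ⟨⟨b + c, fun n => Raises.tensor hb (hc n)⟩, fun ⟨z, x⟩ E => ?_⟩
  obtain ⟨N, hN⟩ := hθ.tendsto x (E - b)
  refine ⟨N, fun n hn => ?_⟩
  have := memF_prod (hb z) (hN n hn)
  rwa [add_sub_cancel] at this

theorem IsNull.tensor_right {θ : ℕ → Op R X Y} (hθ : IsNull θ) (φ : Op R Z W) :
    IsNull fun n => θ n ⊠ φ := by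
  obtain ⟨c, hc⟩ := hθ.bounded
  obtain ⟨b, hb⟩ := φ.exists_memF_app
  refine ⟨⟨c + b, fun n => (hc n).tensor hb⟩, fun ⟨x, z⟩ E => ?_⟩
  obtain ⟨N, hN⟩ := hθ.tendsto x (E - b)
  refine ⟨N, fun n hn => ?_⟩
  have := memF_prod (hN n hn) (hb z)
  rwa [sub_add_cancel] at this

theorem IsNull.sub {θ θ' : ℕ → Op R X Y} (hθ : IsNull θ) (hθ' : IsNull θ') :
    IsNull fun n => θ n - θ' n := by
  obtain ⟨c, hc⟩ := hθ.bounded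
  obtain ⟨b, hb⟩ := hθ'.bounded
  refine ⟨⟨min c b, fun n => ((hc n).mono (min_le_left _ _)).sub ((hb n).mono (min_le_right _ _))⟩,
    fun x E => ?_⟩
  obtain ⟨N, hN⟩ := hθ.tendsto x E
  obtain ⟨N', hN'⟩ := hθ'.tendsto x E
  refine ⟨max N N', fun n hn => ?_⟩
  rw [Op.sub_apply]
  exact (hN n (le_of_max_le_left hn)).sub (hN' n (le_of_max_le_right hn))

theorem IsNull.zsmul {θ : ℕ → Op R X Y} (hθ : IsNull θ) (m : ℤ) : IsNull fun n => m • θ n := by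
  obtain ⟨c, hc⟩ := hθ.bounded
  refine ⟨⟨c, fun n => (hc n).zsmul m⟩, fun x E => ?_⟩
  obtain ⟨N, hN⟩ := hθ.tendsto x E
  refine ⟨N, fun n hn => ?_⟩
  rw [Op.zsmul_apply]
  exact (hN n hn).zsmul m

theorem IsNull.eq_zero {φ : Op R X Y} (h : IsNull fun _ : ℕ => φ) : φ = 0 := by
  ext1 x
  refine eq_zero_of_memF fun E => ?_
  obtain ⟨N, hN⟩ := h.tendsto x E
  exact hN N le_rfl

/-- A uniformly bounded sequence of homogeneous operators that tends to `0` has a sum. -/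
theorem IsNull.exists_sum {θ : ℕ → Op R X Y} (hθ : IsNull θ) {c : ℝ} (hc : ∀ n, Raises c (θ n))
    {d : X → ℤ} {d' : Y → ℤ} {k : ℤ} (hd : ∀ n, Homog d d' k (θ n)) :
    ∃ σ : Op R X Y, Raises c σ ∧ Homog d d' k σ ∧
      IsNull fun n => σ - ∑ r ∈ Finset.range n, θ r := by
  have hfin : ∀ x, ∀ E : ℝ, {n | ¬ MemF E (θ n x)}.Finite := fun x E => by
    obtain ⟨N, hN⟩ := hθ.tendsto x E
    refine (Finset.range N).finite_toSet.subset fun n hn => ?_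
    rw [Finset.mem_coe, Finset.mem_range]
    by_contra! h
    exact hn (hN n h)
  have hco : ∀ x t, (seriesSum fun n => θ n x).co t = ∑ᶠ n, (θ n x).co t := fun x t => by
    rw [seriesSum, dif_pos (hfin x), co_mk]
  have hF : ∀ x, MemF c (seriesSum fun n => θ n x) := fun x t ht => by
    rw [hco] at ht
    obtain ⟨n, hn⟩ := exists_ne_zero_of_finsum_ne_zero' ht
    exact hc n x t hn
  let σ : Op R X Y := ⟨fun x => seriesSum fun n => θ n x, c, hF⟩
  refine ⟨σ, hF, fun x t => ?_, ⟨⟨c, fun n => ?_⟩, ?_⟩⟩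
  · change HomogCoeff d' (d x + k) ((seriesSum fun n => θ n x).co t)
    rw [hco]
    exact finsum_induction _ homogCoeff_zero (fun _ _ => HomogCoeff.add) fun n => hd n x t
  · exact Raises.sub hF
      (Finset.sum_induction _ (fun φ : Op R X Y => Raises c φ) (fun _ _ => Raises.add) raises_zero
        fun r _ => hc r)
  · intro x E
    obtain ⟨N, hN⟩ := hθ.tendsto x E
    refine ⟨N, fun n hn t ht => ?_⟩
    by_contra hE
    refine ht ?_
    rw [Op.sub_apply, Op.sum_apply, co_sub, co_sum, sub_eq_zero]
    refine (hco x t).trans (finsum_eq_sum_of_support_subset _ fun r hr => ?_)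
    rw [Finset.mem_coe, Finset.mem_range]
    by_contra! h
    exact hE (hN r (hn.trans h) t hr)

theorem IsNull.hat {X₁ J X₀ Y₁ K Y₀ : Type u} {d : X₁ → ℤ} {k : ℤ} {u : Op R (List X₁) (List Y₁)}
    {v : Op R (List X₀) (List Y₀)} {θ : ℕ → Op R (List X₁ × J × List X₀) K} (hθ : IsNull θ) :
    IsNull fun n => hat d k u v (θ n) :=
  ((hθ.tensor_right v).tensor_left _).comp_right _

end Series

theorem hat_sub {X₁ J X₀ Y₁ K Y₀ : Type u} {d : X₁ → ℤ} {k : ℤ} {u : Op R (List X₁) (List Y₁)}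
    {v : Op R (List X₀) (List Y₀)} (θ θ' : Op R (List X₁ × J × List X₀) K) :
    hat d k u v (θ - θ') = hat d k u v θ - hat d k u v θ' := by
  rw [hat, sub_tensor, tensor_sub, sub_comp]
  rfl

theorem hat_add {X₁ J X₀ Y₁ K Y₀ : Type u} {d : X₁ → ℤ} {k : ℤ} {u : Op R (List X₁) (List Y₁)}
    {v : Op R (List X₀) (List Y₀)} (θ θ' : Op R (List X₁ × J × List X₀) K) :
    hat d k u v (θ + θ') = hat d k u v θ + hat d k u v θ' := by
  rw [hat, add_tensor, tensor_add, add_comp]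
  rfl

/-! ### Acyclicity of the kernel of the evaluation -/

section Linear

variable {X₁ J X₀ : Type u}

/-- The inclusion of the cogenerators of a cofree bicomodule. -/
def unitInc (R : Type v) [Field R] (X₁ J X₀ : Type u) : Op R J (List X₁ × J × List X₀) :=
  of fun y => ([], y, [])

theorem cogen_comp_unitInc : cogen R X₁ J X₀ ⊚ unitInc R X₁ J X₀ = one R J :=
  Op.ext' fun y => by rw [unitInc, comp_of_apply, cogen_nil, one_apply]

end Linear

theorem AInfHom.op_nil {C C' : AInfAlgebra.{u} R} {f : AInfHom C C'} (hf : f.IsLinear) :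
    f.op [] = basis [] := by
  obtain ⟨c, hc, h0⟩ := f.zero_pos
  refine eq_of_proj List.length fun n => ?_
  have h1 := proj_hatOp f.filtered hc h0 n []
  refine h1.trans ?_
  cases n with
  | zero =>
    rw [blocks_zero_nil, lin_basis]
    exact (proj_of_mem (s := ofLength _ 0) rfl).symm
  | succ n =>
    rw [blocks_succ, cutSum_nil, hf [] (by simp), prod_zero_left, map_zero, lin_basis]
    exact (proj_of_notMem (R := R) (by simp)).symm

/-- The component `n_{0,0}`. -/
def AInfBimod.n₀ {C₁ C₀ : AInfAlgebra.{u} R} (M : AInfBimod C₁ C₀) : Op R M.ι M.ι :=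
  M.nOp ⊚ unitInc R _ _ _

namespace BimodHom

variable {κ : HomKind} {C₁ C₀ C₁' C₀' : AInfAlgebra.{u} R}
  {M : AInfBimod C₁ C₀} {M' : AInfBimod C₁' C₀'} {f₁ : AInfHom C₁ C₁'} {f₀ : AInfHom C₀ C₀'}

/-- The component `φ_{0,0}`. -/
def φ₀ (φ : BimodHom κ M M' f₁ f₀) : Op R M.ι M'.ι := φ.φOp ⊚ unitInc R _ _ _

theorem φOp_eq {φ : BimodHom κ M M' f₁ f₀} (hφ : φ.IsLinear) : φ.φOp = φ.φ₀ ⊚ cogen R _ _ _ := by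
  ext1 ⟨x, y, z⟩
  rw [comp_apply]
  match x, z with
  | [], [] => rw [cogen_nil, lin_basis, φ₀, unitInc, comp_of_apply]
  | _ :: _, _ => rw [cogen_cons_left, map_zero, φOp_apply, hφ _ _ _ (by simp)]
  | _, _ :: _ => rw [cogen_cons_right, map_zero, φOp_apply, hφ _ _ _ (by simp)]

theorem cogen_comp_op (φ : BimodHom κ M M' f₁ f₀) : cogen R _ _ _ ⊚ φ.op = φ.φOp :=
  cogen_comp_hat f₁.isCoalgMap_op f₀.isCoalgMap_op _

theorem op_comp_unitInc (φ : BimodHom κ M M' f₁ f₀) (h₁ : f₁.IsLinear) (h₀ : f₀.IsLinear) :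
    φ.op ⊚ unitInc R _ _ _ = unitInc R _ _ _ ⊚ φ.φ₀ := by
  ext1 y
  rw [unitInc, comp_of_apply, op, GappedAInf.hat_apply, cutSum_nil, cutSum_nil, wdeg_nil, mul_zero,
    sgn_zero, one_smul, AInfHom.op_nil h₁, AInfHom.op_nil h₀, prod_basis_right, prod_basis_left,
    map_map, comp_apply, φ₀]
  simp only [unitInc, comp_of_apply]
  rfl

theorem φ₀_comp_n₀ {φ : BimodHom κ M M' f₁ f₀} (hφ : φ.IsLinear) (h₁ : f₁.IsLinear)
    (h₀ : f₀.IsLinear) : φ.φ₀ ⊚ M.n₀ = M'.n₀ ⊚ φ.φ₀ := by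
  have h := φ.homDiff_op
  rw [homDiff, sgn_zero, one_smul, sub_eq_zero] at h
  have h2 := congrArg (fun ψ => cogen R _ _ _ ⊚ ψ ⊚ unitInc R _ _ _) h
  beta_reduce at h2
  rw [comp_assoc, op_comp_unitInc φ h₁ h₀, ← comp_assoc, M'.cogen_comp_dOp, comp_assoc φ.op,
    ← comp_assoc (cogen R _ _ _) φ.op, φ.cogen_comp_op, φOp_eq hφ, comp_assoc,
    ← comp_assoc (cogen R _ _ _),
    M.cogen_comp_dOp] at h2
  rw [AInfBimod.n₀, AInfBimod.n₀, comp_assoc, h2]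

theorem homog_φ₀ (φ : BimodHom κ M M' f₁ f₀) : Homog M.sdeg M'.sdeg 0 φ.φ₀ := fun y => by
  have := φ.homog_φOp ([], y, [])
  rw [φ₀, unitInc, comp_of_apply]
  convert this using 1
  simp [AInfBimod.bdeg, barDeg]

theorem raises_φ₀ (φ : BimodHom .filtered M M' f₁ f₀) : Raises 0 φ.φ₀ := fun y => by
  obtain ⟨c, hc, h⟩ := φ.energy_loss
  rw [show c = 0 from hc, neg_zero] at h
  rw [φ₀, unitInc, comp_of_apply]
  exact h _ _ _

end BimodHom

namespace AInfBimod.Model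

variable {C₁ C₀ : AInfAlgebra.{u} R} {M : AInfBimod C₁ C₀} {𝔠₁ : C₁.Model} {𝔠₀ : C₀.Model}

theorem ev_comp_incl (𝔪 : M.Model 𝔠₁ 𝔠₀) (s : Fin 2) : (𝔪.ev s).φ₀ ⊚ 𝔪.incl.φ₀ = one R _ := by
  have h : (𝔪.ev s).op ⊚ 𝔪.incl.op = one R _ := lin_injective (by
    rw [lin_comp, BimodHom.lin_op, BimodHom.lin_op, lin_one]
    exact 𝔪.ev_incl s)
  have h2 := congrArg (fun ψ => cogen R _ _ _ ⊚ ψ ⊚ unitInc R _ _ _) h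
  beta_reduce at h2
  rw [comp_assoc, BimodHom.op_comp_unitInc _ 𝔠₁.incl_linear 𝔠₀.incl_linear, ← comp_assoc,
    BimodHom.cogen_comp_op, BimodHom.φOp_eq (𝔪.ev_linear s), comp_assoc,
    ← comp_assoc (cogen R _ _ _),
    cogen_comp_unitInc, one_comp, one_comp, cogen_comp_unitInc] at h2
  exact h2

/-- On the kernel of an evaluation there is an operator `η` of degree `-1` that contracts `n_{0,0}`
up to terms of positive energy: the projection of a contraction over `R`. -/
theorem exists_contraction (𝔪 : M.Model 𝔠₁ 𝔠₀) (s : Fin 2) :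
    ∃ (η : Op R 𝔪.mod.ι 𝔪.mod.ι) (ε : ℝ), 0 < ε ∧ Homog 𝔪.mod.sdeg 𝔪.mod.sdeg (-1) η ∧
      Raises 0 η ∧ (𝔪.ev s).φ₀ ⊚ η = 0 ∧
      Raises ε (one R _ - 𝔪.incl.φ₀ ⊚ (𝔪.ev s).φ₀ - (𝔪.mod.n₀ ⊚ η + η ⊚ 𝔪.mod.n₀)) := by
  set i := 𝔪.incl.φ₀ with hi
  set e := (𝔪.ev s).φ₀ with he
  set n := 𝔪.mod.n₀ with hn
  have hei : e ⊚ i = one R _ := 𝔪.ev_comp_incl s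
  have hen : e ⊚ n = M.n₀ ⊚ e :=
    BimodHom.φ₀_comp_n₀ (𝔪.ev_linear s) (𝔠₁.ev_linear s) (𝔠₀.ev_linear s)
  have hin : i ⊚ M.n₀ = n ⊚ i :=
    BimodHom.φ₀_comp_n₀ 𝔪.incl_linear 𝔠₁.incl_linear 𝔠₀.incl_linear
  have he0 : Raises 0 e := (𝔪.ev s).raises_φ₀
  have hi0 : Raises 0 i := 𝔪.incl.raises_φ₀
  obtain ⟨-, -, w, h, h', -, -, hh', -, -, hw⟩ := 𝔪.incl_equiv
  obtain ⟨G, hG, hGn⟩ := 𝔪.mod_gapped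
  obtain ⟨G', S, hG', hS, hGi⟩ := 𝔪.incl_gapped
  change S = _ at hS
  subst hS
  obtain ⟨ε, hε, h1⟩ := exists_raises_sub_extOp (φ := n) hG fun x t y q hx =>
    hGn [] x [] t y q (by rwa [hn, n₀, unitInc, comp_of_apply] at hx)
  obtain ⟨ε', hε', h2⟩ := exists_raises_sub_extOp (φ := i) hG' fun x t y q hx =>
    hGi [] x [] t y q (by rwa [hi, BimodHom.φ₀, unitInc, comp_of_apply] at hx)
  have hrn : red n.app = 𝔪.mod.redDiff := congrArg red (funext fun y => comp_of_apply _ _ _)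
  have hri : red i.app = 𝔪.incl.redLin := congrArg red (funext fun y => comp_of_apply _ _ _)
  rw [hrn] at h1
  rw [hri] at h2
  set H := extOp (R := R) h' with hH
  set Δ := extOp (R := R) 𝔪.mod.redDiff with hΔ
  set I := extOp (R := R) 𝔪.incl.redLin with hI
  set W := extOp (R := R) w with hW
  have hIW : I ⊚ W - one R _ = Δ ⊚ H + H ⊚ Δ := by
    rw [hI, hW, hΔ, hH, ← extOp_comp, ← extOp_comp, ← extOp_comp, ← extOp_id, ← extOp_sub, hw,
      extOp_add]
  -- The projection to the kernel of `e` along the image of `i`; it commutes with `n`.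
  set Q := one R _ - i ⊚ e with hQ
  have hQi : Q ⊚ i = 0 := by rw [hQ, sub_comp, comp_assoc, hei, one_comp, comp_one, sub_self]
  have heQ : e ⊚ Q = 0 := by rw [hQ, comp_sub, ← comp_assoc, hei, one_comp, comp_one, sub_self]
  have hnQ : n ⊚ Q = Q ⊚ n := by
    rw [hQ, sub_comp, comp_sub, comp_one, one_comp, comp_assoc, hen, ← comp_assoc, ← hin,
      comp_assoc]
  have hQ0 : Raises 0 Q := raises_one.sub ((hi0.comp he0).mono (by norm_num))
  have hQd : Homog 𝔪.mod.sdeg 𝔪.mod.sdeg 0 Q :=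
    homog_one.sub ((𝔪.incl.homog_φ₀.comp (𝔪.ev s).homog_φ₀ :))
  have hHd : Homog 𝔪.mod.sdeg 𝔪.mod.sdeg (-1) H := by
    refine homog_extOp fun x y hxy => ?_
    have := hh' x y hxy
    simp only [AInfBimod.sdeg]
    omega
  refine ⟨-(Q ⊚ H), min ε ε', lt_min hε hε', ?_, ?_, ?_, ?_⟩
  · have := hQd.comp hHd
    rw [add_zero] at this
    exact this.neg
  · exact ((hQ0.comp (raises_extOp _)).mono (by norm_num)).neg
  · rw [comp_neg, ← comp_assoc, heQ, zero_comp, neg_zero]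
  -- `Q` annihilates `i ⊚ W`, so that `1 = I ⊚ W - (Δ ⊚ H + H ⊚ Δ)` leaves only the differences
  -- between operators and their reductions.
  · have key : Q - (n ⊚ (-(Q ⊚ H)) + (-(Q ⊚ H)) ⊚ n) =
        Q ⊚ ((n - Δ) ⊚ H + H ⊚ (n - Δ) - (i - I) ⊚ W) := by
      have e1 : n ⊚ Q ⊚ H = Q ⊚ n ⊚ H := by rw [← comp_assoc, hnQ, comp_assoc]
      have e2 : (n - Δ) ⊚ H + H ⊚ (n - Δ) - (i - I) ⊚ W =
          (n ⊚ H + H ⊚ n) - i ⊚ W + one R _ := by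
        rw [sub_comp, comp_sub, sub_comp, sub_add_sub_comm, ← hIW]
        abel
      rw [e2, comp_add, comp_sub, comp_add, ← comp_assoc Q i, hQi, zero_comp, comp_one, comp_neg,
        neg_comp, e1, comp_assoc]
      abel
    rw [key]
    have b1 : Raises (min ε ε') ((n - Δ) ⊚ H) :=
      (h1.comp (raises_extOp _)).mono (by rw [add_zero]; exact min_le_left _ _)
    have b2 : Raises (min ε ε') (H ⊚ (n - Δ)) :=
      ((raises_extOp _).comp h1).mono (by rw [zero_add]; exact min_le_left _ _)
    have b3 : Raises (min ε ε') ((i - I) ⊚ W) :=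
      (h2.comp (raises_extOp _)).mono (by rw [add_zero]; exact min_le_right _ _)
    exact (hQ0.comp ((b1.add b2).sub b3)).mono (by rw [zero_add])

end AInfBimod.Model

end GappedAInf

end

noncomputable section

namespace GappedAInf

open Nov Op

variable {R : Type v} [Field R]

section Weighted

variable {X₁ X₀ Y₁ Y₀ J K L : Type u}

/-- The weighted energy filtration: the energy is at least `a`, up to a loss of `ε` for each letter
of the two words. -/
def WRaises (ε a : ℝ) (θ : Op R (List X₁ × J × List X₀) K) : Prop :=
  ∀ x y z, MemF (a - ε * (x.length + z.length)) (θ (x, y, z))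

variable {ε a : ℝ} {θ θ' : Op R (List X₁ × J × List X₀) K}

theorem WRaises.sub (h : WRaises ε a θ) (h' : WRaises ε a θ') : WRaises ε a (θ - θ') :=
  fun x y z => by
    rw [Op.sub_apply]
    exact (h x y z).sub (h' x y z)

theorem WRaises.comp_left {c : ℝ} {φ : Op R K L} (hφ : Raises c φ) (h : WRaises ε a θ) :
    WRaises ε (a + c) (φ ⊚ θ) := fun x y z => by
  rw [comp_apply]
  exact (hφ.lin (h x y z)).mono (by linarith)

theorem _root_.GappedAInf.Op.Raises.wRaises (hε : 0 ≤ ε) (h : Raises a θ) : WRaises ε a θ :=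
  fun x y z => (h _).mono (by
    have : 0 ≤ ε * ((x.length : ℝ) + z.length) := by positivity
    linarith)

/-- An operator that vanishes on cogenerators gains energy on a bicomodule map: at least one letter
of the arguments, or an amount of energy `ε`, has been split off. -/
theorem WRaises.comp_hat {d : X₁ → ℤ} {k : ℤ} {u : Op R (List X₁) (List Y₁)}
    {v : Op R (List X₀) (List Y₀)} (hu : Raises 0 u) (hv : Raises 0 v) (hε : 0 ≤ ε)
    (hu₀ : MemF ε (u [] - basis [])) (hv₀ : MemF ε (v [] - basis []))
    {ρ : Op R (List Y₁ × K × List Y₀) L} (hρ : Raises 0 ρ) (hρ₀ : ρ ⊚ unitInc R _ _ _ = 0)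
    (h : WRaises ε a θ) : WRaises ε (a + ε) (ρ ⊚ hat d k u v θ) := by
  intro x y z
  rw [comp_apply, hat_apply, map_cutSum]
  refine memF_cutSum fun x₁ x₂ hx => ?_
  rw [map_cutSum]
  refine memF_cutSum fun z₁ z₂ hz => ?_
  rw [map_zsmul]
  refine MemF.zsmul ?_ _
  have hlx : (x.length : ℝ) = x₁.length + x₂.length := by
    rw [← hx, List.length_append, Nat.cast_add]
  have hlz : (z.length : ℝ) = z₁.length + z₂.length := by
    rw [← hz, List.length_append, Nat.cast_add]
  have hθ := h x₂ y z₁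
  have key : ∀ {b c : ℝ} {s : Nov R (List Y₁)} {t : Nov R (List Y₀)}, MemF b s → MemF c t →
      ε ≤ b + c + ε * (x₁.length + z₂.length) →
      MemF (a + ε - ε * (x.length + z.length)) (ρ.lin (Op.prod s (Op.prod (θ (x₂, y, z₁)) t))) := by
    intro b c s t hs ht hbc
    refine (hρ.lin (memF_prod hs (memF_prod hθ ht))).mono ?_
    rw [hlx, hlz]
    nlinarith
  match x₁, z₂ with
  | [], [] =>
    -- Up to terms of energy at least `ε`, the words `u []` and `v []` are empty.
    have h0 : ρ.lin (Op.prod (basis []) (Op.prod (θ (x₂, y, z₁)) (basis []))) = 0 := by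
      have := lin_comp_apply ρ (unitInc R Y₁ K Y₀) (θ (x₂, y, z₁))
      rw [hρ₀, lin_zero_apply] at this
      rw [prod_basis_right, prod_basis_left, map_map]
      exact this.symm
    have e1 : Op.prod (u []) (Op.prod (θ (x₂, y, z₁)) (v [])) =
        Op.prod (u [] - basis []) (Op.prod (θ (x₂, y, z₁)) (v [])) +
        (Op.prod (basis []) (Op.prod (θ (x₂, y, z₁)) (v [] - basis [])) +
          Op.prod (basis []) (Op.prod (θ (x₂, y, z₁)) (basis []))) := by
      rw [← prod_add_right, ← prod_add_right, sub_add_cancel, ← prod_add_left, sub_add_cancel]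
    rw [e1, map_add, map_add, h0, add_zero]
    exact (key hu₀ (hv []) (by simp)).add (key (memF_basis _) hv₀ (by simp))
  -- Otherwise a letter has been split off, which pays for the gain in the weighted filtration.
  | b :: x₁, z₂ =>
    refine key (hu _) (hv _) ?_
    have : 0 ≤ ε * ((x₁.length : ℝ) + z₂.length) := by positivity
    push_cast [List.length_cons]
    linarith
  | x₁, b :: z₂ =>
    refine key (hu _) (hv _) ?_
    have : 0 ≤ ε * ((x₁.length : ℝ) + z₂.length) := by positivity
    push_cast [List.length_cons]
    linarith

end Weighted

section Acyclic

variable {A₁ A₀ C₁ C₀ B₁ B₀ : AInfAlgebra.{u} R} {P : AInfBimod A₁ A₀} {M : AInfBimod C₁ C₀}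
  {N : AInfBimod B₁ B₀} {f₁ : AInfHom C₁ B₁} {f₀ : AInfHom C₀ B₀} {φ : BimodHom .filtered M N f₁ f₀}
  {u : Op R (List A₁.ι) (List C₁.ι)} {v : Op R (List A₀.ι) (List C₀.ι)}
  {η : Op R M.ι M.ι} {i : Op R N.ι M.ι} {κ : HomKind} {k : ℤ}
  {U : Op R (List A₁.ι × P.ι × List A₀.ι) (List C₁.ι × M.ι × List C₀.ι)} {ε : ℝ}

/-- The operations of a bimodule apart from `n_{0,0}`. -/
def AInfBimod.ρ (M : AInfBimod C₁ C₀) : Op R (List C₁.ι × M.ι × List C₀.ι) M.ι :=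
  M.nOp - M.n₀ ⊚ cogen R _ _ _

theorem AInfBimod.ρ_comp_unitInc (M : AInfBimod C₁ C₀) : M.ρ ⊚ unitInc R _ _ _ = 0 := by
  rw [ρ, sub_comp, comp_assoc, cogen_comp_unitInc, comp_one, n₀, sub_self]

theorem AInfBimod.raises_n₀ (M : AInfBimod C₁ C₀) : Raises 0 M.n₀ :=
  (M.raises_nOp.comp (raises_of _)).mono (by norm_num)

theorem AInfBimod.raises_ρ (M : AInfBimod C₁ C₀) : Raises 0 M.ρ :=
  M.raises_nOp.sub ((M.raises_n₀.comp raises_cogen).mono (by norm_num))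

/-- The pre-homomorphism whose components are the contraction `η` applied to those of `U`. -/
def contract (u : Op R (List A₁.ι) (List C₁.ι)) (v : Op R (List A₀.ι) (List C₀.ι)) (k : ℤ)
    (η : Op R M.ι M.ι)
    (U : Op R (List A₁.ι × P.ι × List A₀.ι) (List C₁.ι × M.ι × List C₀.ι)) :
    Op R (List A₁.ι × P.ι × List A₀.ι) (List C₁.ι × M.ι × List C₀.ι) :=
  hat A₁.sdeg k u v (η ⊚ cogen R _ _ _ ⊚ U)

theorem BimodHom.op_comp_eq_zero_iff (hu : IsDGMap A₁ C₁ u) (hφ : φ.IsLinear)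
    (hU : IsComod A₁.sdeg k u v U) :
    φ.op ⊚ U = 0 ↔ φ.φ₀ ⊚ cogen R _ _ _ ⊚ U = 0 := by
  rw [← comp_assoc, ← φOp_eq hφ, ← φ.cogen_comp_op, comp_assoc]
  constructor
  · intro h
    rw [h, comp_zero]
  · intro h
    refine (φ.isHom_op.comod.comp hU hu.toIsCoalgMap).ext isComod_zero ?_
    rw [h, comp_zero]

theorem op_comp_contract (hu : IsDGMap A₁ C₁ u) (hv : IsDGMap A₀ C₀ v) (hφ : φ.IsLinear)
    (hη : φ.φ₀ ⊚ η = 0) : φ.op ⊚ contract u v k η U = 0 := by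
  rw [contract,
    BimodHom.op_comp_eq_zero_iff hu hφ (isComod_hat hu.toIsCoalgMap hv.toIsCoalgMap _),
    cogen_comp_hat hu.toIsCoalgMap hv.toIsCoalgMap, ← comp_assoc, hη, zero_comp]

/-- The components of the error that is left after `U` has been approximated by the commutator of
its contraction: the defect of `η` as a contraction of `n_{0,0}`, and terms that involve the other
operations. -/
theorem cogen_comp_sub_homDiff (hu : IsDGMap A₁ C₁ u) (hv : IsDGMap A₀ C₀ v) (hφ : φ.IsLinear)
    (hU : IsHom κ (k + 1) P M u v U) (hUc : homDiff P M (k + 1) U = 0) (hUφ : φ.op ⊚ U = 0) :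
    cogen R _ _ _ ⊚ (U - homDiff P M k (contract u v k η U)) =
      (one R _ - i ⊚ φ.φ₀ - (M.n₀ ⊚ η + η ⊚ M.n₀)) ⊚ cogen R _ _ _ ⊚ U -
        M.ρ ⊚ contract u v k η U -
        η ⊚ M.ρ ⊚ hat A₁.sdeg (k + 1) u v (cogen R _ _ _ ⊚ U) := by
  have h1 : φ.φ₀ ⊚ cogen R _ _ _ ⊚ U = 0 :=
    (BimodHom.op_comp_eq_zero_iff hu hφ hU.comod).1 hUφ
  have h2 : cogen R _ _ _ ⊚ contract u v k η U = η ⊚ cogen R _ _ _ ⊚ U :=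
    cogen_comp_hat hu.toIsCoalgMap hv.toIsCoalgMap _
  have h3 : cogen R _ _ _ ⊚ U ⊚ P.dOp = -sgn k • M.nOp ⊚ U := by
    rw [homDiff, sub_eq_zero] at hUc
    have := congrArg (fun ψ => sgn (k + 1) • cogen R _ _ _ ⊚ ψ) hUc
    beta_reduce at this
    rw [comp_zsmul, smul_smul, sgn_mul_self, one_smul, ← comp_assoc (cogen R _ _ _) M.dOp,
      M.cogen_comp_dOp, sgn_add, sgn_one, mul_neg_one] at this
    exact this.symm
  have hn : M.nOp = M.n₀ ⊚ cogen R _ _ _ + M.ρ := by rw [AInfBimod.ρ, add_sub_cancel]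
  rw [homDiff, comp_sub, comp_sub, ← comp_assoc _ M.dOp, M.cogen_comp_dOp, comp_zsmul,
    ← comp_assoc _ (contract u v k η U) P.dOp, h2, comp_assoc η, comp_assoc (cogen R _ _ _) U, h3,
    comp_zsmul, smul_smul, mul_neg, sgn_mul_self, neg_one_zsmul, ← hU.comod.eq_hat, hn, add_comp,
    add_comp, comp_assoc M.n₀, comp_assoc M.n₀, h2, sub_comp, sub_comp, comp_assoc i, h1, comp_zero,
    one_comp, add_comp, comp_assoc, comp_assoc, comp_add]
  abel

/-- One step of the construction of a primitive: it gains energy `ε`. -/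
theorem wRaises_sub_homDiff (hu : IsDGMap A₁ C₁ u) (hv : IsDGMap A₀ C₀ v) (hφ : φ.IsLinear)
    (hε : 0 ≤ ε) (hu₀ : MemF ε (u [] - basis [])) (hv₀ : MemF ε (v [] - basis []))
    (hη0 : Raises 0 η)
    (hηi : Raises ε (one R _ - i ⊚ φ.φ₀ - (M.n₀ ⊚ η + η ⊚ M.n₀)))
    (hU : IsHom κ (k + 1) P M u v U) (hUc : homDiff P M (k + 1) U = 0) (hUφ : φ.op ⊚ U = 0)
    {a : ℝ} (ha : WRaises ε a (cogen R _ _ _ ⊚ U)) :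
    WRaises ε (a + ε) (cogen R _ _ _ ⊚ (U - homDiff P M k (contract u v k η U))) := by
  rw [cogen_comp_sub_homDiff (i := i) hu hv hφ hU hUc hUφ]
  have h1 : WRaises ε a (η ⊚ cogen R _ _ _ ⊚ U) := by
    have := ha.comp_left hη0
    rwa [add_zero] at this
  have h2 : WRaises ε (a + ε) (M.ρ ⊚ contract u v k η U) :=
    h1.comp_hat hu.raises hv.raises hε hu₀ hv₀ M.raises_ρ M.ρ_comp_unitInc
  have h3 : WRaises ε (a + ε) (M.ρ ⊚ hat A₁.sdeg (k + 1) u v (cogen R _ _ _ ⊚ U)) :=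
    ha.comp_hat hu.raises hv.raises hε hu₀ hv₀ M.raises_ρ M.ρ_comp_unitInc
  have h4 := h3.comp_left hη0
  rw [add_zero] at h4
  exact ((ha.comp_left hηi).sub h2).sub h4

theorem homog_contract_comp (hη : Homog M.sdeg M.sdeg (-1) η) (hU : IsHom κ (k + 1) P M u v U) :
    Homog P.bdeg M.sdeg k (η ⊚ cogen R _ _ _ ⊚ U) := by
  have h := hη.comp ((homog_cogen C₁.sdeg M.sdeg C₀.sdeg).comp hU.homog)
  have e : k + 1 + 0 + -1 = k := by ring
  rwa [e] at h

theorem exists_allows_contract (hη0 : Raises 0 η) (hU : IsHom κ (k + 1) P M u v U) :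
    ∃ c, κ.Allows c ∧ Raises (-c) (η ⊚ cogen R _ _ _ ⊚ U) := by
  obtain ⟨c, hc, h⟩ := hU.loss
  exact ⟨c, hc, (hη0.comp (raises_cogen.comp h)).mono (by linarith)⟩

/-- Closed pre-homomorphisms in the kernel of a linear homomorphism are exact in this kernel if the
linear parts are contractible up to positive energy. The primitive is the contraction of the sum of
the errors of successive approximations. -/
theorem exists_homDiff_eq (hu : IsDGMap A₁ C₁ u) (hv : IsDGMap A₀ C₀ v) (hφ : φ.IsLinear)
    (hε : 0 < ε) (hη : Homog M.sdeg M.sdeg (-1) η) (hη0 : Raises 0 η) (hφη : φ.φ₀ ⊚ η = 0)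
    (hηi : Raises ε (one R _ - i ⊚ φ.φ₀ - (M.n₀ ⊚ η + η ⊚ M.n₀)))
    (hU : IsHom κ (k + 1) P M u v U) (hUc : homDiff P M (k + 1) U = 0) (hUφ : φ.op ⊚ U = 0) :
    ∃ V, IsHom κ k P M u v V ∧ φ.op ⊚ V = 0 ∧ homDiff P M k V = U := by
  obtain ⟨ε₁, hε₁, hu₁⟩ := hu.nil
  obtain ⟨ε₀, hε₀, hv₁⟩ := hv.nil
  obtain ⟨δ, hδ, hδ', hδ₁, hδ₀⟩ : ∃ δ > 0, δ ≤ ε ∧ δ ≤ ε₁ ∧ δ ≤ ε₀ :=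
    ⟨min ε (min ε₁ ε₀), lt_min hε (lt_min hε₁ hε₀), min_le_left _ _,
      (min_le_right _ _).trans (min_le_left _ _), (min_le_right _ _).trans (min_le_right _ _)⟩
  obtain ⟨c, hc, hUR⟩ := hU.loss
  -- The errors: their components tend to `0` pointwise, not uniformly, since the weighted
  -- filtration depends on the length of the words.
  let S : ℕ → Op R (List A₁.ι × P.ι × List A₀.ι) (List C₁.ι × M.ι × List C₀.ι) := fun n =>
    Nat.rec U (fun _ W => W - homDiff P M k (contract u v k η W)) n
  have hS : ∀ n, S (n + 1) = S n - homDiff P M k (contract u v k η (S n)) := fun n => rfl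
  have hmain : ∀ n, IsHom κ (k + 1) P M u v (S n) ∧ homDiff P M (k + 1) (S n) = 0 ∧
      φ.op ⊚ S n = 0 ∧ Raises (-c) (S n) ∧ WRaises δ (-c + n * δ) (cogen R _ _ _ ⊚ S n) := by
    intro n
    induction n with
    | zero =>
      refine ⟨hU, hUc, hUφ, hUR, ?_⟩
      rw [Nat.cast_zero, zero_mul, add_zero]
      exact ((raises_cogen.comp hUR).mono (by linarith)).wRaises hδ.le
    | succ n ih =>
      obtain ⟨h1, h2, h3, h4, h5⟩ := ih
      have hc1 : IsHom κ k P M u v (contract u v k η (S n)) :=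
        isHom_hat hu.toIsCoalgMap hv.toIsCoalgMap (homog_contract_comp hη h1)
          (exists_allows_contract hη0 h1)
      have hcR : Raises (-c) (contract u v k η (S n)) :=
        raises_hat hu.raises hv.raises ((hη0.comp (raises_cogen.comp h4)).mono (by linarith))
      rw [hS]
      refine ⟨h1.sub (hc1.homDiff hu hv), ?_, ?_, ?_, ?_⟩
      · rw [homDiff_sub, h2, homDiff_homDiff, sub_zero]
      · rw [comp_sub, h3, ← homDiff_comp_of_closed φ.homDiff_op, op_comp_contract hu hv hφ hφη,
          homDiff_zero, sub_zero]
      · refine h4.sub (Raises.sub ?_ (Raises.zsmul ?_ _))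
        · exact (M.raises_dOp.comp hcR).mono (by linarith)
        · exact (hcR.comp P.raises_dOp).mono (by linarith)
      · have := wRaises_sub_homDiff (i := i) hu hv hφ hδ.le (hu₁.mono hδ₁) (hv₁.mono hδ₀) hη0
          (hηi.mono hδ') h1 h2 h3 h5
        convert this using 1
        push_cast
        ring
  have hnull : IsNull fun n => cogen R C₁.ι M.ι C₀.ι ⊚ S n := by
    refine ⟨⟨-c, fun n => (raises_cogen.comp (hmain n).2.2.2.1).mono (by linarith)⟩,
      fun ⟨x, y, z⟩ E => ?_⟩
    obtain ⟨n₁, hn₁⟩ := exists_nat_gt ((E + c + δ * (x.length + z.length)) / δ)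
    refine ⟨n₁, fun n hn => ((hmain n).2.2.2.2 x y z).mono ?_⟩
    rw [div_lt_iff₀ hδ] at hn₁
    have : (n₁ : ℝ) * δ ≤ n * δ := by
      have : (n₁ : ℝ) ≤ n := by exact_mod_cast hn
      nlinarith
    linarith
  obtain ⟨σ, hσR, hσd, hσ⟩ := hnull.exists_sum
    (fun n => (raises_cogen.comp (hmain n).2.2.2.1).mono (show -c ≤ 0 + -c by linarith))
    (fun n => by
      have := (homog_cogen C₁.sdeg M.sdeg C₀.sdeg).comp (hmain n).1.homog
      rwa [add_zero] at this)
  have hpart : ∀ n, S n = U - homDiff P M k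
      (hat A₁.sdeg k u v (η ⊚ ∑ r ∈ Finset.range n, cogen R _ _ _ ⊚ S r)) := by
    intro n
    induction n with
    | zero =>
      rw [Finset.sum_range_zero, comp_zero, hat, zero_tensor, tensor_zero, zero_comp, homDiff_zero,
        sub_zero]
      rfl
    | succ n ih =>
      rw [hS, Finset.sum_range_succ, comp_add, hat_add, homDiff_add, contract, ← sub_sub, ← ih]
  have hV : IsHom κ k P M u v (hat A₁.sdeg k u v (η ⊚ σ)) := by
    refine isHom_hat hu.toIsCoalgMap hv.toIsCoalgMap ?_ ⟨c, hc, (hη0.comp hσR).mono (by linarith)⟩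
    have h := hη.comp hσd
    have e : k + 1 + -1 = k := by ring
    rwa [e] at h
  refine ⟨_, hV, ?_, ?_⟩
  · rw [BimodHom.op_comp_eq_zero_iff hu hφ hV.comod, cogen_comp_hat hu.toIsCoalgMap hv.toIsCoalgMap,
      ← comp_assoc, hφη, zero_comp]
  · refine ((hV.homDiff hu hv).comod).ext hU.comod (sub_eq_zero.1 (IsNull.eq_zero ?_))
    have h1 : ∀ n, cogen R C₁.ι M.ι C₀.ι ⊚ homDiff P M k (hat A₁.sdeg k u v (η ⊚ σ)) -
        cogen R _ _ _ ⊚ U = cogen R _ _ _ ⊚ homDiff P M k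
          (hat A₁.sdeg k u v (η ⊚ (σ - ∑ r ∈ Finset.range n, cogen R _ _ _ ⊚ S r))) -
        cogen R _ _ _ ⊚ S n := by
      intro n
      rw [← comp_sub, ← comp_sub, hpart n, comp_sub η, hat_sub, homDiff_sub]
      congr 1
      abel
    rw [funext h1]
    have h2 := (hσ.comp_left η).hat (d := A₁.sdeg) (k := k) (u := u) (v := v)
    refine IsNull.sub (IsNull.comp_left (IsNull.sub (h2.comp_left _) ((h2.comp_right _).zsmul _)) _)
      hnull

end Acyclic

end GappedAInf

end

noncomputable section

namespace GappedAInf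

open Nov Op

variable {R : Type v} [Field R]

/-! ### Homotopy classes of homomorphisms -/

section HomotopyClasses

variable {A₁ A₀ C₁ C₀ B₁ B₀ D₁ D₀ : AInfAlgebra.{u} R} {κ : HomKind} {P : AInfBimod A₁ A₀}
  {M : AInfBimod C₁ C₀} {N : AInfBimod B₁ B₀} {L : AInfBimod D₁ D₀}
  {u : Op R (List A₁.ι) (List C₁.ι)} {u₀ : Op R (List A₀.ι) (List C₀.ι)}
  {v : Op R (List A₁.ι) (List B₁.ι)} {v₀ : Op R (List A₀.ι) (List B₀.ι)}
  {w : Op R (List A₁.ι) (List D₁.ι)} {w₀ : Op R (List A₀.ι) (List D₀.ι)}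
  {U U' : Op R (List A₁.ι × P.ι × List A₀.ι) (List C₁.ι × M.ι × List C₀.ι)}
  {W : Op R (List C₁.ι × M.ι × List C₀.ι) (List B₁.ι × N.ι × List B₀.ι)}
  {W' : Op R (List B₁.ι × N.ι × List B₀.ι) (List D₁.ι × L.ι × List D₀.ι)}

theorem IsHom.of_filtered {k : ℤ} (hU : IsHom .filtered k P M u u₀ U) : IsHom κ k P M u u₀ U := by
  obtain ⟨c, hc, h⟩ := hU.loss
  rw [show c = 0 from hc] at h
  exact ⟨hU.comod, hU.homog, 0, κ.allows_zero, h⟩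

/-- Closed pre-homomorphisms of degree `0`, that is, homomorphisms. -/
structure IsClosed (κ : HomKind) (P : AInfBimod A₁ A₀) (M : AInfBimod C₁ C₀)
    (u : Op R (List A₁.ι) (List C₁.ι)) (u₀ : Op R (List A₀.ι) (List C₀.ι))
    (U : Op R (List A₁.ι × P.ι × List A₀.ι) (List C₁.ι × M.ι × List C₀.ι)) : Prop where
  isHom : IsHom κ 0 P M u u₀ U
  closed : homDiff P M 0 U = 0

/-- Exact pre-homomorphisms of degree `0`. -/
def IsExact (κ : HomKind) (P : AInfBimod A₁ A₀) (M : AInfBimod C₁ C₀)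
    (u : Op R (List A₁.ι) (List C₁.ι)) (u₀ : Op R (List A₀.ι) (List C₀.ι))
    (U : Op R (List A₁.ι × P.ι × List A₀.ι) (List C₁.ι × M.ι × List C₀.ι)) : Prop :=
  ∃ V, IsHom κ (-1) P M u u₀ V ∧ homDiff P M (-1) V = U

theorem IsExact.add (hU : IsExact κ P M u u₀ U) (hU' : IsExact κ P M u u₀ U') :
    IsExact κ P M u u₀ (U + U') := by
  obtain ⟨V, hV, rfl⟩ := hU
  obtain ⟨V', hV', rfl⟩ := hU'
  exact ⟨V + V', hV.add hV', homDiff_add _ _⟩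

theorem isExact_zero : IsExact κ P M u u₀ 0 := ⟨0, isHom_zero, homDiff_zero⟩

theorem IsClosed.sub (hU : IsClosed κ P M u u₀ U) (hU' : IsClosed κ P M u u₀ U') :
    IsClosed κ P M u u₀ (U - U') :=
  ⟨hU.isHom.sub hU'.isHom, by rw [homDiff_sub, hU.closed, hU'.closed, sub_zero]⟩

/-- Composition with the closed operator `W` is a map from pre-homomorphisms over `(u, u₀)` to
pre-homomorphisms over `(v, v₀)`. -/
structure PostHom (κ : HomKind) (P : AInfBimod A₁ A₀) (M : AInfBimod C₁ C₀) (N : AInfBimod B₁ B₀)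
    (u : Op R (List A₁.ι) (List C₁.ι)) (u₀ : Op R (List A₀.ι) (List C₀.ι))
    (v : Op R (List A₁.ι) (List B₁.ι)) (v₀ : Op R (List A₀.ι) (List B₀.ι))
    (W : Op R (List C₁.ι × M.ι × List C₀.ι) (List B₁.ι × N.ι × List B₀.ι)) : Prop where
  maps : ∀ k U, IsHom κ k P M u u₀ U → IsHom κ k P N v v₀ (W ⊚ U)
  closed : homDiff M N 0 W = 0

/-- Composition with `W` is a bijection on homotopy classes of homomorphisms. -/
structure PostBij (κ : HomKind) (P : AInfBimod A₁ A₀) (M : AInfBimod C₁ C₀) (N : AInfBimod B₁ B₀)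
    (u : Op R (List A₁.ι) (List C₁.ι)) (u₀ : Op R (List A₀.ι) (List C₀.ι))
    (v : Op R (List A₁.ι) (List B₁.ι)) (v₀ : Op R (List A₀.ι) (List B₀.ι))
    (W : Op R (List C₁.ι × M.ι × List C₀.ι) (List B₁.ι × N.ι × List B₀.ι)) : Prop
    extends PostHom κ P M N u u₀ v v₀ W where
  inj : ∀ U, IsClosed κ P M u u₀ U → IsExact κ P N v v₀ (W ⊚ U) → IsExact κ P M u u₀ U
  surj : ∀ U, IsClosed κ P N v v₀ U → ∃ U', IsClosed κ P M u u₀ U' ∧ IsExact κ P N v v₀ (W ⊚ U' - U)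

theorem IsClosed.postHom {u' : Op R (List C₁.ι) (List B₁.ι)} {v' : Op R (List C₀.ι) (List B₀.ι)}
    (hW : IsClosed κ M N u' v' W) (hu : IsCoalgMap A₁.sdeg C₁.sdeg u) (h : u' ⊚ u = v)
    (h₀ : v' ⊚ u₀ = v₀) : PostHom κ P M N u u₀ v v₀ W := by
  refine ⟨fun k U hU => ?_, hW.closed⟩
  have := hW.isHom.comp hU hu
  rwa [add_zero, h, h₀] at this

theorem PostHom.isClosed (hW : PostHom κ P M N u u₀ v v₀ W) (hU : IsClosed κ P M u u₀ U) :
    IsClosed κ P N v v₀ (W ⊚ U) :=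
  ⟨hW.maps _ _ hU.isHom, by rw [homDiff_comp_of_closed hW.closed, hU.closed, comp_zero]⟩

theorem PostHom.isExact (hW : PostHom κ P M N u u₀ v v₀ W) (hU : IsExact κ P M u u₀ U) :
    IsExact κ P N v v₀ (W ⊚ U) := by
  obtain ⟨V, hV, rfl⟩ := hU
  exact ⟨W ⊚ V, hW.maps _ _ hV, homDiff_comp_of_closed hW.closed⟩

theorem PostHom.comp (hW' : PostHom κ P N L v v₀ w w₀ W') (hW : PostHom κ P M N u u₀ v v₀ W) :
    PostHom κ P M L u u₀ w w₀ (W' ⊚ W) :=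
  ⟨fun k U hU => by rw [comp_assoc]; exact hW'.maps _ _ (hW.maps _ _ hU), by
    rw [homDiff_comp_of_closed hW'.closed, hW.closed, comp_zero]⟩

theorem PostBij.comp (hW' : PostBij κ P N L v v₀ w w₀ W') (hW : PostBij κ P M N u u₀ v v₀ W) :
    PostBij κ P M L u u₀ w w₀ (W' ⊚ W) := by
  refine ⟨hW'.toPostHom.comp hW.toPostHom, fun U hU h => ?_, fun U hU => ?_⟩
  · rw [comp_assoc] at h
    exact hW.inj U hU (hW'.inj _ (hW.isClosed hU) h)
  · obtain ⟨U', hU', h'⟩ := hW'.surj U hU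
    obtain ⟨U'', hU'', h''⟩ := hW.surj U' hU'
    refine ⟨U'', hU'', ?_⟩
    have := (hW'.isExact h'').add h'
    rwa [comp_sub, sub_add_sub_cancel, ← comp_assoc] at this

theorem PostBij.of_comp (hW' : PostBij κ P N L v v₀ w w₀ W') (hW : PostHom κ P M N u u₀ v v₀ W)
    (h : PostBij κ P M L u u₀ w w₀ (W' ⊚ W)) : PostBij κ P M N u u₀ v v₀ W := by
  refine ⟨hW, fun U hU hUe => h.inj U hU ?_, fun U hU => ?_⟩
  · rw [comp_assoc]
    exact hW'.isExact hUe
  · obtain ⟨U', hU', h'⟩ := h.surj _ (hW'.isClosed hU)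
    refine ⟨U', hU', hW'.inj _ ((hW.isClosed hU').sub hU) ?_⟩
    rwa [comp_sub, ← comp_assoc]

theorem postBij_one : PostBij κ P M M u u₀ u u₀ (one R _) := by
  refine ⟨⟨fun k U hU => by rwa [one_comp], ?_⟩, fun U _ h => by rwa [one_comp] at h, fun U hU =>
    ⟨U, hU, ?_⟩⟩
  · rw [homDiff, one_comp, comp_one, sgn_zero, one_smul, sub_self]
  · rw [one_comp, sub_self]
    exact isExact_zero

theorem BimodHom.isClosed_op {f₁ : AInfHom C₁ B₁} {f₀ : AInfHom C₀ B₀}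
    (φ : BimodHom κ M N f₁ f₀) : IsClosed κ M N f₁.op f₀.op φ.op := ⟨φ.isHom_op, φ.homDiff_op⟩

/-- The evaluations of a model of `[0, 1] × M` induce bijections on homotopy classes. -/
theorem AInfBimod.Model.postBij_ev {𝔠₁ : C₁.Model} {𝔠₀ : C₀.Model} (𝔪 : M.Model 𝔠₁ 𝔠₀) (s : Fin 2)
    {u : Op R (List A₁.ι) (List 𝔠₁.alg.ι)} {v : Op R (List A₀.ι) (List 𝔠₀.alg.ι)}
    (hu : IsDGMap A₁ 𝔠₁.alg u) (hv : IsDGMap A₀ 𝔠₀.alg v) :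
    PostBij κ P 𝔪.mod M u v ((𝔠₁.ev s).op ⊚ u) ((𝔠₀.ev s).op ⊚ v) (𝔪.ev s).op := by
  obtain ⟨η, ε, hε, hη, hη0, heη, hηi⟩ := 𝔪.exists_contraction s
  have hker : ∀ k U, IsHom κ (k + 1) P 𝔪.mod u v U → homDiff P 𝔪.mod (k + 1) U = 0 →
      (𝔪.ev s).op ⊚ U = 0 → ∃ V, IsHom κ k P 𝔪.mod u v V ∧ (𝔪.ev s).op ⊚ V = 0 ∧
        homDiff P 𝔪.mod k V = U := fun k U hU hUc hUe =>
    exists_homDiff_eq hu hv (𝔪.ev_linear s) hε hη hη0 heη hηi hU hUc hUe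
  -- Components of pre-homomorphisms to `M` are lifted by the inclusion, so that the evaluation is a
  -- surjection of complexes; its kernel is acyclic.
  have hlift : ∀ k U, IsHom κ k P M ((𝔠₁.ev s).op ⊚ u) ((𝔠₀.ev s).op ⊚ v) U →
      ∃ V, IsHom κ k P 𝔪.mod u v V ∧ (𝔪.ev s).op ⊚ V = U := by
    intro k U hU
    have h1 : IsHom κ k P 𝔪.mod u v (hat A₁.sdeg k u v (𝔪.incl.φ₀ ⊚ cogen R _ _ _ ⊚ U)) := by
      refine isHom_hat hu.toIsCoalgMap hv.toIsCoalgMap ?_ ?_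
      · have := 𝔪.incl.homog_φ₀.comp ((homog_cogen C₁.sdeg M.sdeg C₀.sdeg).comp hU.homog)
        rwa [add_zero, add_zero] at this
      · obtain ⟨c, hc, h⟩ := hU.loss
        exact ⟨c, hc, (𝔪.incl.raises_φ₀.comp (raises_cogen.comp h)).mono (by linarith)⟩
    refine ⟨_, h1, IsComod.ext (d := A₁.sdeg) (k := k) ?_ hU.comod ?_⟩
    · have := (𝔪.ev s).isHom_op.comod.comp h1.comod hu.toIsCoalgMap
      rwa [add_zero] at this
    · rw [← comp_assoc, BimodHom.cogen_comp_op, BimodHom.φOp_eq (𝔪.ev_linear s), comp_assoc,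
        cogen_comp_hat hu.toIsCoalgMap hv.toIsCoalgMap, ← comp_assoc, 𝔪.ev_comp_incl, one_comp]
  have hpost : PostHom κ P 𝔪.mod M u v ((𝔠₁.ev s).op ⊚ u) ((𝔠₀.ev s).op ⊚ v) (𝔪.ev s).op :=
    IsClosed.postHom ⟨(𝔪.ev s).isHom_op.of_filtered, (𝔪.ev s).homDiff_op⟩ hu.toIsCoalgMap rfl rfl
  refine ⟨hpost, fun U hU hUe => ?_, fun U hU => ?_⟩
  · obtain ⟨V, hV, hVU⟩ := hUe
    obtain ⟨V₀, hV₀, rfl⟩ := hlift _ V hV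
    obtain ⟨V₁, hV₁, -, h⟩ := hker (-1) (U - homDiff P 𝔪.mod (-1) V₀)
      (hU.isHom.sub (hV₀.homDiff hu hv))
      (by
        rw [homDiff_sub, homDiff_homDiff, sub_zero]
        exact hU.closed)
      (by rw [comp_sub, ← homDiff_comp_of_closed hpost.closed, hVU, sub_self])
    exact ⟨V₀ + V₁, hV₀.add hV₁, by rw [homDiff_add, h, add_sub_cancel]⟩
  · obtain ⟨V₀, hV₀, rfl⟩ := hlift _ U hU.isHom
    obtain ⟨V₁, hV₁, hV₁e, h⟩ := hker 0 (homDiff P 𝔪.mod 0 V₀) (hV₀.homDiff hu hv)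
      (homDiff_homDiff _) (by rw [← homDiff_comp_of_closed hpost.closed, hU.closed])
    refine ⟨V₀ - V₁, ⟨hV₀.sub hV₁, by rw [homDiff_sub, h, sub_self]⟩, ?_⟩
    rw [comp_sub, hV₁e, sub_zero, sub_self]
    exact isExact_zero

theorem AInfHom.op_comp_eq {C D E : AInfAlgebra.{u} R} {f : AInfHom D E} {g : AInfHom C D}
    {w : Op R (List C.ι) (List E.ι)} (h : f.hat ∘ₗ g.hat = w.lin) : f.op ⊚ g.op = w :=
  lin_injective (by rw [lin_comp, lin_op, lin_op, h])

/-- A homomorphism homotopic to the identity induces bijections on homotopy classes, although the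
underlying coalgebra maps change. -/
theorem BimodHomotopic.postBij {f₁ : Op R (List C₁.ι) (List C₁.ι)}
    {f₀ : Op R (List C₀.ι) (List C₀.ι)}
    {W : Op R (List C₁.ι × M.ι × List C₀.ι) (List C₁.ι × M.ι × List C₀.ι)}
    (h : BimodHomotopic κ f₁.lin LinearMap.id f₀.lin LinearMap.id W.lin
      (LinearMap.id : M.Bar →ₗ[_] _))
    (hu : IsDGMap A₁ C₁ u) (hu₀ : IsDGMap A₀ C₀ u₀) :
    PostBij κ P M M u u₀ (f₁ ⊚ u) (f₀ ⊚ u₀) W := by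
  obtain ⟨𝔠₁, 𝔠₀, 𝔪, F₁, F₀, Φ, ⟨-, hF₁, hF₁'⟩, ⟨-, hF₀, hF₀'⟩, hΦ, hΦ'⟩ := h
  rw [← lin_one (R := R)] at hF₁' hF₀' hΦ'
  have e1 := AInfHom.op_comp_eq hF₁
  have e2 := AInfHom.op_comp_eq hF₀
  have e3 := AInfHom.op_comp_eq hF₁'
  have e4 := AInfHom.op_comp_eq hF₀'
  have e5 : (𝔪.ev 0).op ⊚ Φ.op = W :=
    lin_injective (by rw [lin_comp, BimodHom.lin_op, BimodHom.lin_op, hΦ])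
  have e6 : (𝔪.ev 1).op ⊚ Φ.op = one R _ :=
    lin_injective (by rw [lin_comp, BimodHom.lin_op, BimodHom.lin_op, hΦ'])
  have h0 := 𝔪.postBij_ev (κ := κ) (P := P) 0 (F₁.isDGMap_op.comp hu) (F₀.isDGMap_op.comp hu₀)
  have h1 := 𝔪.postBij_ev (κ := κ) (P := P) 1 (F₁.isDGMap_op.comp hu) (F₀.isDGMap_op.comp hu₀)
  rw [← comp_assoc, ← comp_assoc, e1, e2] at h0
  rw [← comp_assoc, ← comp_assoc, e3, e4, one_comp, one_comp] at h1
  -- `Φ` is right inverse to the bijection induced by the evaluation at `1`.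
  have h2 : PostBij κ P M 𝔪.mod u u₀ (F₁.op ⊚ u) (F₀.op ⊚ u₀) Φ.op := by
    refine h1.of_comp (Φ.isClosed_op.postHom hu.toIsCoalgMap rfl rfl) ?_
    rw [e6]
    exact postBij_one
  have h3 := h0.comp h2
  rwa [e5] at h3

end HomotopyClasses

/-- A homotopy equivalence over the identity has a homotopy inverse over the identity, with
homotopies that are pre-homomorphisms over the identity. -/
theorem BimodHom.IsHomotopyEquiv.exists_inverse {A : AInfAlgebra.{u} R} {κ : HomKind}
    {M N : AInfBimod A A} {φ : BimodHom κ M N (AInfHom.id A) (AInfHom.id A)}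
    (hφ : φ.IsHomotopyEquiv) :
    ∃ U, IsClosed κ N M (one R _) (one R _) U ∧
      IsExact κ N N (one R _) (one R _) (φ.op ⊚ U - one R _) ∧
      IsExact κ M M (one R _) (one R _) (U ⊚ φ.op - one R _) := by
  obtain ⟨g₁, g₀, ψ, -, -, h1, h2⟩ := hφ
  rw [AInfHom.hat_id, LinearMap.id_comp, LinearMap.id_comp, ← AInfHom.lin_op, ← AInfHom.lin_op,
    ← φ.lin_op, ← ψ.lin_op, ← lin_comp] at h1
  rw [AInfHom.hat_id, LinearMap.comp_id, LinearMap.comp_id, ← AInfHom.lin_op, ← AInfHom.lin_op,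
    ← φ.lin_op, ← ψ.lin_op, ← lin_comp] at h2
  have hφc := φ.isClosed_op
  rw [AInfHom.op_id] at hφc
  have hd1 := isDGMap_one A
  -- As both composites induce bijections, so does `ψ`, and then `φ`.
  have key : ∀ P : AInfBimod A A,
      PostBij κ P M N (one R _) (one R _) (one R _) (one R _) φ.op := by
    intro P
    have b1 := h1.postBij (P := P) hd1 hd1
    have b2 := h2.postBij (P := P) hd1 hd1
    rw [comp_one, comp_one] at b1 b2
    have p1 : PostHom κ P M N (one R _) (one R _) (one R _) (one R _) φ.op :=
      hφc.postHom hd1.toIsCoalgMap (one_comp _) (one_comp _)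
    have p2 : PostHom κ P M N g₁.op g₀.op g₁.op g₀.op φ.op :=
      hφc.postHom g₁.isCoalgMap_op (one_comp _) (one_comp _)
    have p3 : PostHom κ P N M (one R _) (one R _) g₁.op g₀.op ψ.op :=
      ψ.isClosed_op.postHom hd1.toIsCoalgMap (comp_one _) (comp_one _)
    refine PostBij.of_comp ⟨p3, fun U hU h => b1.inj U hU ?_, fun U hU => ?_⟩ p1 b2
    · rw [comp_assoc]
      exact p2.isExact h
    · obtain ⟨U', hU', h'⟩ := b2.surj U hU
      exact ⟨φ.op ⊚ U', p1.isClosed hU', by rwa [← comp_assoc]⟩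
  have hone : ∀ P : AInfBimod A A, IsClosed κ P P (one R _) (one R _) (one R _) := fun P =>
    ⟨isHom_one κ P, by rw [homDiff, one_comp, comp_one, sgn_zero, one_smul, sub_self]⟩
  obtain ⟨U, hU, hUe⟩ := (key N).surj _ (hone N)
  refine ⟨U, hU, hUe, (key M).inj _ (IsClosed.sub ?_ (hone M)) ?_⟩
  · exact (hU.postHom hd1.toIsCoalgMap (one_comp _) (one_comp _)).isClosed hφc
  · obtain ⟨V, hV, hVe⟩ := hUe
    refine ⟨V ⊚ φ.op, ?_, ?_⟩
    · have := hV.comp hφc.isHom hd1.toIsCoalgMap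
      rwa [zero_add, one_comp] at this
    · rw [homDiff_comp_closed hφc.closed, hVe, sub_comp, one_comp, comp_sub, comp_one, comp_assoc]

end GappedAInf

end

noncomputable section

namespace GappedAInf

open Nov Op

variable {R : Type v} [Field R]

/-! ### Hochschild chains as invariants of the bimodule bar complex -/

theorem lin_eq_sgn_map {X Y : Type u} {d : X → ℤ} {n a b : ℤ} {φ : Op R X Y} {g : X → Y}
    (h : ∀ x, φ x = sgn (a * d x + b) • basis (g x)) {z : Nov R X} (hz : IsHomog d n z) :
    φ.lin z = sgn (a * n + b) • map g z := by
  let s : Op R X X := ⟨fun x => sgn (a * d x + b) • basis x, 0, fun x => (memF_basis x).zsmul _⟩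
  have e : φ = of g ⊚ s := ext' fun x => by
    rw [comp_apply, h]
    change _ = (of g).lin (sgn (a * d x + b) • basis x)
    rw [map_zsmul, lin_basis, of_apply]
  rw [e, lin_comp_apply, lin_of, ← map_zsmul]
  exact congrArg (map g) (lift_sgn_apply hz a b)

section Cyclic

variable {X J K L : Type u} {d : X → ℤ} {dJ : J → ℤ} {dK : K → ℤ} {dL : L → ℤ}

/-- Moving the last of two words past the module element and the first word. -/
def rotate (R : Type v) [Field R] (d : X → ℤ) (dJ : J → ℤ) :
    Op R (J × List X × List X) (List X × J × List X) :=
  ⟨fun p => sgn (wdeg d p.2.2 * (dJ p.1 + wdeg d p.2.1)) • basis (p.2.2, p.1, p.2.1), 0,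
    fun _ => (memF_basis _).zsmul _⟩

theorem rotate_apply (y : J) (a b : List X) : rotate R d dJ (y, a, b) =
    sgn (wdeg d b * (dJ y + wdeg d a)) • basis (b, y, a) := rfl

/-- The inclusion of the Hochschild chains in the bimodule bar complex: the sum over all ways of
moving a last part of the word to the other side of the module element. -/
def cycInc (R : Type v) [Field R] (d : X → ℤ) (dJ : J → ℤ) :
    Op R (J × List X) (List X × J × List X) :=
  rotate R d dJ ⊚ (one R J ⊠ deconc R X)

theorem cycInc_apply (y : J) (w : List X) : cycInc R d dJ (y, w) =
    cutSum (fun a b => sgn (wdeg d b * (dJ y + wdeg d a)) • basis (b, y, a)) w := by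
  rw [cycInc, comp_apply, tensor_apply, one_apply, deconc_apply, prod_cutSum_right, map_cutSum]
  exact cutSum_congr fun a b _ => by rw [prod_basis, lin_basis, rotate_apply]

/-- The projection to the words that are empty on the left. -/
def emptyLeft (R : Type v) [Field R] (X J : Type u) : Op R (List X × J × List X) (J × List X) :=
  of (fun p : PUnit.{u + 1} × J × List X => p.2) ⊚ (counit R X ⊠ one R (J × List X))

theorem emptyLeft_nil (y : J) (w : List X) : emptyLeft R X J ([], y, w) = basis (y, w) := by
  rw [emptyLeft, comp_apply, tensor_apply, counit_nil, one_apply, prod_basis, lin_basis]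
  rfl

theorem emptyLeft_cons (x : X) (a : List X) (y : J) (w : List X) :
    emptyLeft R X J (x :: a, y, w) = 0 := by
  rw [emptyLeft, comp_apply, tensor_apply, counit_cons, prod_zero_left, map_zero]

theorem raises_emptyLeft : Raises 0 (emptyLeft R X J) := fun ⟨x, y, w⟩ => by
  cases x with
  | nil => rw [emptyLeft_nil]; exact memF_basis _
  | cons x a => rw [emptyLeft_cons]; exact memF_zero

theorem homog_emptyLeft (d : X → ℤ) (dJ : J → ℤ) :
    Homog (barDeg d dJ d) (fun p : J × List X => dJ p.1 + wdeg d p.2) 0 (emptyLeft R X J) :=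
  fun ⟨x, y, w⟩ => by
    cases x with
    | nil =>
      rw [emptyLeft_nil]
      have := isHomog_basis (R := R) (fun p : J × List X => dJ p.1 + wdeg d p.2) (y, w)
      simpa [barDeg] using this
    | cons x a => rw [emptyLeft_cons]; exact isHomog_zero

theorem raises_cycInc : Raises 0 (cycInc R d dJ) := fun ⟨y, w⟩ => by
  rw [cycInc_apply]
  exact memF_cutSum fun a b _ => (memF_basis _).zsmul _

theorem homog_cycInc : Homog (fun p : J × List X => dJ p.1 + wdeg d p.2) (barDeg d dJ d) 0
    (cycInc R d dJ) := fun ⟨y, w⟩ => by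
  rw [cycInc_apply]
  refine isHomog_cutSum fun a b h => IsHomog.zsmul ?_ _
  have := isHomog_basis (R := R) (barDeg d dJ d) (b, y, a)
  convert this using 1
  simp only [barDeg, ← h, wdeg_append]
  ring

theorem emptyLeft_comp_cycInc : emptyLeft R X J ⊚ cycInc R d dJ = one R _ := by
  ext1 ⟨y, w⟩
  rw [comp_apply, cycInc_apply, map_cutSum, cutSum_eq_last]
  · rw [map_zsmul, lin_basis, emptyLeft_nil, wdeg_nil, zero_mul, sgn_zero, one_smul, one_apply]
  · intro a x b
    rw [map_zsmul, lin_basis, emptyLeft_cons, smul_zero]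

theorem lin_cycInc_map {n : ℤ} {z : Nov R J} (hz : IsHomog dJ n z) (e : List X) :
    (cycInc R d dJ).lin (map (fun y => (y, e)) z) =
      cutSum (fun a b => sgn (wdeg d b * (n + wdeg d a)) • map (fun y => (b, y, a)) z) e := by
  have h : cycInc R d dJ ⊚ of (fun y => (y, e)) = cutSum (fun a b =>
      (rotate R d dJ ⊚ of (fun y => (y, a, b)) : Op R J (List X × J × List X))) e := by
    ext1 y
    rw [comp_of_apply, cycInc_apply, cutSum_apply]
    exact cutSum_congr fun a b _ => by rw [comp_of_apply, rotate_apply]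
  rw [← lin_of, ← lin_comp_apply, h, lin_cutSum_apply]
  refine cutSum_congr fun a b _ => ?_
  rw [mul_add]
  refine lin_eq_sgn_map (fun y => ?_) hz
  rw [comp_of_apply, rotate_apply, mul_add]

/-- The subspace of Hochschild chains is preserved by bicomodule maps over the identity. -/
theorem hat_comp_cycInc {k : ℤ} {θ : Op R (List X × J × List X) K}
    (hθ : Homog (barDeg d dJ d) dK k θ) :
    ∃ T : Op R (J × List X) (K × List X),
      hat d k (one R _) (one R _) θ ⊚ cycInc R d dJ = cycInc R d dK ⊚ T := by
  obtain ⟨c, hc⟩ := θ.exists_memF_app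
  let T : Op R (J × List X) (K × List X) := ⟨fun p => cutSum (fun a b => cutSum (fun a₁ e =>
    sgn (wdeg d b * (dJ p.1 + wdeg d a)) • map (fun y => (y, e)) (θ (b, p.1, a₁))) a) p.2, c,
    fun p => memF_cutSum fun a b _ => memF_cutSum fun a₁ e _ => (memF_map _ (hc _)).zsmul _⟩
  refine ⟨T, ?_⟩
  ext1 ⟨y, w⟩
  rw [comp_apply, comp_apply, cycInc_apply, map_cutSum]
  change _ = (cycInc R d dK).lin (cutSum (fun a b => cutSum (fun a₁ e =>
    sgn (wdeg d b * (dJ y + wdeg d a)) • map (fun y => (y, e)) (θ (b, y, a₁))) a) w)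
  rw [map_cutSum]
  -- Both sides are sums over all ways of cutting `w` into four pieces.
  have h1 : ∀ a b, (hat d k (one R _) (one R _) θ).lin
      (sgn (wdeg d b * (dJ y + wdeg d a)) • basis (b, y, a)) =
      cutSum (fun b₁ b₂ => cutSum (fun a₁ a₂ => sgn (wdeg d b * (dJ y + wdeg d a) + k * wdeg d b₁) •
        map (fun y' => (b₁, y', a₂)) (θ (b₂, y, a₁))) a) b := by
    intro a b
    rw [map_zsmul, lin_basis, hat_apply, zsmul_cutSum]
    refine cutSum_congr fun b₁ b₂ _ => ?_
    rw [zsmul_cutSum]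
    refine cutSum_congr fun a₁ a₂ _ => ?_
    rw [smul_smul, ← sgn_add, one_apply, one_apply, prod_basis_right, prod_basis_left, map_map]
    rfl
  have h2 : ∀ a b, (cycInc R d dK).lin (cutSum (fun a₁ e =>
      sgn (wdeg d b * (dJ y + wdeg d a)) • map (fun y => (y, e)) (θ (b, y, a₁))) a) =
      cutSum (fun a₁ e => cutSum (fun a₂ b₁ => sgn (wdeg d b * (dJ y + wdeg d a) +
        wdeg d b₁ * (barDeg d dJ d (b, y, a₁) + k + wdeg d a₂)) •
          map (fun y' => (b₁, y', a₂)) (θ (b, y, a₁))) e) a := by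
    intro a b
    rw [map_cutSum]
    refine cutSum_congr fun a₁ e _ => ?_
    rw [map_zsmul, lin_cycInc_map (hθ _), zsmul_cutSum]
    exact cutSum_congr fun a₂ b₁ _ => by rw [smul_smul, ← sgn_add]
  let F : List X → List X → List X → List X → Nov R (List X × K × List X) := fun a₁ a₂ b₁ b₂ =>
    sgn ((wdeg d b₁ + wdeg d b₂) * (dJ y + (wdeg d a₁ + wdeg d a₂)) + k * wdeg d b₁) •
      map (fun y' => (b₁, y', a₂)) (θ (b₂, y, a₁))
  have h3 : cutSum (fun a b => (hat d k (one R _) (one R _) θ).lin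
      (sgn (wdeg d b * (dJ y + wdeg d a)) • basis (b, y, a))) w =
      cutSum (fun a b => cutSum (fun b₁ b₂ => cutSum (fun a₁ a₂ => F a₁ a₂ b₁ b₂) a) b) w := by
    refine cutSum_congr fun a b _ => (h1 a b).trans ?_
    refine cutSum_congr fun b₁ b₂ hb => cutSum_congr fun a₁ a₂ ha => ?_
    rw [← hb, ← ha, wdeg_append, wdeg_append]
  have h4 : cutSum (fun a b => (cycInc R d dK).lin (cutSum (fun a₁ e =>
      sgn (wdeg d b * (dJ y + wdeg d a)) • map (fun y => (y, e)) (θ (b, y, a₁))) a)) w =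
      cutSum (fun a b => cutSum (fun a₁ e => cutSum (fun a₂ b₁ => F a₁ a₂ b₁ b) e) a) w := by
    refine cutSum_congr fun a b _ => (h2 a b).trans ?_
    refine cutSum_congr fun a₁ e ha => cutSum_congr fun a₂ b₁ he => ?_
    congr 1
    refine sgn_congr ?_
    rw [← ha, ← he, wdeg_append, wdeg_append]
    refine ⟨wdeg d b * wdeg d b₁, ?_⟩
    simp only [barDeg]
    ring
  rw [h3, h4]
  rw [cutSum_assoc (fun a₁ e b => cutSum (fun a₂ b₁ => F a₁ a₂ b₁ b) e)]
  have h5 : ∀ a b, cutSum (fun b₁ b₂ => cutSum (fun a₁ a₂ => F a₁ a₂ b₁ b₂) a) b =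
      cutSum (fun a₁ a₂ => cutSum (fun b₁ b₂ => F a₁ a₂ b₁ b₂) b) a := fun a b =>
    cutSum_comm (fun b₁ b₂ a₁ a₂ => F a₁ a₂ b₁ b₂) b a
  simp only [h5]
  rw [cutSum_assoc (fun a₁ a₂ b => cutSum (fun b₁ b₂ => F a₁ a₂ b₁ b₂) b)]
  refine cutSum_congr fun a₁ r _ => ?_
  exact (cutSum_assoc (fun a₂ b₁ b₂ => F a₁ a₂ b₁ b₂) r).symm

variable {D : Op R (List X) (List X)}

/-- The bar differentials on both sides of the module element restrict to the one of the Hochschild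
complex. -/
theorem tensor_comp_cycInc (hD : Homog (wdeg d) (wdeg d) 1 D)
    (hd : deconc R X ⊚ D = (D ⊠ one R _ + sign (wdeg d) 1 ⊠ D) ⊚ deconc R X) :
    (D ⊠ one R (J × List X) + sign (wdeg d) 1 ⊠ (sign dJ 1 ⊠ D)) ⊚ cycInc R d dJ =
      cycInc R d dJ ⊚ (sign dJ 1 ⊠ D) := by
  have h1 : rotate R d dJ ⊚ (sign dJ 1 ⊠ (D ⊠ one R _)) =
      (sign (wdeg d) 1 ⊠ (sign dJ 1 ⊠ D)) ⊚ rotate R d dJ := by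
    ext1 ⟨y, a, b⟩
    rw [comp_apply, comp_apply, rotate_apply, map_zsmul, lin_basis, tensor_apply, tensor_apply,
      tensor_apply, tensor_apply, Op.sign_apply, Op.sign_apply, one_apply, prod_zsmul_left,
      prod_zsmul_left, prod_zsmul_left, prod_zsmul_right, prod_basis_right, prod_basis_left,
      prod_basis_left, prod_basis_left, map_map, map_map, map_zsmul, ← lin_of, ← lin_comp_apply,
      lin_eq_sgn_map (d := wdeg d) (a := wdeg d b) (b := wdeg d b * dJ y)
        (g := fun a' => (b, y, a')) (fun a' => ?_) (hD a), smul_smul, smul_smul, smul_smul,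
      ← sgn_add, ← sgn_add, ← sgn_add]
    · congr 1
      congr 1
      ring
    · rw [comp_of_apply]
      refine (rotate_apply _ _ _).trans ?_
      congr 2
      ring
  have h2 : rotate R d dJ ⊚ (sign dJ 1 ⊠ (sign (wdeg d) 1 ⊠ D)) =
      (D ⊠ one R (J × List X)) ⊚ rotate R d dJ := by
    ext1 ⟨y, a, b⟩
    rw [comp_apply, comp_apply, rotate_apply, map_zsmul, lin_basis, tensor_apply, tensor_apply,
      tensor_apply, Op.sign_apply, Op.sign_apply, one_apply, prod_zsmul_left,
      prod_zsmul_left, prod_zsmul_right, prod_basis_right, prod_basis_left,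
      prod_basis_left, map_map, map_zsmul, map_zsmul, ← lin_of, ← lin_comp_apply,
      lin_eq_sgn_map (d := wdeg d) (a := dJ y + wdeg d a) (b := 0)
        (g := fun b' => (b', y, a)) (fun b' => ?_) (hD b), smul_smul, smul_smul,
      ← sgn_add, ← sgn_add]
    · congr 1
      refine sgn_congr ⟨dJ y + wdeg d a, ?_⟩
      ring
    · rw [comp_of_apply]
      refine (rotate_apply _ _ _).trans ?_
      congr 2
      ring
  rw [cycInc, ← comp_assoc, add_comp, ← h1, ← h2, comp_assoc, tensor_comp, one_comp, hd,
    ← comp_add, ← tensor_add, add_comm (sign (wdeg d) 1 ⊠ D), comp_assoc]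
  congr 1
  rw [tensor_comp, comp_one]

/-- The operator on Hochschild chains induced by an operator on the bimodule bar complex. -/
def onHoch (d : X → ℤ) (dJ : J → ℤ) (U : Op R (List X × J × List X) (List X × K × List X)) :
    Op R (J × List X) (K × List X) :=
  emptyLeft R X K ⊚ U ⊚ cycInc R d dJ

/-- The operator preserves the Hochschild chains. -/
def PreservesHoch (d : X → ℤ) (dJ : J → ℤ) (dK : K → ℤ)
    (U : Op R (List X × J × List X) (List X × K × List X)) : Prop :=
  U ⊚ cycInc R d dJ = cycInc R d dK ⊚ onHoch d dJ U

theorem preservesHoch_of_exists {U : Op R (List X × J × List X) (List X × K × List X)}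
    (h : ∃ T, U ⊚ cycInc R d dJ = cycInc R d dK ⊚ T) : PreservesHoch d dJ dK U := by
  obtain ⟨T, hT⟩ := h
  rw [PreservesHoch, onHoch, hT, ← comp_assoc (emptyLeft R X K), emptyLeft_comp_cycInc, one_comp]

theorem onHoch_comp (V : Op R (List X × K × List X) (List X × L × List X))
    {U : Op R (List X × J × List X) (List X × K × List X)} (hU : PreservesHoch d dJ dK U) :
    onHoch d dJ (V ⊚ U) = onHoch d dK V ⊚ onHoch d dJ U := by
  rw [onHoch, comp_assoc V, hU]
  simp only [onHoch, comp_assoc]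

theorem onHoch_one : onHoch d dJ (one R _) = one R _ := by
  rw [onHoch, one_comp, emptyLeft_comp_cycInc]

theorem onHoch_sub (U V : Op R (List X × J × List X) (List X × K × List X)) :
    onHoch d dJ (U - V) = onHoch d dJ U - onHoch d dJ V := by
  rw [onHoch, sub_comp, comp_sub, onHoch, onHoch]

theorem onHoch_zsmul (n : ℤ) (U : Op R (List X × J × List X) (List X × K × List X)) :
    onHoch d dJ (n • U) = n • onHoch d dJ U := by
  rw [onHoch, zsmul_comp, comp_zsmul, onHoch]

/-- The part of a bicomodule map over the identity with empty word on the left. -/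
theorem emptyLeft_comp_hat (k : ℤ) (θ : Op R (List X × J × List X) K) (x : List X) (y : J)
    (z : List X) : (emptyLeft R X K ⊚ hat d k (one R _) (one R _) θ) (x, y, z) =
      cutSum (fun c e => map (fun y' => (y', e)) (θ (x, y, c))) z := by
  rw [comp_apply, hat_apply, map_cutSum, cutSum_eq_first]
  · rw [map_cutSum]
    refine cutSum_congr fun c e _ => ?_
    have h : emptyLeft R X K ⊚ of ((fun p => ([], p)) ∘ fun y' => (y', e)) =
        of fun y' => (y', e) :=
      ext' fun y' => (comp_of_apply _ _ _).trans (emptyLeft_nil _ _)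
    rw [wdeg_nil, mul_zero, sgn_zero, one_smul, one_apply, one_apply, prod_basis_right,
      prod_basis_left, map_map, ← lin_of, ← lin_comp_apply, h, lin_of]
  · intro x' a b
    rw [map_cutSum]
    refine Finset.sum_eq_zero fun i _ => ?_
    beta_reduce
    have h : emptyLeft R X K ⊚ of (fun p : K × List X => (x' :: a, p)) = 0 :=
      ext' fun p => (comp_of_apply _ _ _).trans (emptyLeft_cons _ _ _ _)
    rw [map_zsmul, one_apply, prod_basis_left, ← lin_of, ← lin_comp_apply, h, lin_zero_apply,
      smul_zero]

end Cyclic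

end GappedAInf

end

noncomputable section

namespace GappedAInf

open Nov Op

variable {R : Type v} [Field R]

/-! ### Permutations of the letters of a word -/

section Perm

variable {X Y J : Type u} {d : X → ℤ}

/-- The signed action of a permutation of `k` letters on the words of length `k`; words of other
lengths are fixed. -/
def permOp (R : Type v) [Field R] (d : X → ℤ) (k : ℕ) (σ : Equiv.Perm (Fin k)) :
    Op R (List X) (List X) :=
  ⟨fun w => if h : k = w.length then
      koszul (fun i => d (w.get (i.cast h))) σ • basis (List.ofFn fun i => w.get ((σ i).cast h))
    else basis w, 0, fun w => by
      beta_reduce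
      split_ifs
      · exact (memF_basis _).zsmul _
      · exact memF_basis _⟩

theorem permOp_ofFn {k : ℕ} (σ : Equiv.Perm (Fin k)) (x : Fin k → X) :
    permOp R d k σ (List.ofFn x) = koszul (d ∘ x) σ • basis (List.ofFn (x ∘ σ)) := by
  have h : k = (List.ofFn x).length := (List.length_ofFn).symm
  refine (dif_pos h).trans ?_
  have h1 : ∀ i : Fin k, (List.ofFn x).get (i.cast h) = x i := fun i => by simp
  simp only [h1]
  rfl

theorem permOp_of_length_ne {k : ℕ} (σ : Equiv.Perm (Fin k)) {w : List X} (h : w.length ≠ k) :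
    permOp R d k σ w = basis w := dif_neg fun h' => h h'.symm

theorem exists_ofFn_of_length {k : ℕ} {w : List X} (h : w.length = k) :
    ∃ x : Fin k → X, List.ofFn x = w := by
  subst h
  exact ⟨w.get, List.ofFn_get w⟩

theorem proj_comp_permOp (k l : ℕ) (σ : Equiv.Perm (Fin k)) :
    proj R (ofLength X l) ⊚ permOp R d k σ = permOp R d k σ ⊚ proj R (ofLength X l) := by
  ext1 w
  rw [comp_apply, comp_apply]
  by_cases h : w.length = k
  · obtain ⟨x, rfl⟩ := exists_ofFn_of_length h
    rw [permOp_ofFn, map_zsmul, lin_basis]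
    by_cases hl : k = l
    · rw [proj_of_mem (show List.ofFn (x ∘ σ) ∈ ofLength X l from by simp [hl]),
        proj_of_mem (show List.ofFn x ∈ ofLength X l from by simp [hl]), lin_basis, permOp_ofFn]
    · rw [proj_of_notMem (show List.ofFn (x ∘ σ) ∉ ofLength X l from by simp [hl]),
        proj_of_notMem (show List.ofFn x ∉ ofLength X l from by simp [hl]), map_zero, smul_zero]
  · rw [permOp_of_length_ne σ h, lin_basis]
    by_cases hl : w ∈ ofLength X l
    · rw [proj_of_mem hl, lin_basis, permOp_of_length_ne σ h]
    · rw [proj_of_notMem hl, map_zero]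

theorem permOp_comp_proj {k l : ℕ} (σ : Equiv.Perm (Fin k)) (h : l ≠ k) :
    permOp R d k σ ⊚ proj R (ofLength X l) = proj R (ofLength X l) := by
  ext1 w
  rw [comp_apply]
  by_cases hl : w ∈ ofLength X l
  · rw [proj_of_mem hl, lin_basis, permOp_of_length_ne]
    rw [show w.length = l from hl]
    exact h
  · rw [proj_of_notMem hl, map_zero]

theorem deconcPart_append {i j : ℕ} {a b : List X} (ha : a.length = i) (hb : b.length = j) :
    deconcPart R X i j (a ++ b) = basis (a, b) := by
  rw [deconcPart_apply, cutSum, Finset.sum_eq_single i]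
  · rw [← ha, List.take_left, List.drop_left, proj_of_mem (show a ∈ ofLength X a.length from rfl),
      proj_of_mem (show b ∈ ofLength X j from hb), prod_basis]
  · intro k hk hki
    rw [Finset.mem_range] at hk
    rw [proj_of_notMem, prod_zero_left]
    change ((a ++ b).take k).length ≠ i
    rw [List.length_take]
    omega
  · intro h
    refine absurd (Finset.mem_range.2 ?_) h
    rw [List.length_append]
    omega

theorem deconcPart_of_length_ne {i j : ℕ} {w : List X} (h : w.length ≠ i + j) :
    deconcPart R X i j w = 0 := by
  rw [deconcPart_eq_comp_proj, comp_apply,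
    proj_of_notMem (show w ∉ ofLength X (i + j) from h), map_zero]

theorem wdeg_ofFn {k : ℕ} (x : Fin k → X) : wdeg d (List.ofFn x) = ∑ i, d (x i) := by
  rw [wdeg, List.map_ofFn, List.sum_ofFn]
  rfl

/-- The permutation of the last `m` of `j + m` letters. -/
def lastPerm (j : ℕ) {m : ℕ} (σ : Equiv.Perm (Fin m)) : Equiv.Perm (Fin (j + m)) :=
  finSumFinEquiv.permCongr (Equiv.Perm.sumCongr 1 σ)

theorem lastPerm_castAdd (j : ℕ) {m : ℕ} (σ : Equiv.Perm (Fin m)) (i : Fin j) :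
    lastPerm j σ (Fin.castAdd m i) = Fin.castAdd m i := by
  simp [lastPerm, Equiv.permCongr_apply]

theorem lastPerm_natAdd (j : ℕ) {m : ℕ} (σ : Equiv.Perm (Fin m)) (i : Fin m) :
    lastPerm j σ (Fin.natAdd j i) = Fin.natAdd j (σ i) := by
  simp [lastPerm, Equiv.permCongr_apply]

theorem append_comp_lastPerm {j m : ℕ} (σ : Equiv.Perm (Fin m)) (x : Fin j → X) (y : Fin m → X) :
    Fin.append x y ∘ lastPerm j σ = Fin.append x (y ∘ σ) := by
  funext i
  refine Fin.addCases (fun i => ?_) (fun i => ?_) i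
  · rw [Function.comp_apply, lastPerm_castAdd, Fin.append_left, Fin.append_left]
  · rw [Function.comp_apply, lastPerm_natAdd, Fin.append_right, Fin.append_right,
      Function.comp_apply]

theorem koszul_lastPerm {j m : ℕ} (σ : Equiv.Perm (Fin m)) (x : Fin j → X) (y : Fin m → X) :
    koszul (d ∘ Fin.append x y) (lastPerm j σ) = koszul (d ∘ y) σ := by
  rw [koszul, koszul]
  congr 1
  have h1 : ∀ (a : Fin m) (b : Fin j), ¬ Fin.natAdd j a < Fin.castAdd m b := fun a b h => by
    rw [Fin.lt_def, Fin.val_natAdd, Fin.val_castAdd] at h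
    omega
  rw [Fin.sum_univ_add]
  simp only [Fin.sum_univ_add, lastPerm_castAdd, lastPerm_natAdd, h1, false_and, and_false,
    if_false, Finset.sum_const_zero, add_zero, zero_add, Fin.natAdd_lt_natAdd_iff,
    Function.comp_apply, Fin.append_right]
  rw [Finset.sum_eq_zero, zero_add]
  refine fun a _ => Finset.sum_eq_zero fun b _ => if_neg ?_
  rintro ⟨h, h'⟩
  exact absurd h h'.asymm

/-- The permutation that exchanges the first `q` with the last `p` letters. -/
def blockSwap (q p : ℕ) : Equiv.Perm (Fin (q + p)) :=
  (finCongr (add_comm q p)).trans finAddFlip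

theorem append_comp_blockSwap {q p : ℕ} (x : Fin q → X) (y : Fin p → X) :
    Fin.append x y ∘ blockSwap q p = Fin.append y x ∘ Fin.cast (add_comm q p) := by
  have h : ∀ i : Fin (p + q), Fin.append x y (finAddFlip i) = Fin.append y x i := by
    intro i
    refine Fin.addCases (fun i => ?_) (fun i => ?_) i
    · rw [finAddFlip_apply_castAdd, Fin.append_right, Fin.append_left]
    · rw [finAddFlip_apply_natAdd, Fin.append_left, Fin.append_right]
  funext i
  exact h _

theorem koszul_blockSwap {q p : ℕ} (x : Fin q → X) (y : Fin p → X) :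
    koszul (d ∘ Fin.append x y) (blockSwap q p) =
      sgn (wdeg d (List.ofFn x) * wdeg d (List.ofFn y)) := by
  rw [koszul]
  congr 1
  let F : Fin (p + q) → Fin (p + q) → ℤ := fun i j =>
    if i < j ∧ finAddFlip j < (finAddFlip i : Fin (q + p)) then
      d (Fin.append x y (finAddFlip i)) * d (Fin.append x y (finAddFlip j)) else 0
  have h1 : ∀ i j : Fin (q + p), (if i < j ∧ blockSwap q p j < blockSwap q p i then
      (d ∘ Fin.append x y) (blockSwap q p i) * (d ∘ Fin.append x y) (blockSwap q p j) else 0) =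
      F (finCongr (add_comm q p) i) (finCongr (add_comm q p) j) := fun i j => rfl
  simp only [h1]
  rw [Equiv.sum_comp (finCongr (add_comm q p)) fun i => ∑ j, F i (finCongr (add_comm q p) j)]
  have h2 : ∀ i, ∑ j, F i (finCongr (add_comm q p) j) = ∑ j, F i j := fun i =>
    Equiv.sum_comp (finCongr (add_comm q p)) (F i)
  simp only [h2, F]
  have h3 : ∀ (a : Fin q) (b : Fin p), ¬ Fin.natAdd p a < Fin.castAdd q b := fun a b h => by
    rw [Fin.lt_def, Fin.val_natAdd, Fin.val_castAdd] at h
    omega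
  have h4 : ∀ (a : Fin q) (b : Fin p), Fin.castAdd q b < Fin.natAdd p a := fun a b => by
    rw [Fin.lt_def, Fin.val_natAdd, Fin.val_castAdd]
    omega
  have h5 : ∀ (a : Fin p) (b : Fin q), Fin.castAdd p b < Fin.natAdd q a := fun a b => by
    rw [Fin.lt_def, Fin.val_natAdd, Fin.val_castAdd]
    omega
  have h6 : ∀ a b : Fin p, ¬ (Fin.castAdd q a < Fin.castAdd q b ∧
      Fin.natAdd q b < Fin.natAdd q a) := fun a b ⟨h, h'⟩ => by
    simp only [Fin.lt_def, Fin.val_natAdd, Fin.val_castAdd] at h h'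
    omega
  have h7 : ∀ a b : Fin q, ¬ (Fin.natAdd p a < Fin.natAdd p b ∧
      Fin.castAdd p b < Fin.castAdd p a) := fun a b ⟨h, h'⟩ => by
    simp only [Fin.lt_def, Fin.val_natAdd, Fin.val_castAdd] at h h'
    omega
  simp only [Fin.sum_univ_add, finAddFlip_apply_castAdd, finAddFlip_apply_natAdd, h3, h4, h5, h6,
    h7, false_and, and_true, if_true, if_false, Finset.sum_const_zero, add_zero, zero_add,
    Fin.append_left, Fin.append_right]
  rw [wdeg_ofFn, wdeg_ofFn, mul_comm, Finset.sum_mul_sum]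

/-- A permutation of the second factor of the coproduct comes from one of the whole word. -/
theorem tensor_permOp_comp_deconcPart (j : ℕ) {m : ℕ} (σ : Equiv.Perm (Fin m)) :
    (one R _ ⊠ permOp R d m σ) ⊚ deconcPart R X j m =
      deconcPart R X j m ⊚ permOp R d (j + m) (lastPerm j σ) := by
  ext1 w
  rw [comp_apply, comp_apply]
  by_cases h : w.length = j + m
  · obtain ⟨x, rfl⟩ := exists_ofFn_of_length h
    obtain ⟨y, z, rfl⟩ : ∃ (y : Fin j → X) (z : Fin m → X), Fin.append y z = x :=
      ⟨_, _, Fin.append_castAdd_natAdd⟩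
    rw [permOp_ofFn, map_zsmul, lin_basis, append_comp_lastPerm, koszul_lastPerm,
      List.ofFn_fin_append, List.ofFn_fin_append,
      deconcPart_append List.length_ofFn List.length_ofFn,
      deconcPart_append List.length_ofFn List.length_ofFn, lin_basis, tensor_apply, one_apply,
      permOp_ofFn, prod_zsmul_right, prod_basis]
  · rw [permOp_of_length_ne _ h, lin_basis, deconcPart_of_length_ne h, map_zero]

/-- The signed exchange of two words. -/
def flipOp (R : Type v) [Field R] (d : X → ℤ) : Op R (List X × List X) (List X × List X) :=
  ⟨fun p => sgn (wdeg d p.1 * wdeg d p.2) • basis (p.2, p.1), 0, fun _ => (memF_basis _).zsmul _⟩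

theorem flipOp_apply (a b : List X) :
    flipOp R d (a, b) = sgn (wdeg d a * wdeg d b) • basis (b, a) := rfl

/-- The exchange of the factors of the coproduct comes from a permutation of the word. -/
theorem flipOp_comp_deconcPart (q p : ℕ) :
    flipOp R d ⊚ deconcPart R X q p = deconcPart R X p q ⊚ permOp R d (q + p) (blockSwap q p) := by
  ext1 w
  rw [comp_apply, comp_apply]
  by_cases h : w.length = q + p
  · obtain ⟨x, rfl⟩ := exists_ofFn_of_length h
    obtain ⟨y, z, rfl⟩ : ∃ (y : Fin q → X) (z : Fin p → X), Fin.append y z = x :=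
      ⟨_, _, Fin.append_castAdd_natAdd⟩
    have e : List.ofFn (Fin.append z y ∘ Fin.cast (add_comm q p)) = List.ofFn z ++ List.ofFn y := by
      rw [← List.ofFn_fin_append]
      exact (List.ofFn_congr (add_comm p q) _).symm
    rw [permOp_ofFn, map_zsmul, lin_basis, append_comp_blockSwap, koszul_blockSwap, e,
      List.ofFn_fin_append, deconcPart_append List.length_ofFn List.length_ofFn,
      deconcPart_append List.length_ofFn List.length_ofFn, lin_basis, flipOp_apply]
  · rw [permOp_of_length_ne _ h, lin_basis, deconcPart_of_length_ne h, map_zero,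
      deconcPart_of_length_ne (by omega)]

theorem proj_tensor_proj (s : Set X) (t : Set Y) :
    proj R s ⊠ proj R t = proj R (s ×ˢ t) := by
  ext1 ⟨x, y⟩
  rw [tensor_apply]
  by_cases hx : x ∈ s
  · by_cases hy : y ∈ t
    · rw [proj_of_mem hx, proj_of_mem hy, prod_basis, proj_of_mem (Set.mk_mem_prod hx hy)]
    · rw [proj_of_notMem hy, prod_zero_right, proj_of_notMem fun h => hy h.2]
  · rw [proj_of_notMem hx, prod_zero_left, proj_of_notMem fun h => hx h.1]

theorem proj_univ : proj R (Set.univ : Set X) = one R X := ext' fun _ => proj_of_mem trivial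

theorem eq_of_proj_length {z z' : Nov R (J × List X × List X)}
    (h : ∀ i j, (one R J ⊠ (proj R (ofLength X i) ⊠ proj R (ofLength X j))).lin z =
      (one R J ⊠ (proj R (ofLength X i) ⊠ proj R (ofLength X j))).lin z') : z = z' := by
  refine eq_of_proj (fun p => (p.2.1.length, p.2.2.length)) fun ⟨i, j⟩ => ?_
  have e : (Set.univ : Set J) ×ˢ (ofLength X i ×ˢ ofLength X j) =
      (fun p : J × List X × List X => (p.2.1.length, p.2.2.length)) ⁻¹' {(i, j)} := by
    ext p
    simp
  have := h i j
  rwa [proj_tensor_proj, ← proj_univ, proj_tensor_proj, e] at this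

/-- Elements that are fixed by all permutations of the letters. -/
def IsSym (d : X → ℤ) (z : Nov R (J × List X)) : Prop :=
  ∀ (k : ℕ) (σ : Equiv.Perm (Fin k)), (one R J ⊠ permOp R d k σ).lin z = z

theorem IsSym.lin_deconcPart {z : Nov R (J × List X)} (hz : IsSym d z) {k i j : ℕ}
    (σ : Equiv.Perm (Fin k)) :
    (one R J ⊠ (deconcPart R X i j ⊚ permOp R d k σ)).lin z =
      (one R J ⊠ deconcPart R X i j).lin z := by
  rw [← one_comp (one R J), ← tensor_comp, lin_comp_apply, hz, one_comp]

theorem lin_proj_deconc (i j : ℕ) (z : Nov R (J × List X)) :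
    (one R J ⊠ (proj R (ofLength X i) ⊠ proj R (ofLength X j))).lin
      ((one R J ⊠ deconc R X).lin z) = (one R J ⊠ deconcPart R X i j).lin z := by
  rw [← lin_comp_apply, tensor_comp, one_comp]
  rfl

/-- The coproduct of a symmetric element is symmetric in its second factor. -/
theorem IsSym.lin_permOp_deconc {z : Nov R (J × List X)} (hz : IsSym d z) {m : ℕ}
    (σ : Equiv.Perm (Fin m)) :
    (one R J ⊠ (one R _ ⊠ permOp R d m σ)).lin ((one R J ⊠ deconc R X).lin z) =
      (one R J ⊠ deconc R X).lin z := by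
  refine eq_of_proj_length fun i j => ?_
  rw [lin_proj_deconc, ← lin_comp_apply, ← lin_comp_apply, tensor_comp, tensor_comp, tensor_comp,
    one_comp, one_comp, proj_comp_permOp, comp_one]
  have e : (proj R (ofLength X i) ⊠ (permOp R d m σ ⊚ proj R (ofLength X j))) ⊚ deconc R X =
      (one R _ ⊠ permOp R d m σ) ⊚ deconcPart R X i j := by
    rw [deconcPart, ← comp_assoc, tensor_comp, one_comp]
  by_cases hj : j = m
  · subst hj
    rw [e, tensor_permOp_comp_deconcPart, hz.lin_deconcPart]
  · rw [permOp_comp_proj σ hj]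
    rfl

/-- The coproduct of a symmetric element is cocommutative. -/
theorem IsSym.lin_flipOp_deconc {z : Nov R (J × List X)} (hz : IsSym d z) :
    (one R J ⊠ flipOp R d).lin ((one R J ⊠ deconc R X).lin z) = (one R J ⊠ deconc R X).lin z := by
  refine eq_of_proj_length fun p q => ?_
  rw [lin_proj_deconc, ← lin_comp_apply, ← lin_comp_apply, tensor_comp, tensor_comp,
    one_comp, one_comp]
  have e : (proj R (ofLength X p) ⊠ proj R (ofLength X q)) ⊚ flipOp R d =
      flipOp R d ⊚ (proj R (ofLength X q) ⊠ proj R (ofLength X p)) := by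
    ext1 ⟨a, b⟩
    rw [comp_apply, comp_apply, flipOp_apply, map_zsmul, lin_basis, tensor_apply, tensor_apply]
    by_cases ha : a ∈ ofLength X q
    · by_cases hb : b ∈ ofLength X p
      · rw [proj_of_mem ha, proj_of_mem hb, prod_basis, prod_basis, lin_basis, flipOp_apply]
      · rw [proj_of_notMem hb, prod_zero_left, prod_zero_right, map_zero, smul_zero]
    · rw [proj_of_notMem ha, prod_zero_left, prod_zero_right, map_zero, smul_zero]
  rw [e, comp_assoc]
  change (one R J ⊠ (flipOp R d ⊚ deconcPart R X q p)).lin z = _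
  rw [flipOp_comp_deconcPart, hz.lin_deconcPart]

end Perm

end GappedAInf

end

noncomputable section

namespace GappedAInf

open Nov Op

variable {R : Type v} [Field R]

/-! ### Chevalley-Eilenberg chains as symmetric Hochschild chains -/

section Shuffle

variable {X J K L : Type u} {d : X → ℤ} {dJ : J → ℤ} {dK : K → ℤ}

/-- Moving the first of two words past the module element. -/
def shift (R : Type v) [Field R] (d : X → ℤ) (dJ : J → ℤ) :
    Op R (J × List X × List X) (List X × J × List X) :=
  ⟨fun p => sgn (dJ p.1 * wdeg d p.2.1) • basis (p.2.1, p.1, p.2.2), 0,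
    fun _ => (memF_basis _).zsmul _⟩

theorem shift_apply (y : J) (a b : List X) : shift R d dJ (y, a, b) =
    sgn (dJ y * wdeg d a) • basis (a, y, b) := rfl

/-- The inclusion of `J ⊗ EX` in the bimodule bar complex: the sum over all ways of moving a first
part of the word to the other side of the module element. -/
def symInc (R : Type v) [Field R] (d : X → ℤ) (dJ : J → ℤ) :
    Op R (J × List X) (List X × J × List X) :=
  shift R d dJ ⊚ (one R J ⊠ deconc R X)

theorem symInc_apply (y : J) (w : List X) : symInc R d dJ (y, w) =
    cutSum (fun a b => sgn (dJ y * wdeg d a) • basis (a, y, b)) w := by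
  rw [symInc, comp_apply, tensor_apply, one_apply, deconc_apply, prod_cutSum_right, map_cutSum]
  exact cutSum_congr fun a b _ => by rw [prod_basis, lin_basis, shift_apply]

theorem emptyLeft_comp_symInc : emptyLeft R X J ⊚ symInc R d dJ = one R _ := by
  ext1 ⟨y, w⟩
  rw [comp_apply, symInc_apply, map_cutSum, cutSum_eq_first]
  · rw [map_zsmul, lin_basis, emptyLeft_nil, wdeg_nil, mul_zero, sgn_zero, one_smul, one_apply]
  · intro x a b
    rw [map_zsmul, lin_basis, emptyLeft_cons, smul_zero]

/-- As the coproduct of symmetric elements is cocommutative, the two inclusions agree on them. -/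
theorem IsSym.lin_symInc {z : Nov R (J × List X)} (hz : IsSym d z) :
    (symInc R d dJ).lin z = (cycInc R d dJ).lin z := by
  have h : shift R d dJ ⊚ (one R J ⊠ flipOp R d) = rotate R d dJ := by
    ext1 ⟨y, a, b⟩
    rw [comp_apply, tensor_apply, one_apply, flipOp_apply, prod_zsmul_right, prod_basis, map_zsmul,
      lin_basis, shift_apply, smul_smul, ← sgn_add, rotate_apply]
    congr 2
    ring
  rw [symInc, lin_comp_apply, ← hz.lin_flipOp_deconc, ← lin_comp_apply, h, cycInc, lin_comp_apply]

/-- The operator on `J ⊗ EX` induced by an operator on the bimodule bar complex. -/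
def onCE (d : X → ℤ) (dJ : J → ℤ) (U : Op R (List X × J × List X) (List X × K × List X)) :
    Op R (J × List X) (K × List X) :=
  emptyLeft R X K ⊚ U ⊚ symInc R d dJ

theorem IsSym.lin_onCE {z : Nov R (J × List X)} (hz : IsSym d z)
    (U : Op R (List X × J × List X) (List X × K × List X)) :
    (onCE d dJ U).lin z = (onHoch d dJ U).lin z := by
  rw [onCE, onHoch, lin_comp_apply, lin_comp_apply, hz.lin_symInc, lin_comp_apply, lin_comp_apply]

theorem onHoch_hat_apply (k : ℤ) (θ : Op R (List X × J × List X) K) (y : J) (w : List X) :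
    onHoch d dJ (hat d k (one R _) (one R _) θ) (y, w) = cutSum (fun a b => cutSum (fun c e =>
      sgn (wdeg d b * (dJ y + wdeg d a)) • map (fun y' => (y', e)) (θ (b, y, c))) a) w := by
  rw [onHoch, ← comp_assoc, comp_apply, cycInc_apply, map_cutSum]
  refine cutSum_congr fun a b _ => ?_
  rw [map_zsmul, lin_basis, emptyLeft_comp_hat, zsmul_cutSum]

theorem onCE_hat_apply (k : ℤ) (θ : Op R (List X × J × List X) K) (y : J) (w : List X) :
    onCE d dJ (hat d k (one R _) (one R _) θ) (y, w) =
      cutSum (fun c e => map (fun y' => (y', e)) ((θ ⊚ symInc R d dJ) (y, c))) w := by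
  rw [onCE, ← comp_assoc, comp_apply, symInc_apply, map_cutSum]
  have h : ∀ a r, (emptyLeft R X K ⊚ hat d k (one R _) (one R _) θ).lin
      (sgn (dJ y * wdeg d a) • basis (a, y, r)) = cutSum (fun b e =>
        sgn (dJ y * wdeg d a) • map (fun y' => (y', e)) (θ (a, y, b))) r := fun a r => by
    rw [map_zsmul, lin_basis, emptyLeft_comp_hat, zsmul_cutSum]
  simp only [h]
  rw [← cutSum_assoc fun a b e => sgn (dJ y * wdeg d a) • map (fun y' => (y', e)) (θ (a, y, b))]
  refine cutSum_congr fun c e _ => ?_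
  rw [comp_apply, symInc_apply, map_cutSum, map_cutSum]
  exact cutSum_congr fun a b _ => by rw [map_zsmul, map_zsmul, lin_basis]

/-- The operators induced by bicomodule maps preserve symmetric elements: the word that is left over
is the second factor of the coproduct of a symmetric element. -/
theorem IsSym.lin_onCE_hat {z : Nov R (J × List X)} (hz : IsSym d z) (k : ℤ)
    (θ : Op R (List X × J × List X) K) :
    IsSym d ((onCE d dJ (hat d k (one R _) (one R _) θ)).lin z) := by
  intro m σ
  have e1 : onCE d dJ (hat d k (one R _) (one R _) θ) =
      ((θ ⊚ symInc R d dJ) ⊠ one R _) ⊚ of (fun p : J × List X × List X => ((p.1, p.2.1), p.2.2)) ⊚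
        (one R J ⊠ deconc R X) := by
    ext1 ⟨y, w⟩
    rw [onCE_hat_apply, comp_apply, comp_apply, tensor_apply, one_apply, deconc_apply,
      prod_cutSum_right, map_cutSum, map_cutSum]
    exact cutSum_congr fun c e _ => by
      rw [prod_basis, lin_basis, of_apply, lin_basis, tensor_apply, one_apply, prod_basis_right]
  have e2 : of (fun p : J × List X × List X => ((p.1, p.2.1), p.2.2)) ⊚
      (one R J ⊠ (one R (List X) ⊠ permOp R d m σ)) = (one R (J × List X) ⊠ permOp R d m σ) ⊚
        of (fun p : J × List X × List X => ((p.1, p.2.1), p.2.2)) := by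
    ext1 ⟨y, a, b⟩
    rw [comp_apply, comp_of_apply, tensor_apply, tensor_apply, tensor_apply, one_apply, one_apply,
      one_apply, prod_basis_left, prod_basis_left, prod_basis_left, map_map, lin_of, map_map]
    rfl
  rw [e1, lin_comp_apply, lin_comp_apply, ← lin_comp_apply, tensor_comp, one_comp]
  conv_rhs => rw [← hz.lin_permOp_deconc σ, ← lin_comp_apply (of _), e2]
  rw [lin_comp_apply (one R (J × List X) ⊠ permOp R d m σ), ← lin_comp_apply (_ ⊠ one R (List X)),
    tensor_comp, comp_one, one_comp, comp_one]

end Shuffle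

/-! ### The complexes in terms of the bimodule bar complex -/

section Complexes

variable {A : AInfAlgebra.{u} R} {κ : HomKind} {k : ℤ} {M N : AInfBimod A A}
  {U : Op R (List A.ι × M.ι × List A.ι) (List A.ι × N.ι × List A.ι)}

theorem IsHom.preservesHoch (hU : IsHom κ k M N (one R _) (one R _) U) :
    PreservesHoch A.sdeg M.sdeg N.sdeg U := by
  refine preservesHoch_of_exists ?_
  rw [hU.comod.eq_hat]
  refine hat_comp_cycInc (dK := N.sdeg) ?_
  have := (homog_cogen A.sdeg N.sdeg A.sdeg).comp hU.homog
  rwa [add_zero] at this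

theorem AInfBimod.preservesHoch_dOp (M : AInfBimod A A) :
    PreservesHoch A.sdeg M.sdeg M.sdeg M.dOp := by
  refine preservesHoch_of_exists ?_
  obtain ⟨T, hT⟩ := hat_comp_cycInc (R := R) M.homog_nOp
  refine ⟨T + sign M.sdeg 1 ⊠ A.dOp, ?_⟩
  rw [dOp, bimodDiff, comp_add, ← hT, ← tensor_comp_cycInc A.homog_dOp A.deconc_comp_dOp,
    ← add_comp]
  congr 1
  abel

theorem AInfBimod.emptyLeft_comp_dOp (M : AInfBimod A A) : emptyLeft R A.ι M.ι ⊚ M.dOp =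
    emptyLeft R A.ι M.ι ⊚ hat A.sdeg 1 (one R _) (one R _) M.nOp +
      (sign M.sdeg 1 ⊠ A.dOp) ⊚ emptyLeft R A.ι M.ι := by
  have h1 : emptyLeft R A.ι M.ι ⊚ (A.dOp ⊠ one R _) = 0 := by
    rw [emptyLeft, comp_assoc, tensor_comp, A.counit_comp_dOp, zero_tensor, comp_zero]
  have h2 : emptyLeft R A.ι M.ι ⊚ (sign (wdeg A.sdeg) 1 ⊠ (sign M.sdeg 1 ⊠ A.dOp)) =
      (sign M.sdeg 1 ⊠ A.dOp) ⊚ emptyLeft R A.ι M.ι := by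
    have h3 : of (fun p : PUnit.{u + 1} × M.ι × List A.ι => p.2) ⊚
        (one R _ ⊠ (sign M.sdeg 1 ⊠ A.dOp)) = (sign M.sdeg 1 ⊠ A.dOp) ⊚
        of (fun p : PUnit.{u + 1} × M.ι × List A.ι => p.2) := by
      ext1 ⟨x, p⟩
      rw [comp_of_apply, comp_apply, tensor_apply, one_apply (X := PUnit.{u + 1}) x,
        prod_basis_left, lin_of, map_map]
      exact lin_one_apply _
    rw [emptyLeft, ← comp_assoc, ← h3, comp_assoc, comp_assoc, tensor_comp, tensor_comp,
      counit_comp_sign, one_comp, comp_one, one_comp]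
  rw [dOp, bimodDiff, comp_add, comp_add, h1, h2, zero_add]

theorem cyclicOp_eq (θ : Op R (List A.ι × M.ι × List A.ι) N.ι) (k : ℤ) :
    cyclicOp M N (fun x y z => θ (x, y, z)) =
      (onHoch A.sdeg M.sdeg (hat A.sdeg k (one R _) (one R _) θ)).app := by
  funext ⟨y, w⟩
  rw [onHoch_hat_apply, cyclicOp, cutSum, ← Finset.sum_range_reflect]
  refine Finset.sum_congr rfl fun i hi => ?_
  rw [Finset.mem_range] at hi
  have e1 : w.length - (w.length + 1 - 1 - i) = i := by omega
  have e2 : w.length + 1 - (w.length + 1 - 1 - i) = (w.take i).length + 1 := by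
    rw [List.length_take]
    omega
  rw [lastPart, initPart, e1, e2, cutSum]
  refine Finset.sum_congr rfl fun j hj => ?_
  rw [Finset.mem_range, List.length_take] at hj
  rw [List.take_take, min_eq_left (by omega)]
  rfl

theorem ceModOp_eq (θ : Op R (List A.ι × M.ι × List A.ι) N.ι) (k : ℤ) :
    ceModOp M N (fun x y z => θ (x, y, z)) =
      (onCE A.sdeg M.sdeg (hat A.sdeg k (one R _) (one R _) θ)).app := by
  funext ⟨y, w⟩
  rw [onCE_hat_apply]
  refine Finset.sum_congr rfl fun j _ => ?_
  beta_reduce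
  congr 1
  rw [comp_apply, symInc_apply, map_cutSum]
  refine Finset.sum_congr rfl fun p _ => ?_
  beta_reduce
  rw [map_zsmul, lin_basis]
  rfl

theorem BimodHom.op_eq_hat_one (φ : BimodHom κ M N (AInfHom.id A) (AInfHom.id A)) :
    φ.op = GappedAInf.hat A.sdeg 0 (one R _) (one R _) φ.φOp := by
  rw [op, AInfHom.op_id]

theorem hochMap_eq (φ : BimodHom κ M N (AInfHom.id A) (AInfHom.id A)) :
    hochMap φ = (onHoch A.sdeg M.sdeg φ.op).lin := by
  rw [φ.op_eq_hat_one, hochMap, Op.lin, ← cyclicOp_eq]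
  rfl

theorem chevEilMap_eq (φ : BimodHom κ M N (AInfHom.id A) (AInfHom.id A)) :
    chevEilMap φ = (onCE A.sdeg M.sdeg φ.op).lin := by
  rw [φ.op_eq_hat_one, chevEilMap, Op.lin, ← ceModOp_eq]
  rfl

theorem tensor_dOp_apply (y : M.ι) (w : List A.ι) : (sign M.sdeg 1 ⊠ A.dOp) (y, w) =
    sgn (M.sdeg y) • map (fun w' => (y, w')) (A.dWord w) := by
  rw [tensor_apply, Op.sign_apply, one_mul, prod_zsmul_left, prod_basis_left]
  rfl

theorem hoch_d (M : AInfBimod A A) : (hoch M).d = (onHoch A.sdeg M.sdeg M.dOp).lin := by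
  have h : (onHoch A.sdeg M.sdeg M.dOp).app = hochOp M := funext fun ⟨y, w⟩ => by
    rw [onHoch, ← comp_assoc, M.emptyLeft_comp_dOp, add_comp, comp_assoc, comp_assoc,
      emptyLeft_comp_cycInc, comp_one, add_comm, Op.add_apply, tensor_dOp_apply, hochOp]
    congr 1
    exact (congrFun (cyclicOp_eq M.nOp 1) (y, w)).symm
  rw [Op.lin, h]
  rfl

theorem chevEil_d (M : AInfBimod A A) : (chevEil M).d = (onCE A.sdeg M.sdeg M.dOp).lin := by
  have h : (onCE A.sdeg M.sdeg M.dOp).app = ceOp M := funext fun ⟨y, w⟩ => by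
    rw [onCE, ← comp_assoc, M.emptyLeft_comp_dOp, add_comp, comp_assoc, comp_assoc,
      emptyLeft_comp_symInc, comp_one, Op.add_apply, tensor_dOp_apply, ceOp]
    congr 1
    exact (congrFun (ceModOp_eq M.nOp 1) (y, w)).symm
  rw [Op.lin, h]
  rfl

theorem symAct_eq (M : AInfBimod A A) (k : ℕ) (σ : Equiv.Perm (Fin k)) :
    symAct M k σ = (one R M.ι ⊠ permOp R A.sdeg k σ).lin := by
  have h : (one R M.ι ⊠ permOp R A.sdeg k σ).app = fun (v, w) =>
      if h : k = w.length then
        koszul (fun i => A.sdeg (w.get (i.cast h))) σ •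
          basis (v, List.ofFn fun i => w.get ((σ i).cast h))
      else basis (v, w) := funext fun ⟨v, w⟩ => by
    rw [tensor_apply, one_apply]
    by_cases h : k = w.length
    · rw [show permOp R A.sdeg k σ w = _ from dif_pos h, prod_zsmul_right, prod_basis]
      dsimp only
      rw [dif_pos h]
    · rw [show permOp R A.sdeg k σ w = _ from dif_neg h, prod_basis]
      dsimp only
      rw [dif_neg h]
  rw [Op.lin, h, symAct]

theorem mem_symChains_iff {z : Nov R (HochIdx M)} : z ∈ symChains M ↔ IsSym A.sdeg z := by
  simp only [symChains, Submodule.mem_iInf, LinearMap.mem_ker, LinearMap.sub_apply,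
    LinearMap.id_apply, sub_eq_zero, symAct_eq]
  rfl

end Complexes

end GappedAInf

end

noncomputable section

namespace GappedAInf

open Nov Op

variable {R : Type v} [Field R]

/-! ### Chain homotopy equivalences and homology -/

namespace Cplx

variable {K L : Cplx.{u} R} {k : Coeffs}

/-- `f` maps chains to chains and commutes with the differentials as long as they stay in the
submodules of chains. -/
structure IsChainMap (K L : Cplx.{u} R) (k : Coeffs) (f : Nov R K.X →ₗ[Novikov R] Nov R L.X) :
    Prop where
  chains : ∀ n, ∀ z ∈ K.chains k n, f z ∈ L.chains k n
  comm : ∀ z ∈ K.sub, K.d z ∈ K.sub → L.d (f z) = f (K.d z)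

variable {f : Nov R K.X →ₗ[Novikov R] Nov R L.X} {g : Nov R L.X →ₗ[Novikov R] Nov R K.X}
  {h : Nov R K.X →ₗ[Novikov R] Nov R K.X} {h' : Nov R L.X →ₗ[Novikov R] Nov R L.X}

theorem IsChainMap.mem_cycles (hf : IsChainMap K L k f) {n : ℤ} {z : Nov R K.X}
    (hz : z ∈ K.cycles k n) : f z ∈ L.cycles k n := by
  have hd : K.d z = 0 := hz.2
  refine ⟨hf.chains n z hz.1, ?_⟩
  change L.d (f z) = 0
  rw [hf.comm z hz.1.1 (by rw [hd]; exact zero_mem _), hd, map_zero]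

/-- The restriction of a chain map to cycles. -/
def IsChainMap.onCycles (hf : IsChainMap K L k f) (n : ℤ) :
    K.cycles k n →ₗ[degZero R k] L.cycles k n :=
  (f.restrictScalars (degZero R k)).restrict fun _ => hf.mem_cycles

/-- The map of homology induced by a chain map. -/
def IsChainMap.onHomology (hf : IsChainMap K L k f) (n : ℤ) :
    K.homology k n →ₗ[degZero R k] L.homology k n :=
  Submodule.mapQ _ _ (hf.onCycles n) fun z hz => by
    obtain ⟨w, hw, hwz⟩ := hz
    -- The chain `w` is in `K.sub`, and so is `K.d w`, being a cycle.
    replace hwz : K.d w = z.1 := hwz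
    refine ⟨f w, hf.chains _ w hw, ?_⟩
    change L.d (f w) = f z.1
    rw [hf.comm w hw.1 (by rw [hwz]; exact z.2.1.1), hwz]

theorem inducesIso_of_homotopy (hf : IsChainMap K L k f) (hg : IsChainMap L K k g)
    (hh : ∀ n, ∀ z ∈ K.chains k n, h z ∈ K.chains k (n - 1))
    (hh' : ∀ n, ∀ z ∈ L.chains k n, h' z ∈ L.chains k (n - 1))
    (hgf : ∀ z ∈ K.sub, K.d z = 0 → g (f z) - z = K.d (h z))
    (hfg : ∀ z ∈ L.sub, L.d z = 0 → f (g z) - z = L.d (h' z)) (n : ℤ) :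
    K.InducesIso L f k n := by
  refine ⟨LinearEquiv.ofLinearMap (hf.onHomology n) (hg.onHomology n) ?_ ?_,
    fun z => ⟨hf.mem_cycles z.2, rfl⟩⟩
  · refine LinearMap.ext fun z => ?_
    obtain ⟨z, rfl⟩ := Submodule.Quotient.mk_surjective _ z
    exact (Submodule.Quotient.eq _).2
      ⟨h' z.1, hh' n z.1 z.2.1, (hfg z.1 z.2.1.1 z.2.2).symm⟩
  · refine LinearMap.ext fun z => ?_
    obtain ⟨z, rfl⟩ := Submodule.Quotient.mk_surjective _ z
    exact (Submodule.Quotient.eq _).2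
      ⟨h z.1, hh n z.1 z.2.1, (hgf z.1 z.2.1.1 z.2.2).symm⟩

end Cplx

/-! ### Invariance of Hochschild and Chevalley-Eilenberg homology -/

variable {A : AInfAlgebra.{u} R} {κ : HomKind} {k : ℤ} {M N : AInfBimod A A}
  {U : Op R (List A.ι × M.ι × List A.ι) (List A.ι × N.ι × List A.ι)}

theorem IsHom.homog_onHoch (hU : IsHom κ k M N (one R _) (one R _) U) :
    Homog (hochDeg M) (hochDeg N) k (onHoch A.sdeg M.sdeg U) := by
  have h := ((homog_emptyLeft A.sdeg N.sdeg).comp hU.homog).comp (homog_cycInc (R := R)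
    (d := A.sdeg) (dJ := M.sdeg))
  rw [zero_add, add_zero, comp_assoc] at h
  exact h

theorem IsHom.raises_onHoch (hU : IsHom .filtered k M N (one R _) (one R _) U) :
    Raises 0 (onHoch A.sdeg M.sdeg U) := by
  obtain ⟨c, hc, h⟩ := hU.loss
  have h := (raises_emptyLeft.comp h).comp (raises_cycInc (R := R) (d := A.sdeg) (dJ := M.sdeg))
  rw [comp_assoc] at h
  refine h.mono ?_
  have : c = 0 := hc
  linarith

/-- A homotopy equivalence induces isomorphisms on the homology of all functorial subcomplexes `S`
of the Hochschild complexes. The differential `D` and the map `f` need to have their usual values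
on `S` only. -/
theorem BimodHom.IsHomotopyEquiv.inducesIso
    {S : ∀ M : AInfBimod A A, Submodule (Novikov R) (Nov R (HochIdx M))}
    {D : ∀ M : AInfBimod A A, Nov R (HochIdx M) →ₗ[Novikov R] Nov R (HochIdx M)}
    (hS : ∀ {M N : AInfBimod A A} {k : ℤ}
      {U : Op R (List A.ι × M.ι × List A.ι) (List A.ι × N.ι × List A.ι)},
      IsHom κ k M N (one R _) (one R _) U → ∀ z ∈ S M, (onHoch A.sdeg M.sdeg U).lin z ∈ S N)
    (hD : ∀ M, ∀ z ∈ S M, D M z = (onHoch A.sdeg M.sdeg M.dOp).lin z)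
    {φ : BimodHom κ M N (AInfHom.id A) (AInfHom.id A)} (hφ : φ.IsHomotopyEquiv)
    {f : Nov R (HochIdx M) →ₗ[Novikov R] Nov R (HochIdx N)}
    (hf : ∀ z ∈ S M, f z = (onHoch A.sdeg M.sdeg φ.op).lin z)
    {c : Coeffs} (hc : c = .nov₀ → κ = .filtered) (n : ℤ) :
    Cplx.InducesIso ⟨HochIdx M, hochDeg M, S M, D M⟩ ⟨HochIdx N, hochDeg N, S N, D N⟩ f c n := by
  obtain ⟨U, hU, ⟨V, hV, hV'⟩, W, hW, hW'⟩ := hφ.exists_inverse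
  have hφ' : IsHom κ 0 M N (one R _) (one R _) φ.op := by
    have h := φ.isHom_op
    rwa [AInfHom.op_id] at h
  have chains : ∀ {M N : AInfBimod A A} {k : ℤ}
      {U : Op R (List A.ι × M.ι × List A.ι) (List A.ι × N.ι × List A.ι)},
      IsHom κ k M N (one R _) (one R _) U → ∀ n,
      ∀ z ∈ Cplx.chains ⟨HochIdx M, hochDeg M, S M, D M⟩ c n, (onHoch A.sdeg M.sdeg U).lin z ∈
        Cplx.chains ⟨HochIdx N, hochDeg N, S N, D N⟩ c (n + k) := by
    intro M N k U hU n z hz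
    refine ⟨hS hU z hz.1, hU.homog_onHoch.lin hz.2.1, fun h => ?_⟩
    obtain rfl := hc h
    have := hU.raises_onHoch.lin (hz.2.2 h)
    rwa [add_zero] at this
  have comm : ∀ {M N : AInfBimod A A}
      {U : Op R (List A.ι × M.ι × List A.ι) (List A.ι × N.ι × List A.ι)},
      IsHom κ 0 M N (one R _) (one R _) U → homDiff M N 0 U = 0 → ∀ z ∈ S M, D M z ∈ S M →
      D N ((onHoch A.sdeg M.sdeg U).lin z) = (onHoch A.sdeg M.sdeg U).lin (D M z) := by
    intro M N U hU h0 z hz _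
    rw [homDiff, sgn_zero, one_smul, sub_eq_zero] at h0
    rw [hD N _ (hS hU z hz), hD M z hz, ← lin_comp_apply, ← lin_comp_apply,
      ← onHoch_comp _ hU.preservesHoch, ← onHoch_comp _ M.preservesHoch_dOp, h0]
  have htpy : ∀ {M N : AInfBimod A A}
      {U : Op R (List A.ι × M.ι × List A.ι) (List A.ι × N.ι × List A.ι)}
      {V : Op R (List A.ι × N.ι × List A.ι) (List A.ι × M.ι × List A.ι)}
      {T : Op R (List A.ι × M.ι × List A.ι) (List A.ι × M.ι × List A.ι)},
      IsHom κ 0 M N (one R _) (one R _) U →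
      IsHom κ (-1) M M (one R _) (one R _) T → homDiff M M (-1) T = V ⊚ U - one R _ →
      ∀ z ∈ S M, D M z = 0 →
      (onHoch A.sdeg N.sdeg V).lin ((onHoch A.sdeg M.sdeg U).lin z) - z =
        D M ((onHoch A.sdeg M.sdeg T).lin z) := by
    intro M N U V T hU hT h z hz hz0
    rw [hD M z hz] at hz0
    have h1 := congrArg (fun Q => (onHoch A.sdeg M.sdeg Q).lin z) h
    simp only [homDiff, onHoch_sub, onHoch_zsmul, onHoch_one, onHoch_comp _ hU.preservesHoch,
      onHoch_comp _ hT.preservesHoch, onHoch_comp _ M.preservesHoch_dOp] at h1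
    rw [lin_sub_apply, lin_sub_apply, lin_zsmul_apply,
      lin_comp_apply, lin_comp_apply, hz0, map_zero, smul_zero, sub_zero, lin_comp_apply,
      lin_one_apply] at h1
    rw [← h1, hD M _ (hS hT z hz)]
  refine Cplx.inducesIso_of_homotopy (g := (onHoch A.sdeg N.sdeg U).lin)
    (h := (onHoch A.sdeg M.sdeg W).lin) (h' := (onHoch A.sdeg N.sdeg V).lin)
    ⟨fun m z hz => ?_, fun z hz hdz => ?_⟩ ⟨fun m z hz => ?_, fun z hz hdz => ?_⟩
    (chains hW) (chains hV) (fun z hz hdz => ?_) (fun z hz hdz => ?_) n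
  · have := chains hφ' m z hz
    rw [add_zero, ← hf z hz.1] at this
    exact this
  · change D N (f z) = f (D M z)
    rw [hf z hz, hf _ hdz, comm hφ' φ.homDiff_op z hz hdz]
  · have := chains hU.isHom m z hz
    rwa [add_zero] at this
  · exact comm hU.isHom hU.closed z hz hdz
  · rw [hf z hz]
    exact htpy hφ' hW hW' z hz hdz
  · rw [hf _ (hS hU.isHom z hz)]
    exact htpy hU.isHom hV hV' z hz hdz

/-- As bicomodule maps preserve the Hochschild chains and, on symmetric elements, agree with the
operators of `onCE`, they preserve the symmetric Hochschild chains. -/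
theorem IsHom.lin_onHoch_mem_symChains (hU : IsHom κ k M N (one R _) (one R _) U)
    {z : Nov R (HochIdx M)} (hz : z ∈ symChains M) :
    (onHoch A.sdeg M.sdeg U).lin z ∈ symChains N := by
  rw [mem_symChains_iff] at hz ⊢
  rw [← hz.lin_onCE, hU.comod.eq_hat]
  exact hz.lin_onCE_hat k _

theorem BimodHom.IsHomotopyEquiv.hoch_inducesIso
    {φ : BimodHom κ M N (AInfHom.id A) (AInfHom.id A)} (hφ : φ.IsHomotopyEquiv) {c : Coeffs}
    (hc : c = .nov₀ → κ = .filtered) (n : ℤ) : (hoch M).InducesIso (hoch N) (hochMap φ) c n :=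
  hφ.inducesIso (S := fun _ => ⊤) (D := fun M => (hoch M).d) (fun _ _ _ => Submodule.mem_top)
    (fun M _ _ => by rw [hoch_d]) (fun _ _ => by rw [hochMap_eq]) hc n

theorem BimodHom.IsHomotopyEquiv.chevEil_inducesIso
    {φ : BimodHom κ M N (AInfHom.id A) (AInfHom.id A)} (hφ : φ.IsHomotopyEquiv) {c : Coeffs}
    (hc : c = .nov₀ → κ = .filtered) (n : ℤ) :
    (chevEil M).InducesIso (chevEil N) (chevEilMap φ) c n :=
  hφ.inducesIso (S := symChains) (D := fun M => (chevEil M).d)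
    (fun hU _ hz => hU.lin_onHoch_mem_symChains hz)
    (fun M _ hz => by rw [chevEil_d, (mem_symChains_iff.1 hz).lin_onCE])
    (fun _ hz => by rw [chevEilMap_eq, (mem_symChains_iff.1 hz).lin_onCE]) hc n

end GappedAInf

end

theorem mainTheorem6 {R : Type v} [Field R] [CharZero R] {A : AInfAlgebra.{u} R}
    (hA : A.IsGapped) {M N : AInfBimod A A} (hM : M.IsGapped) (hN : N.IsGapped)
    (κ : HomKind) (φ : BimodHom κ M N (AInfHom.id A) (AInfHom.id A)) (hφ : φ.IsGapped)
    (hequiv : φ.IsHomotopyEquiv) :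
    (∀ n : ℤ, (hoch M).InducesIso (hoch N) (hochMap φ) .nov n ∧
      (chevEil M).InducesIso (chevEil N) (chevEilMap φ) .nov n) ∧
    (κ = .filtered → ∀ n : ℤ, (hoch M).InducesIso (hoch N) (hochMap φ) .nov₀ n ∧
      (chevEil M).InducesIso (chevEil N) (chevEilMap φ) .nov₀ n) := by
  have hnov : Coeffs.nov = .nov₀ → κ = .filtered := fun h => Coeffs.noConfusion h
  exact ⟨fun n => ⟨hequiv.hoch_inducesIso hnov n, hequiv.chevEil_inducesIso hnov n⟩,
    fun hκ n => ⟨hequiv.hoch_inducesIso (fun _ => hκ) n, hequiv.chevEil_inducesIso (fun _ => hκ) n⟩⟩
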